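/- Let $G$ be a discrete group. A *$G$-category* is a small category internal to $G$-sets (its objects and its morphisms form $G$-sets, and source, target, identity and composition are $G$-maps); $G$-functors and $G$-transformations are the internal functors and natural transformations. Let $\mathbf{Assoc}$ be the associativity operad in sets: $\mathbf{Assoc}(n)=\Sigma_n$ as a right $\Sigma_n$-set, with unit $1=e_1$ and $\gamma(\sigma;\tau_1,\dots,\tau_k)=\sigma(m_1,\dots,m_k)(\tau_1\oplus\cdots\oplus\tau_k)$ for $\tau_i\in\Sigma_{m_i}$. For a set $S$ let $\mathcal E S$ be the chaotic category on $S$ (exactly one morphism between any two objects); $\mathcal EG$ is a $G$-category by left multiplication. Let $\mathscr P=\mathcal E\,\mathbf{Assoc}$ with trivial $G$-action, and let $\mathscr P_G=\mathbf{Cat}(\mathcal EG,\mathscr P)$ be the operad of $G$-categories whose $n$-th term consists of all (not necessarily equivariant) functors $\mathcal EG\to\mathscr P(n)$ and all natural transformations, with $G$ acting by conjugation and with the structure induced from $\mathscr P$. Write $\mathscr O=\mathscr P_G$. An *$\mathscr O$-pseudoalgebra* $(\mathscr A,\theta,\varphi)$ is a $G$-category $\mathscr A$ with $G$-functors $\theta_n\colon\mathscr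 O(n)\times\mathscr A^n\to\mathscr A$ ($n\ge 0$) and invertible $G$-transformations $$\varphi(n;m_1,\dots,m_n)\colon\ \theta_n\circ\Big(\mathrm{id}\times\prod_r\theta_{m_r}\Big)\Longrightarrow\theta_{m}\circ(\gamma\times\mathrm{id})\circ\pi,\qquad m=\sum_r m_r,$$ of functors $\mathscr O(n)\times\prod_r(\mathscr O(m_r)\times\mathscr A^{m_r})\to\mathscr A$, where $\pi$ shuffles the variables, such that: (i) $\theta_n(o\rho;a)=\theta_n(o;\rho a)$ for $\rho\in\Sigma_n$; (ii) $\varphi$ is the identity at operations of the form $(o;1,\dots,1,0,1,\dots,1)$ with $o\in\mathscr O(n)$, $1\in\mathscr O(1)$ the unit and $0$ the unique object of $\mathscr O(0)$ in any one place; (iii) $\theta_1(1;a)=a$; (iv) $\varphi$ is invariant under permuting the blocks and permuting inside the blocks; (v) $\varphi(1;n)$ is the identity at $(1;x)$ and $\varphi(n;1,\dots,1)$ is the identity at $(x;1,\dots,1)$, for $x\in\mathscr O(n)$; (vi) the two ways of contracting a threefold iterated action by means of $\varphi$ agree. It is a *strict algebra* if every $\varphi$ is an identity. A *pseudomorphism*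 $(f,\zeta)\colon(\mathscr A,\theta,\varphi)\to(\mathscr B,\xi,\psi)$ is a $G$-functor $f$ with invertible $G$-transformations $\zeta_n\colon\xi_n\circ(\mathrm{id}\times f^n)\Rightarrow f\circ\theta_n$ such that $\zeta_0$ is the identity, $\zeta_1$ is the identity at the unit $1\in\mathscr O(1)$, the $\zeta_n$ are $\Sigma_n$-equivariant, and for all $n,m_1,\dots,m_n$ the pasting of $\mathrm{id}\times\prod_r\zeta_{m_r}$, $\zeta_n$ and $\varphi$ equals the pasting of $\psi$ and $\zeta_m$. It is a *strict map* if every $\zeta_n$ is an identity. An *algebra 2-cell* $(f,\zeta)\Rightarrow(g,\kappa)$ is a $G$-transformation $\lambda\colon f\Rightarrow g$ with $\kappa_n\cdot\xi_n(\mathrm{id}\times\lambda^n)=(\lambda\theta_n)\cdot\zeta_n$ for all $n$. The *(genuine) symmetric monoidal $G$-categories* are the $\mathscr P_G$-pseudoalgebras; with the pseudomorphisms and the algebra 2-cells they form a 2-category $\mathscr P_G\text{-}\mathbf{PsAlg}$. The *(genuine) permutative $G$-categories* are the strict $\mathscr P_G$-algebras; with the strict maps and the algebra 2-cells they form a 2-category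 $\mathscr P_G\text{-}\mathbf{AlgSt}$. **Corollary.** The inclusion 2-functor $\mathbb J\colon\mathscr P_G\text{-}\mathbf{AlgSt}\to\mathscr P_G\text{-}\mathbf{PsAlg}$ has a left 2-adjoint $\mathbf{St}$: there are a 2-functor $\mathbf{St}\colon\mathscr P_G\text{-}\mathbf{PsAlg}\to\mathscr P_G\text{-}\mathbf{AlgSt}$ and 2-natural transformations $\mathrm{Id}\Rightarrow\mathbb J\,\mathbf{St}$ (the unit) and $\mathbf{St}\,\mathbb J\Rightarrow\mathrm{Id}$ (the counit) that satisfy the triangle identities. Moreover, for every symmetric monoidal $G$-category $\mathscr X$ the component $\mathscr X\to\mathbb J\,\mathbf{St}\,\mathscr X$ of the unit is an equivalence of symmetric monoidal $G$-categories, that is, an (adjoint) equivalence in the 2-category $\mathscr P_G\text{-}\mathbf{PsAlg}$. -/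

import Mathlib

universe u v w v' w'

namespace GSym

open CategoryTheory Bicategory

/-! ### Categories internal to `G`-sets -/

/-- A `G`-category: a category internal to the category of `G`-sets. It has a `G`-set of objects and
a `G`-set of morphisms; source, target, identity and composition are `G`-maps. Composition is
written in diagrammatic order and is defined on the pullback of `tgt` and `src`. -/
structure GCat (G : Type u) [Group G] : Type (max u (v + 1)) where
  Ob : Type v
  Mor : Type v
  obAct : MulAction G Ob
  morAct : MulAction G Mor
  src : Mor → Ob
  tgt : Mor → Ob
  idt : Ob → Mor
  comp : (f g : Mor) → tgt f = src g → Mor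
  src_idt : ∀ x, src (idt x) = x
  tgt_idt : ∀ x, tgt (idt x) = x
  src_comp : ∀ f g h, src (comp f g h) = src f
  tgt_comp : ∀ f g h, tgt (comp f g h) = tgt g
  idt_comp : ∀ f, comp (idt (src f)) f (tgt_idt _) = f
  comp_idt : ∀ f, comp f (idt (tgt f)) (src_idt _).symm = f
  assoc : ∀ (f g k) (h₁ : tgt f = src g) (h₂ : tgt g = src k),
    comp (comp f g h₁) k ((tgt_comp _ _ _).trans h₂) =
      comp f (comp g k h₂) (h₁.trans (src_comp _ _ _).symm)
  src_smul : ∀ (c : G) (f : Mor), src (c • f) = c • src f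
  tgt_smul : ∀ (c : G) (f : Mor), tgt (c • f) = c • tgt f
  idt_smul : ∀ (c : G) (x : Ob), idt (c • x) = c • idt x
  comp_smul : ∀ (c : G) (f g : Mor) (h : tgt f = src g),
    comp (c • f) (c • g) (by rw [tgt_smul, src_smul, h]) = c • comp f g h

attribute [instance] GCat.obAct GCat.morAct
attribute [simp] GCat.src_idt GCat.tgt_idt GCat.src_comp GCat.tgt_comp
  GCat.src_smul GCat.tgt_smul

variable {G : Type u} [Group G]

/-- A functor between the underlying categories, not necessarily `G`-equivariant. -/
@[ext]
structure UFunctor (A : GCat.{u, v} G) (B : GCat.{u, w} G) where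
  obj : A.Ob → B.Ob
  mor : A.Mor → B.Mor
  src_mor : ∀ f, B.src (mor f) = obj (A.src f)
  tgt_mor : ∀ f, B.tgt (mor f) = obj (A.tgt f)
  mor_idt : ∀ x, mor (A.idt x) = B.idt (obj x)
  mor_comp : ∀ f g (h : A.tgt f = A.src g),
    mor (A.comp f g h) = B.comp (mor f) (mor g) (by rw [tgt_mor, src_mor, h])

attribute [simp] UFunctor.src_mor UFunctor.tgt_mor

/-- A `G`-functor: a functor internal to `G`-sets. -/
structure GFunctor (A : GCat.{u, v} G) (B : GCat.{u, w} G) extends UFunctor A B where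
  obj_smul : ∀ (c : G) x, obj (c • x) = c • obj x
  mor_smul : ∀ (c : G) f, mor (c • f) = c • mor f

/-- A natural transformation of (not necessarily equivariant) functors. -/
@[ext]
structure UTrans {A : GCat.{u, v} G} {B : GCat.{u, w} G} (F F' : UFunctor A B) where
  app : A.Ob → B.Mor
  src_app : ∀ x, B.src (app x) = F.obj x
  tgt_app : ∀ x, B.tgt (app x) = F'.obj x
  naturality : ∀ f,
    B.comp (F.mor f) (app (A.tgt f)) (by rw [F.tgt_mor, src_app]) =
      B.comp (app (A.src f)) (F'.mor f) (by rw [F'.src_mor, tgt_app])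

attribute [simp] UTrans.src_app UTrans.tgt_app

/-- A `G`-transformation: a natural transformation internal to `G`-sets. -/
structure GTrans {A : GCat.{u, v} G} {B : GCat.{u, w} G} (F F' : GFunctor A B) extends
    UTrans F.toUFunctor F'.toUFunctor where
  app_smul : ∀ (c : G) x, app (c • x) = c • app x

theorem GFunctor.ext' {A : GCat.{u, v} G} {B : GCat.{u, w} G} {F F' : GFunctor A B}
    (ho : ∀ x, F.obj x = F'.obj x) (hm : ∀ f, F.mor f = F'.mor f) : F = F' := by
  cases F with | mk F _ _ => cases F' with | mk F' _ _ =>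
  have : F = F' := UFunctor.ext (funext ho) (funext hm)
  subst this; rfl

theorem GTrans.ext' {A : GCat.{u, v} G} {B : GCat.{u, w} G} {F F' : GFunctor A B}
    {s t : GTrans F F'} (h : ∀ x, s.app x = t.app x) : s = t := by
  cases s with | mk s _ => cases t with | mk t _ =>
  have : s = t := UTrans.ext (funext h)
  subst this; rfl

namespace GCat

theorem comp_congr (A : GCat.{u, v} G) {f f' g g' : A.Mor} (hf : f = f') (hg : g = g')
    (h : A.tgt f = A.src g) : A.comp f g h = A.comp f' g' (by rw [← hf, ← hg, h]) := by
  subst hf; subst hg; rfl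

theorem idt_comp' (A : GCat.{u, v} G) (x : A.Ob) (f : A.Mor) (h : A.tgt (A.idt x) = A.src f) :
    A.comp (A.idt x) f h = f := by
  have hx : x = A.src f := by rw [← h, A.tgt_idt]
  subst hx; exact A.idt_comp f

theorem comp_idt' (A : GCat.{u, v} G) (x : A.Ob) (f : A.Mor) (h : A.tgt f = A.src (A.idt x)) :
    A.comp f (A.idt x) h = f := by
  have hx : x = A.tgt f := by rw [h, A.src_idt]
  subst hx; exact A.comp_idt f

theorem assoc' (A : GCat.{u, v} G) (f g k : A.Mor) (h₁ : A.tgt f = A.src g)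
    (h : A.tgt (A.comp f g h₁) = A.src k) :
    A.comp (A.comp f g h₁) k h = A.comp f (A.comp g k ((A.tgt_comp _ _ _).symm.trans h))
      (h₁.trans (A.src_comp _ _ _).symm) :=
  A.assoc f g k h₁ _

/-- The product of two `G`-categories. -/
@[simps, reducible]
def prod (A : GCat.{u, v} G) (B : GCat.{u, w} G) : GCat.{u, max v w} G where
  Ob := A.Ob × B.Ob
  Mor := A.Mor × B.Mor
  obAct := inferInstance
  morAct := inferInstance
  src f := (A.src f.1, B.src f.2)
  tgt f := (A.tgt f.1, B.tgt f.2)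
  idt x := (A.idt x.1, B.idt x.2)
  comp f g h := (A.comp f.1 g.1 (congrArg Prod.fst h), B.comp f.2 g.2 (congrArg Prod.snd h))
  src_idt _ := by simp
  tgt_idt _ := by simp
  src_comp _ _ _ := by simp
  tgt_comp _ _ _ := by simp
  idt_comp _ := Prod.ext (A.idt_comp _) (B.idt_comp _)
  comp_idt _ := Prod.ext (A.comp_idt _) (B.comp_idt _)
  assoc _ _ _ _ _ := Prod.ext (A.assoc _ _ _ _ _) (B.assoc _ _ _ _ _)
  src_smul _ _ := Prod.ext (A.src_smul _ _) (B.src_smul _ _)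
  tgt_smul _ _ := Prod.ext (A.tgt_smul _ _) (B.tgt_smul _ _)
  idt_smul _ _ := Prod.ext (A.idt_smul _ _) (B.idt_smul _ _)
  comp_smul _ _ _ _ := Prod.ext (A.comp_smul _ _ _ _) (B.comp_smul _ _ _ _)

/-- The product of a family of `G`-categories. -/
@[simps, reducible]
def pi {ι : Type w} (A : ι → GCat.{u, v} G) : GCat.{u, max v w} G where
  Ob := ∀ i, (A i).Ob
  Mor := ∀ i, (A i).Mor
  obAct := inferInstance
  morAct := inferInstance
  src f i := (A i).src (f i)
  tgt f i := (A i).tgt (f i)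
  idt x i := (A i).idt (x i)
  comp f g h i := (A i).comp (f i) (g i) (congrFun h i)
  src_idt _ := by simp
  tgt_idt _ := by simp
  src_comp _ _ _ := by simp
  tgt_comp _ _ _ := by simp
  idt_comp _ := funext fun i => (A i).idt_comp _
  comp_idt _ := funext fun i => (A i).comp_idt _
  assoc _ _ _ _ _ := funext fun i => (A i).assoc _ _ _ _ _
  src_smul _ _ := funext fun i => (A i).src_smul _ _
  tgt_smul _ _ := funext fun i => (A i).tgt_smul _ _
  idt_smul _ _ := funext fun i => (A i).idt_smul _ _
  comp_smul _ _ _ _ := funext fun i => (A i).comp_smul _ _ _ _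

/-- The cartesian power `A ^ n`. -/
abbrev pow (A : GCat.{u, v} G) (n : ℕ) : GCat.{u, v} G := pi fun _ : Fin n => A

/-- The chaotic `G`-category on a `G`-set: it has a unique morphism between any two objects.
A morphism is the pair (target, source). -/
abbrev chaotic (X : Type v) (act : MulAction G X) : GCat.{u, v} G where
  Ob := X
  Mor := X × X
  obAct := act
  morAct := inferInstance
  src f := f.2
  tgt f := f.1
  idt x := (x, x)
  comp f g _ := (g.1, f.2)
  src_idt _ := rfl
  tgt_idt _ := rfl
  src_comp _ _ _ := rfl
  tgt_comp _ _ _ := rfl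
  idt_comp _ := rfl
  comp_idt _ := rfl
  assoc _ _ _ _ _ := rfl
  src_smul _ _ := rfl
  tgt_smul _ _ := rfl
  idt_smul _ _ := rfl
  comp_smul _ _ _ _ := rfl

end GCat

/-- The trivial action of `G` on a set. -/
abbrev trivialAct (G : Type u) [Group G] (X : Type v) : MulAction G X where
  smul _ x := x
  one_smul _ := rfl
  mul_smul _ _ _ := rfl

namespace UFunctor

variable {A : GCat.{u, v} G} {B : GCat.{u, w} G} {C : GCat.{u, v'} G}

/-- Composition of functors, in diagrammatic order. -/
@[simps]
def comp (F : UFunctor A B) (K : UFunctor B C) : UFunctor A C where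
  obj x := K.obj (F.obj x)
  mor f := K.mor (F.mor f)
  src_mor _ := by simp
  tgt_mor _ := by simp
  mor_idt _ := by simp [F.mor_idt, K.mor_idt]
  mor_comp _ _ _ := by simp [F.mor_comp, K.mor_comp]

/-- The conjugate `x ↦ c F(c⁻¹ x)` of a functor by an element `c` of `G`. -/
@[simps]
def conj (c : G) (F : UFunctor A B) : UFunctor A B where
  obj x := c • F.obj (c⁻¹ • x)
  mor f := c • F.mor (c⁻¹ • f)
  src_mor _ := by simp
  tgt_mor _ := by simp
  mor_idt _ := by rw [← A.idt_smul, F.mor_idt, B.idt_smul]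
  mor_comp f g h := by
    rw [B.comp_smul _ _ _ (by simp [h]), ← F.mor_comp _ _ (by simp [h]), A.comp_smul _ _ _ h]

end UFunctor

namespace GFunctor

variable {A : GCat.{u, v} G} {B : GCat.{u, w} G} {C : GCat.{u, v'} G} {D : GCat.{u, w'} G}

/-- The identity `G`-functor. -/
@[simps!]
def id (A : GCat.{u, v} G) : GFunctor A A where
  obj x := x
  mor f := f
  src_mor _ := rfl
  tgt_mor _ := rfl
  mor_idt _ := rfl
  mor_comp _ _ _ := rfl
  obj_smul _ _ := rfl
  mor_smul _ _ := rfl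

/-- Composition of `G`-functors, in diagrammatic order. -/
@[simps!]
def comp (F : GFunctor A B) (K : GFunctor B C) : GFunctor A C where
  toUFunctor := F.toUFunctor.comp K.toUFunctor
  obj_smul _ _ := by simp [F.obj_smul, K.obj_smul]
  mor_smul _ _ := by simp [F.mor_smul, K.mor_smul]

/-- The product of two `G`-functors. -/
@[simps!]
def prodMap (F : GFunctor A B) (K : GFunctor C D) : GFunctor (A.prod C) (B.prod D) where
  obj x := (F.obj x.1, K.obj x.2)
  mor f := (F.mor f.1, K.mor f.2)
  src_mor _ := Prod.ext (F.src_mor _) (K.src_mor _)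
  tgt_mor _ := Prod.ext (F.tgt_mor _) (K.tgt_mor _)
  mor_idt _ := Prod.ext (F.mor_idt _) (K.mor_idt _)
  mor_comp _ _ _ := Prod.ext (F.mor_comp _ _ _) (K.mor_comp _ _ _)
  obj_smul _ _ := Prod.ext (F.obj_smul _ _) (K.obj_smul _ _)
  mor_smul _ _ := Prod.ext (F.mor_smul _ _) (K.mor_smul _ _)

/-- The product of a family of `G`-functors. -/
@[simps!]
def piMap {ι : Type w'} {A : ι → GCat.{u, v} G} {B : ι → GCat.{u, w} G}
    (F : ∀ i, GFunctor (A i) (B i)) : GFunctor (GCat.pi A) (GCat.pi B) where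
  obj x i := (F i).obj (x i)
  mor f i := (F i).mor (f i)
  src_mor _ := funext fun i => (F i).src_mor _
  tgt_mor _ := funext fun i => (F i).tgt_mor _
  mor_idt _ := funext fun i => (F i).mor_idt _
  mor_comp _ _ _ := funext fun i => (F i).mor_comp _ _ _
  obj_smul _ _ := funext fun i => (F i).obj_smul _ _
  mor_smul _ _ := funext fun i => (F i).mor_smul _ _

end GFunctor

namespace UTrans

variable {A : GCat.{u, v} G} {B : GCat.{u, w} G} {C : GCat.{u, v'} G}

/-- Vertical composition; the two middle functors are only required to be equal. -/
@[simps]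
def vcomp {F₁ F₂ F₃ F₄ : UFunctor A B} (s : UTrans F₁ F₂) (t : UTrans F₃ F₄) (h : F₂ = F₃) :
    UTrans F₁ F₄ where
  app x := B.comp (s.app x) (t.app x) (by simp [h])
  src_app _ := by simp
  tgt_app _ := by simp
  naturality f := by
    subst h
    rw [← B.assoc _ _ _ (by simp) (by simp), B.comp_congr (s.naturality f) rfl,
      B.assoc' _ _ _ _ _, B.comp_congr rfl (t.naturality f), ← B.assoc _ _ _ (by simp) (by simp)]

/-- The conjugate of a natural transformation by an element of `G`. -/
@[simps]
def conj (c : G) {F F' : UFunctor A B} (s : UTrans F F') : UTrans (F.conj c) (F'.conj c) where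
  app x := c • s.app (c⁻¹ • x)
  src_app _ := by simp
  tgt_app _ := by simp
  naturality f := by
    have := congrArg (c • ·) (s.naturality (c⁻¹ • f))
    simpa only [← B.comp_smul, A.src_smul, A.tgt_smul, UFunctor.conj_mor] using this

end UTrans

namespace GTrans

variable {A : GCat.{u, v} G} {B : GCat.{u, w} G}

/-- The identity transformation. -/
@[simps!]
def id (F : GFunctor A B) : GTrans F F where
  app x := B.idt (F.obj x)
  src_app _ := by simp
  tgt_app _ := by simp
  naturality f := by rw [B.comp_idt', B.idt_comp']
  app_smul _ _ := by rw [F.obj_smul, B.idt_smul]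

/-- Vertical composition. -/
@[simps!]
def vcomp {F F' F'' : GFunctor A B} (s : GTrans F F') (t : GTrans F' F'') : GTrans F F'' where
  toUTrans := s.toUTrans.vcomp t.toUTrans rfl
  app_smul _ _ := by
    simp only [UTrans.vcomp_app]
    rw [← B.comp_smul]
    exact B.comp_congr (s.app_smul _ _) (t.app_smul _ _) _

/-- A `G`-transformation is invertible if it has a two-sided inverse for vertical composition. -/
def IsInvertible {F F' : GFunctor A B} (s : GTrans F F') : Prop :=
  ∃ t : GTrans F' F, s.vcomp t = GTrans.id F ∧ t.vcomp s = GTrans.id F'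

end GTrans

/-! ### The `G`-category of all functors -/

/-- A natural transformation together with its source and target functors. -/
structure TransArrow (X : GCat.{u, v} G) (A : GCat.{u, w} G) where
  dom : UFunctor X A
  cod : UFunctor X A
  tr : UTrans dom cod

theorem TransArrow.ext' {X : GCat.{u, v} G} {A : GCat.{u, w} G} {s t : TransArrow X A}
    (hd : s.dom = t.dom) (hc : s.cod = t.cod) (ha : ∀ x, s.tr.app x = t.tr.app x) : s = t := by
  cases s with | mk d c s => cases t with | mk d' c' t =>
  dsimp only at hd hc
  subst hd; subst hc
  have : s = t := UTrans.ext (funext ha)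
  subst this; rfl

/-- The `G`-category `Cat(X, A)` of all functors `X ⥤ A`, not necessarily equivariant, and all
natural transformations between them, where `G` acts by conjugation. -/
abbrev GCat.functorCat (X : GCat.{u, v} G) (A : GCat.{u, w} G) : GCat.{u, max v w} G where
  Ob := UFunctor X A
  Mor := TransArrow X A
  obAct :=
    { smul := fun c F => F.conj c
      one_smul := fun F => by
        apply UFunctor.ext <;> funext x
        · change (1 : G) • F.obj ((1 : G)⁻¹ • x) = _; simp
        · change (1 : G) • F.mor ((1 : G)⁻¹ • x) = _; simp
      mul_smul := fun c d F => by
        apply UFunctor.ext <;> funext x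
        · change (c * d) • F.obj ((c * d)⁻¹ • x) = c • d • F.obj (d⁻¹ • c⁻¹ • x)
          simp [mul_smul]
        · change (c * d) • F.mor ((c * d)⁻¹ • x) = c • d • F.mor (d⁻¹ • c⁻¹ • x)
          simp [mul_smul] }
  morAct :=
    { smul := fun c s => ⟨s.dom.conj c, s.cod.conj c, s.tr.conj c⟩
      one_smul := fun s => by
        apply TransArrow.ext'
        · apply UFunctor.ext <;> funext x
          · change (1 : G) • s.dom.obj ((1 : G)⁻¹ • x) = _; simp
          · change (1 : G) • s.dom.mor ((1 : G)⁻¹ • x) = _; simp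
        · apply UFunctor.ext <;> funext x
          · change (1 : G) • s.cod.obj ((1 : G)⁻¹ • x) = _; simp
          · change (1 : G) • s.cod.mor ((1 : G)⁻¹ • x) = _; simp
        · intro x
          change (1 : G) • s.tr.app ((1 : G)⁻¹ • x) = _; simp
      mul_smul := fun c d s => by
        apply TransArrow.ext'
        · apply UFunctor.ext <;> funext x
          · change (c * d) • s.dom.obj ((c * d)⁻¹ • x) = c • d • s.dom.obj (d⁻¹ • c⁻¹ • x)
            simp [mul_smul]
          · change (c * d) • s.dom.mor ((c * d)⁻¹ • x) = c • d • s.dom.mor (d⁻¹ • c⁻¹ • x)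
            simp [mul_smul]
        · apply UFunctor.ext <;> funext x
          · change (c * d) • s.cod.obj ((c * d)⁻¹ • x) = c • d • s.cod.obj (d⁻¹ • c⁻¹ • x)
            simp [mul_smul]
          · change (c * d) • s.cod.mor ((c * d)⁻¹ • x) = c • d • s.cod.mor (d⁻¹ • c⁻¹ • x)
            simp [mul_smul]
        · intro x
          change (c * d) • s.tr.app ((c * d)⁻¹ • x) = c • d • s.tr.app (d⁻¹ • c⁻¹ • x)
          simp [mul_smul] }
  src s := s.dom
  tgt s := s.cod
  idt F := ⟨F, F,
    { app := fun x => A.idt (F.obj x)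
      src_app := fun _ => by simp
      tgt_app := fun _ => by simp
      naturality := fun f => by rw [A.comp_idt', A.idt_comp'] }⟩
  comp s t h := ⟨s.dom, t.cod, s.tr.vcomp t.tr h⟩
  src_idt _ := rfl
  tgt_idt _ := rfl
  src_comp _ _ _ := rfl
  tgt_comp _ _ _ := rfl
  idt_comp _ := TransArrow.ext' rfl rfl fun _ => A.idt_comp' _ _ _
  comp_idt _ := TransArrow.ext' rfl rfl fun _ => A.comp_idt' _ _ _
  assoc _ _ _ _ _ := TransArrow.ext' rfl rfl fun _ => A.assoc' _ _ _ _ _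
  src_smul _ _ := rfl
  tgt_smul _ _ := rfl
  idt_smul _ _ := TransArrow.ext' rfl rfl fun _ => A.idt_smul _ _
  comp_smul _ _ _ _ := TransArrow.ext' rfl rfl fun _ => A.comp_smul _ _ _ _

/-! ### Lexicographic reindexing of blocks -/

section Blocks

variable {k : ℕ}

/-- The position of an index in a concatenation of blocks of lengths `m 0, m 1, …`: the number of
its block and the place in that block. -/
def blk (m : Fin k → ℕ) (j : Fin (∑ i, m i)) : (i : Fin k) × Fin (m i) :=
  finSigmaFinEquiv.symm j

/-- Concatenation of a tuple of tuples. -/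
abbrev flat {m : Fin k → ℕ} {X : Type v} (a : ∀ i, Fin (m i) → X) (j : Fin (∑ i, m i)) : X :=
  a (blk m j).1 (blk m j).2

/-- The bijection that moves block `i` to block `e i` and acts inside that block by `d i`. -/
def blockEquiv {k' : ℕ} {m : Fin k → ℕ} {m' : Fin k' → ℕ} (e : Fin k ≃ Fin k')
    (d : ∀ i, Fin (m i) ≃ Fin (m' (e i))) : Fin (∑ i, m i) ≃ Fin (∑ i, m' i) :=
  finSigmaFinEquiv.symm.trans ((Equiv.sigmaCongr e d).trans finSigmaFinEquiv)

/-- The identification of `∑ i : Fin 1, n` with `n`. -/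
def oneBlockEquiv (n : ℕ) : Fin (∑ _i : Fin 1, n) ≃ Fin n :=
  finCongr (by simp)

/-- The identification of `∑ i : Fin n, 1` with `n`. -/
def unitBlocksEquiv (n : ℕ) : Fin (∑ _i : Fin n, 1) ≃ Fin n :=
  finCongr (by simp)

/-- The identification of a concatenation of blocks of blocks with an iterated concatenation. -/
def assocEquiv (m : Fin k → ℕ) (p : ∀ i, Fin (m i) → ℕ) :
    Fin (∑ j : Fin (∑ i, m i), flat p j) ≃ Fin (∑ i, ∑ s, p i s) :=
  finCongr (by
    have h := Equiv.sum_comp (finSigmaFinEquiv (n := m)).symm (fun x => p x.1 x.2)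
    rw [Fintype.sum_sigma] at h
    exact h)

theorem finSigma_lt_iff {m : Fin k → ℕ} (x y : (i : Fin k) × Fin (m i)) :
    finSigmaFinEquiv x < finSigmaFinEquiv y ↔
      x.1 < y.1 ∨ (x.1 = y.1 ∧ (x.2 : ℕ) < y.2) := by
  have key : ∀ x y : (i : Fin k) × Fin (m i), x.1 < y.1 →
      (finSigmaFinEquiv x : ℕ) < finSigmaFinEquiv y := by
    intro x y h
    let M : ℕ → ℕ := fun i => if h : i < k then m ⟨i, h⟩ else 0
    have hs : ∀ z : (i : Fin k) × Fin (m i), (finSigmaFinEquiv z : ℕ) =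
        ∑ i ∈ Finset.range z.1, M i + z.2 := by
      intro z
      rw [finSigmaFinEquiv_apply, Finset.sum_range]
      congr 1
      apply Finset.sum_congr rfl
      intro i _
      have : (i : ℕ) < k := i.2.trans z.1.2
      simp [M, this]
      rfl
    rw [hs, hs]
    have h1 : (x.2 : ℕ) < M x.1 := by simp [M]
    have h2 : ∑ i ∈ Finset.range (x.1 + 1), M i ≤ ∑ i ∈ Finset.range y.1, M i :=
      Finset.sum_le_sum_of_subset (Finset.range_mono h)
    rw [Finset.sum_range_succ] at h2
    omega
  rcases lt_trichotomy x.1 y.1 with h | h | h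
  · simp only [h, true_or, iff_true]
    exact key x y h
  · obtain ⟨i, s⟩ := x
    obtain ⟨j, t⟩ := y
    dsimp only at h
    subst h
    rw [Fin.lt_def, finSigmaFinEquiv_apply, finSigmaFinEquiv_apply]
    simp
  · have h' := key y x h
    constructor
    · intro h''; exact absurd h' (not_lt.mpr (le_of_lt h''))
    · rintro (h'' | ⟨h'', _⟩)
      · exact absurd h (not_lt.mpr h''.le)
      · exact absurd h'' (ne_of_gt h)

theorem blk_lt_iff {m : Fin k → ℕ} (x y : Fin (∑ i, m i)) :
    x < y ↔ (blk m x).1 < (blk m y).1 ∨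
      ((blk m x).1 = (blk m y).1 ∧ ((blk m x).2 : ℕ) < (blk m y).2) := by
  rw [← finSigma_lt_iff]; simp [blk]

theorem lt_iff_finSigma {m : Fin k → ℕ} (x y : Fin (∑ i, m i)) :
    x < y ↔ finSigmaFinEquiv (blk m x) < finSigmaFinEquiv (blk m y) := by
  simp [blk]

theorem blk_blockEquiv {k' : ℕ} {m : Fin k → ℕ} {m' : Fin k' → ℕ} (e : Fin k ≃ Fin k')
    (d : ∀ i, Fin (m i) ≃ Fin (m' (e i))) (j : Fin (∑ i, m i)) :
    blk m' (blockEquiv e d j) = ⟨e (blk m j).1, d _ (blk m j).2⟩ := by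
  simp only [blk, blockEquiv, Equiv.trans_apply, Equiv.symm_apply_apply]
  rfl

theorem val_eq_of_strictMono {n n' : ℕ} (e : Fin n ≃ Fin n') (h : ∀ x y, x < y → e x < e y)
    (x : Fin n) : (e x : ℕ) = x := by
  have hn : n = n' := Fin.equiv_iff_eq.mp ⟨e⟩
  subst hn
  have hm : StrictMono e := fun x y hxy => h x y hxy
  have : StrictMono.orderIsoOfSurjective e hm e.surjective = OrderIso.refl (Fin n) :=
    Subsingleton.elim _ _
  exact congrArg Fin.val (congrArg (fun f : Fin n ≃o Fin n => f x) this)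

theorem inner_lt_iff {m : Fin k → ℕ} {p : ∀ i, Fin (m i) → ℕ} (x y : (i : Fin k) × Fin (m i))
    (l : Fin (p x.1 x.2)) (l' : Fin (p y.1 y.2)) (h : x.1 = y.1) :
    ((finSigmaFinEquiv (⟨x.2, l⟩ : (s : Fin (m x.1)) × Fin (p x.1 s)) : ℕ) <
      finSigmaFinEquiv (⟨y.2, l'⟩ : (s : Fin (m y.1)) × Fin (p y.1 s))) ↔
      ((x.2 : ℕ) < y.2 ∨ ((x.2 : ℕ) = y.2 ∧ (l : ℕ) < l')) := by
  obtain ⟨i, s⟩ := x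
  obtain ⟨i', s'⟩ := y
  dsimp only at h
  subst h
  have := finSigma_lt_iff (⟨s, l⟩ : (s : Fin (m i)) × Fin (p i s)) ⟨s', l'⟩
  rw [Fin.lt_def, Fin.lt_def, Fin.ext_iff] at this
  exact this

theorem blk_assocEquiv (m : Fin k → ℕ) (p : ∀ i, Fin (m i) → ℕ)
    (j : Fin (∑ j : Fin (∑ i, m i), flat p j)) :
    blk (fun i => ∑ s, p i s) (assocEquiv m p j) =
      ⟨(blk m (blk (flat p) j).1).1,
        finSigmaFinEquiv ⟨(blk m (blk (flat p) j).1).2, (blk (flat p) j).2⟩⟩ := by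
  let S : ((j : Fin (∑ i, m i)) × Fin (flat p j)) ≃
      (x : (i : Fin k) × Fin (m i)) × Fin (p x.1 x.2) :=
    Equiv.sigmaCongr finSigmaFinEquiv.symm fun _ => Equiv.refl _
  let E : Fin (∑ j : Fin (∑ i, m i), flat p j) ≃ Fin (∑ i, ∑ s, p i s) :=
    finSigmaFinEquiv.symm.trans (S.trans ((Equiv.sigmaAssoc fun i s => Fin (p i s)).trans
      ((Equiv.sigmaCongrRight fun i => finSigmaFinEquiv).trans finSigmaFinEquiv)))
  have hE : ∀ j, E j = finSigmaFinEquiv ⟨(blk m (blk (flat p) j).1).1,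
        finSigmaFinEquiv ⟨(blk m (blk (flat p) j).1).2, (blk (flat p) j).2⟩⟩ := fun j => rfl
  have hmono : ∀ x y, x < y → E x < E y := by
    intro x y hxy
    rw [hE, hE, finSigma_lt_iff]
    rw [blk_lt_iff, blk_lt_iff] at hxy
    generalize blk (flat p) x = x at *
    generalize blk (flat p) y = y at *
    obtain ⟨x, l⟩ := x
    obtain ⟨y, l'⟩ := y
    dsimp only at hxy ⊢
    rcases hxy with (h | ⟨h, h'⟩) | ⟨h, h'⟩
    · exact Or.inl h
    · exact Or.inr ⟨h, (inner_lt_iff (blk m x) (blk m y) _ _ h).mpr (Or.inl h')⟩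
    · subst h
      exact Or.inr ⟨rfl, (inner_lt_iff (blk m x) (blk m x) _ _ rfl).mpr (Or.inr ⟨rfl, h'⟩)⟩
  have hj : assocEquiv m p j = E j :=
    Fin.ext (val_eq_of_strictMono E hmono j).symm
  rw [hj, hE]
  simp [blk]

end Blocks

/-! ### Operads -/

/-- A reduced operad in sets. The right actions of the symmetric groups are recorded as a
contravariant functor on the groupoid of the sets `Fin n` and their bijections; as there are no
bijections `Fin n ≃ Fin m` for `n ≠ m`, this amounts to a right action `x ↦ x · e` of
`Equiv.Perm (Fin n)` on `obj n` for all `n`, and it includes the transport along `n = m`. -/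
structure SetOperad : Type (v + 1) where
  obj : ℕ → Type v
  act : ∀ {n m : ℕ}, (Fin n ≃ Fin m) → obj m → obj n
  one : obj 1
  gam : ∀ {k : ℕ} (m : Fin k → ℕ), obj k → (∀ i, obj (m i)) → obj (∑ i, m i)
  reduced : Nonempty (Unique (obj 0))
  act_refl : ∀ (n : ℕ) (x : obj n), act (Equiv.refl (Fin n)) x = x
  act_trans : ∀ {n m k : ℕ} (e : Fin n ≃ Fin m) (e' : Fin m ≃ Fin k) (x : obj k),
    act (e.trans e') x = act e (act e' x)
  gam_one_left : ∀ (n : ℕ) (x : obj n),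
    gam (fun _ : Fin 1 => n) one (fun _ => x) = act (oneBlockEquiv n) x
  gam_one_right : ∀ (n : ℕ) (x : obj n),
    gam (fun _ : Fin n => 1) x (fun _ => one) = act (unitBlocksEquiv n) x
  gam_equivariant : ∀ {k k' : ℕ} {m : Fin k → ℕ} {m' : Fin k' → ℕ} (e : Fin k ≃ Fin k')
    (d : ∀ i, Fin (m i) ≃ Fin (m' (e i))) (o : obj k') (x : ∀ i, obj (m' i)),
    gam m (act e o) (fun i => act (d i) (x (e i))) = act (blockEquiv e d) (gam m' o x)
  gam_assoc : ∀ {k : ℕ} (m : Fin k → ℕ) (p : ∀ i, Fin (m i) → ℕ) (o : obj k)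
    (x : ∀ i, obj (m i)) (y : ∀ i s, obj (p i s)),
    gam (flat p) (gam m o x) (fun j => y (blk m j).1 (blk m j).2) =
      act (assocEquiv m p) (gam (fun i => ∑ s, p i s) o (fun i => gam (p i) (x i) (y i)))

/-- A reduced operad in the category of `G`-categories. For the symmetric group actions see
`SetOperad`. -/
structure Operad (G : Type u) [Group G] : Type (max u (v + 1)) where
  obj : ℕ → GCat.{u, v} G
  act : ∀ {n m : ℕ}, (Fin n ≃ Fin m) → GFunctor (obj m) (obj n)
  one : (obj 1).Ob
  gam : ∀ {k : ℕ} (m : Fin k → ℕ),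
    GFunctor ((obj k).prod (GCat.pi fun i => obj (m i))) (obj (∑ i, m i))
  one_fixed : ∀ c : G, c • one = one
  reduced : Nonempty (Unique (obj 0).Ob) ∧ Nonempty (Unique (obj 0).Mor)
  act_refl : ∀ n : ℕ, act (Equiv.refl (Fin n)) = GFunctor.id (obj n)
  act_trans : ∀ {n m k : ℕ} (e : Fin n ≃ Fin m) (e' : Fin m ≃ Fin k),
    act (e.trans e') = (act e').comp (act e)
  gam_one_left_obj : ∀ (n : ℕ) (x : (obj n).Ob),
    (gam fun _ : Fin 1 => n).obj (one, fun _ => x) = (act (oneBlockEquiv n)).obj x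
  gam_one_left_mor : ∀ (n : ℕ) (x : (obj n).Mor),
    (gam fun _ : Fin 1 => n).mor ((obj 1).idt one, fun _ => x) = (act (oneBlockEquiv n)).mor x
  gam_one_right_obj : ∀ (n : ℕ) (x : (obj n).Ob),
    (gam fun _ : Fin n => 1).obj (x, fun _ => one) = (act (unitBlocksEquiv n)).obj x
  gam_one_right_mor : ∀ (n : ℕ) (x : (obj n).Mor),
    (gam fun _ : Fin n => 1).mor (x, fun _ => (obj 1).idt one) = (act (unitBlocksEquiv n)).mor x
  gam_equivariant_obj : ∀ {k k' : ℕ} {m : Fin k → ℕ} {m' : Fin k' → ℕ} (e : Fin k ≃ Fin k')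
    (d : ∀ i, Fin (m i) ≃ Fin (m' (e i))) (o : (obj k').Ob) (x : ∀ i, (obj (m' i)).Ob),
    (gam m).obj ((act e).obj o, fun i => (act (d i)).obj (x (e i))) =
      (act (blockEquiv e d)).obj ((gam m').obj (o, x))
  gam_equivariant_mor : ∀ {k k' : ℕ} {m : Fin k → ℕ} {m' : Fin k' → ℕ} (e : Fin k ≃ Fin k')
    (d : ∀ i, Fin (m i) ≃ Fin (m' (e i))) (o : (obj k').Mor) (x : ∀ i, (obj (m' i)).Mor),
    (gam m).mor ((act e).mor o, fun i => (act (d i)).mor (x (e i))) =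
      (act (blockEquiv e d)).mor ((gam m').mor (o, x))
  gam_assoc_obj : ∀ {k : ℕ} (m : Fin k → ℕ) (p : ∀ i, Fin (m i) → ℕ) (o : (obj k).Ob)
    (x : ∀ i, (obj (m i)).Ob) (y : ∀ i s, (obj (p i s)).Ob),
    (gam (flat p)).obj ((gam m).obj (o, x), fun j => y (blk m j).1 (blk m j).2) =
      (act (assocEquiv m p)).obj
        ((gam fun i => ∑ s, p i s).obj (o, fun i => (gam (p i)).obj (x i, y i)))
  gam_assoc_mor : ∀ {k : ℕ} (m : Fin k → ℕ) (p : ∀ i, Fin (m i) → ℕ) (o : (obj k).Mor)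
    (x : ∀ i, (obj (m i)).Mor) (y : ∀ i s, (obj (p i s)).Mor),
    (gam (flat p)).mor ((gam m).mor (o, x), fun j => y (blk m j).1 (blk m j).2) =
      (act (assocEquiv m p)).mor
        ((gam fun i => ∑ s, p i s).mor (o, fun i => (gam (p i)).mor (x i, y i)))

/-! ### The permutativity operads -/

/-- The block sum `τ₁ ⊕ ⋯ ⊕ τₖ` of permutations. -/
def blockSum {k : ℕ} {m : Fin k → ℕ} (t : ∀ i, Equiv.Perm (Fin (m i))) :
    Equiv.Perm (Fin (∑ i, m i)) :=
  blockEquiv (Equiv.refl _) t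

/-- The permutation that permutes `k` blocks of lengths `m 0, m 1, …` as `s` permutes `k`
letters. -/
def blockPerm {k : ℕ} (s : Equiv.Perm (Fin k)) (m : Fin k → ℕ) : Equiv.Perm (Fin (∑ i, m i)) :=
  (blockEquiv (m' := fun j => m (s.symm j)) s
    (fun i => finCongr (congrArg m (s.symm_apply_apply i).symm))).trans
      (finCongr (Equiv.sum_comp s.symm m))

theorem perm_ext_of_lt {n : ℕ} {x y : Equiv.Perm (Fin n)}
    (h : ∀ a b, x a < x b ↔ y a < y b) : x = y := by
  have := val_eq_of_strictMono (x.symm.trans y) (fun a b hab => by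
    have := (h (x.symm a) (x.symm b)).mp (by simpa using hab)
    simpa using this)
  ext a
  simpa using (this (x a)).symm

/-- The lexicographic comparison by which `γ(s; t)` orders the letters. -/
def PermLt {k : ℕ} {m : Fin k → ℕ} (s : Equiv.Perm (Fin k)) (t : ∀ i, Equiv.Perm (Fin (m i)))
    (x y : (i : Fin k) × Fin (m i)) : Prop :=
  s x.1 < s y.1 ∨ (x.1 = y.1 ∧ (t _ x.2 : ℕ) < t _ y.2)

theorem assoc_gam_lt_iff {k : ℕ} {m : Fin k → ℕ} (s : Equiv.Perm (Fin k))
    (t : ∀ i, Equiv.Perm (Fin (m i))) (a b : Fin (∑ i, m i)) :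
    (blockPerm s m * blockSum t) a < (blockPerm s m * blockSum t) b ↔
      PermLt s t (blk m a) (blk m b) := by
  let E : Fin (∑ i, m i) ≃ Fin (∑ j, m (s.symm j)) :=
    blockEquiv (m' := fun j => m (s.symm j)) s
      (fun i => finCongr (congrArg m (s.symm_apply_apply i).symm))
  have hval : ∀ c, blk (fun j => m (s.symm j)) (E (blockSum t c)) =
      ⟨s (blk m c).1, finCongr (congrArg m (s.symm_apply_apply _).symm) (t _ (blk m c).2)⟩ := by
    intro c
    rw [blk_blockEquiv, blockSum, blk_blockEquiv (Equiv.refl (Fin k)) t]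
    rfl
  have h := lt_iff_finSigma (m := fun j => m (s.symm j)) (E (blockSum t a)) (E (blockSum t b))
  rw [hval, hval, finSigma_lt_iff] at h
  simp only [s.injective.eq_iff, finCongr_apply, Fin.val_cast] at h
  exact h

theorem assoc_gam_inner_lt_iff {k : ℕ} {m : Fin k → ℕ} {p : ∀ i, Fin (m i) → ℕ}
    (s : ∀ i, Equiv.Perm (Fin (m i))) (t : ∀ i j, Equiv.Perm (Fin (p i j)))
    (x y : (i : Fin k) × Fin (m i)) (l : Fin (p x.1 x.2)) (l' : Fin (p y.1 y.2))
    (h : x.1 = y.1) :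
    (((blockPerm (s x.1) (p x.1) * blockSum (t x.1)) (finSigmaFinEquiv ⟨x.2, l⟩) : ℕ) <
      (blockPerm (s y.1) (p y.1) * blockSum (t y.1)) (finSigmaFinEquiv ⟨y.2, l'⟩)) ↔
      ((s x.1 x.2 : ℕ) < s y.1 y.2 ∨ (x = y ∧ (t x.1 x.2 l : ℕ) < t y.1 y.2 l')) := by
  obtain ⟨i, j⟩ := x
  obtain ⟨i', j'⟩ := y
  dsimp only at h
  subst h
  have := assoc_gam_lt_iff (s i) (t i) (finSigmaFinEquiv ⟨j, l⟩) (finSigmaFinEquiv ⟨j', l'⟩)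
  rw [Fin.lt_def] at this
  have e : ∀ z, blk (p i) (finSigmaFinEquiv z) = z := fun z => by simp [blk]
  rw [this, e, e, PermLt, Fin.lt_def]
  simp only [Sigma.mk.injEq, true_and, heq_eq_eq]

theorem act_lt_iff {n n' : ℕ} (e : Fin n ≃ Fin n') (h : n' = n) (x : Equiv.Perm (Fin n'))
    (a b : Fin n) : ((e.trans x).trans (finCongr h)) a < ((e.trans x).trans (finCongr h)) b ↔
      x (e a) < x (e b) := by
  subst h; rfl

/-- The associativity operad: `Assoc(n)` is the symmetric group `Σₙ` as a right `Σₙ`-set, and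
`γ(σ; τ₁, …, τₖ) = σ(m₁, …, mₖ) (τ₁ ⊕ ⋯ ⊕ τₖ)`. -/
def Assoc : SetOperad.{0} where
  obj n := Equiv.Perm (Fin n)
  act e x := (e.trans x).trans (finCongr (Fin.equiv_iff_eq.mp ⟨e⟩).symm)
  one := 1
  gam m s t := blockPerm s m * blockSum t
  reduced := ⟨inferInstance⟩
  act_refl n x := by ext; simp
  act_trans e e' x := by ext; simp
  gam_one_left n x := by
    apply perm_ext_of_lt
    intro a b
    have hb : ∀ c : Fin (∑ _i : Fin 1, n), (blk _ c).2 = oneBlockEquiv n c := by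
      intro c
      have := finSigmaFinEquiv_one (blk (fun _ : Fin 1 => n) c)
      ext
      rw [← this]; simp [blk, oneBlockEquiv]
    rw [assoc_gam_lt_iff, act_lt_iff, PermLt, hb, hb]
    simp [Subsingleton.elim (blk (fun _ : Fin 1 => n) a).1 (blk (fun _ : Fin 1 => n) b).1]
  gam_one_right n x := by
    apply perm_ext_of_lt
    intro a b
    have hb : ∀ c : Fin (∑ _i : Fin n, 1), (blk _ c).1 = unitBlocksEquiv n c := by
      intro c
      have := finSigmaFinEquiv_apply (blk (fun _ : Fin n => 1) c)
      simp only [blk, Equiv.apply_symm_apply, Finset.sum_const, smul_eq_mul, mul_one,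
        Fin.val_eq_zero, add_zero] at this
      ext
      exact ((Finset.card_fin _).symm.trans this.symm)
    rw [assoc_gam_lt_iff, act_lt_iff, PermLt, hb, hb]
    simp
  gam_equivariant {k k' m m'} e d o x := by
    apply perm_ext_of_lt
    intro a b
    rw [act_lt_iff, assoc_gam_lt_iff, assoc_gam_lt_iff, blk_blockEquiv, blk_blockEquiv]
    simp [PermLt]
  gam_assoc {k} m p o x y := by
    apply perm_ext_of_lt
    intro a b
    rw [act_lt_iff, assoc_gam_lt_iff, assoc_gam_lt_iff, blk_assocEquiv, blk_assocEquiv]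
    rw [PermLt, PermLt, assoc_gam_lt_iff, PermLt]
    generalize blk (flat p) a = a
    generalize blk (flat p) b = b
    dsimp only
    have hinj : a.1 = b.1 ↔ blk m a.1 = blk m b.1 := finSigmaFinEquiv.symm.injective.eq_iff.symm
    by_cases h : (blk m a.1).1 = (blk m b.1).1
    · rw [assoc_gam_inner_lt_iff x y (blk m a.1) (blk m b.1) a.2 b.2 h, hinj]
      simp [h]
    · have : ¬ blk m a.1 = blk m b.1 := fun h' => h (congrArg Sigma.fst h')
      simp [h, hinj, this]

/-- The chaotic categorification of an operad in sets, with trivial action of `G`. -/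
def chaoticOperad (G : Type u) [Group G] (O : SetOperad.{v}) : Operad.{u, v} G where
  obj n := GCat.chaotic (O.obj n) (trivialAct G _)
  act e :=
    { obj := O.act e
      mor := fun f => (O.act e f.1, O.act e f.2)
      src_mor := fun _ => rfl
      tgt_mor := fun _ => rfl
      mor_idt := fun _ => rfl
      mor_comp := fun _ _ _ => rfl
      obj_smul := fun _ _ => rfl
      mor_smul := fun _ _ => rfl }
  one := O.one
  gam m :=
    { obj := fun x => O.gam m x.1 x.2
      mor := fun f => (O.gam m f.1.1 fun i => (f.2 i).1, O.gam m f.1.2 fun i => (f.2 i).2)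
      src_mor := fun _ => rfl
      tgt_mor := fun _ => rfl
      mor_idt := fun _ => rfl
      mor_comp := fun _ _ _ => rfl
      obj_smul := fun _ _ => rfl
      mor_smul := fun _ _ => rfl }
  one_fixed _ := rfl
  reduced := ⟨O.reduced, O.reduced.elim fun h =>
    ⟨⟨⟨(h.default, h.default)⟩, fun f => Prod.ext (h.uniq f.1) (h.uniq f.2)⟩⟩⟩
  act_refl n := GFunctor.ext' (fun x => O.act_refl n x)
    (fun f => Prod.ext (O.act_refl n f.1) (O.act_refl n f.2))
  act_trans e e' := GFunctor.ext' (fun x => O.act_trans e e' x)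
    (fun f => Prod.ext (O.act_trans e e' f.1) (O.act_trans e e' f.2))
  gam_one_left_obj n x := O.gam_one_left n x
  gam_one_left_mor n x := Prod.ext (O.gam_one_left n x.1) (O.gam_one_left n x.2)
  gam_one_right_obj n x := O.gam_one_right n x
  gam_one_right_mor n x := Prod.ext (O.gam_one_right n x.1) (O.gam_one_right n x.2)
  gam_equivariant_obj e d o x := O.gam_equivariant e d o x
  gam_equivariant_mor e d o x := Prod.ext (O.gam_equivariant e d o.1 fun i => (x i).1)
    (O.gam_equivariant e d o.2 fun i => (x i).2)
  gam_assoc_obj m p o x y := O.gam_assoc m p o x y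
  gam_assoc_mor m p o x y :=
    Prod.ext (O.gam_assoc m p o.1 (fun i => (x i).1) fun i s => (y i s).1)
      (O.gam_assoc m p o.2 (fun i => (x i).2) fun i s => (y i s).2)

/-- The functor into a product given by its components. -/
def UFunctor.pair {ι : Type w'} {X : GCat.{u, v} G} {A : GCat.{u, w} G} {B : ι → GCat.{u, v'} G}
    (F : UFunctor X A) (K : ∀ i, UFunctor X (B i)) : UFunctor X (A.prod (GCat.pi B)) where
  obj x := (F.obj x, fun i => (K i).obj x)
  mor f := (F.mor f, fun i => (K i).mor f)
  src_mor _ := Prod.ext (F.src_mor _) (funext fun i => (K i).src_mor _)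
  tgt_mor _ := Prod.ext (F.tgt_mor _) (funext fun i => (K i).tgt_mor _)
  mor_idt _ := Prod.ext (F.mor_idt _) (funext fun i => (K i).mor_idt _)
  mor_comp _ _ _ := Prod.ext (F.mor_comp _ _ _) (funext fun i => (K i).mor_comp _ _ _)

/-- The transformation into a product given by its components. -/
def UTrans.pair {ι : Type w'} {X : GCat.{u, v} G} {A : GCat.{u, w} G} {B : ι → GCat.{u, v'} G}
    {F F' : UFunctor X A} {K K' : ∀ i, UFunctor X (B i)} (s : UTrans F F')
    (t : ∀ i, UTrans (K i) (K' i)) : UTrans (F.pair K) (F'.pair K') where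
  app x := (s.app x, fun i => (t i).app x)
  src_app _ := Prod.ext (s.src_app _) (funext fun i => (t i).src_app _)
  tgt_app _ := Prod.ext (s.tgt_app _) (funext fun i => (t i).tgt_app _)
  naturality _ := Prod.ext (s.naturality _) (funext fun i => (t i).naturality _)

/-- Whiskering of a transformation with a functor that is applied after it. -/
def UTrans.whisker {X : GCat.{u, v} G} {A : GCat.{u, w} G} {B : GCat.{u, v'} G}
    {F F' : UFunctor X A} (s : UTrans F F') (K : UFunctor A B) :
    UTrans (F.comp K) (F'.comp K) where
  app x := K.mor (s.app x)
  src_app _ := by simp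
  tgt_app _ := by simp
  naturality f := by
    simp only [UFunctor.comp_mor]
    rw [← K.mor_comp _ _ (by simp), ← K.mor_comp _ _ (by simp), s.naturality]

/-- The functor `Cat(X, A) ⥤ Cat(X, B)` induced by a `G`-functor `A ⥤ B`. -/
def GFunctor.postcomp (X : GCat.{u, v} G) {A : GCat.{u, w} G} {B : GCat.{u, v'} G}
    (K : GFunctor A B) : GFunctor (X.functorCat A) (X.functorCat B) where
  obj F := F.comp K.toUFunctor
  mor s := ⟨s.dom.comp K.toUFunctor, s.cod.comp K.toUFunctor, s.tr.whisker K.toUFunctor⟩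
  src_mor _ := rfl
  tgt_mor _ := rfl
  mor_idt _ := TransArrow.ext' rfl rfl fun _ => K.mor_idt _
  mor_comp _ _ _ := TransArrow.ext' rfl rfl fun _ => K.mor_comp _ _ _
  obj_smul _ _ := UFunctor.ext (funext fun _ => K.obj_smul _ _) (funext fun _ => K.mor_smul _ _)
  mor_smul _ _ := TransArrow.ext'
    (UFunctor.ext (funext fun _ => K.obj_smul _ _) (funext fun _ => K.mor_smul _ _))
    (UFunctor.ext (funext fun _ => K.obj_smul _ _) (funext fun _ => K.mor_smul _ _))
    (fun _ => K.mor_smul _ _)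

/-- The comparison `Cat(X, A) × ∏ Cat(X, Bᵢ) ⥤ Cat(X, A × ∏ Bᵢ)`. -/
def GFunctor.pairing (X : GCat.{u, v} G) {ι : Type w'} (A : GCat.{u, w} G)
    (B : ι → GCat.{u, v'} G) :
    GFunctor ((X.functorCat A).prod (GCat.pi fun i => X.functorCat (B i)))
      (X.functorCat (A.prod (GCat.pi B))) where
  obj F := UFunctor.pair F.1 F.2
  mor s := ⟨UFunctor.pair s.1.dom fun i => (s.2 i).dom, UFunctor.pair s.1.cod fun i => (s.2 i).cod,
    UTrans.pair s.1.tr fun i => (s.2 i).tr⟩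
  src_mor _ := rfl
  tgt_mor _ := rfl
  mor_idt _ := rfl
  mor_comp _ _ _ := rfl
  obj_smul _ _ := rfl
  mor_smul _ _ := rfl

/-- The operad `Cat(X, O)` obtained by applying the product-preserving functor `Cat(X, -)` to
an operad `O` of `G`-categories. -/
def functorOperad (X : GCat.{u, v} G) (O : Operad.{u, w} G) : Operad.{u, max v w} G where
  obj n := X.functorCat (O.obj n)
  act e := (O.act e).postcomp X
  one :=
    { obj := fun _ => O.one
      mor := fun _ => (O.obj 1).idt O.one
      src_mor := fun _ => by simp
      tgt_mor := fun _ => by simp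
      mor_idt := fun _ => rfl
      mor_comp := fun _ _ _ => by rw [(O.obj 1).idt_comp'] }
  gam m := (GFunctor.pairing X _ _).comp ((O.gam m).postcomp X)
  one_fixed c := UFunctor.ext (funext fun _ => O.one_fixed c)
    (funext fun _ => ((O.obj 1).idt_smul c O.one).symm.trans (by rw [O.one_fixed]))
  reduced := by
    obtain ⟨⟨_⟩, ⟨_⟩⟩ := O.reduced
    have hob : ∀ F F' : UFunctor X (O.obj 0), F = F' := fun F F' =>
      UFunctor.ext (funext fun _ => Subsingleton.elim _ _) (funext fun _ => Subsingleton.elim _ _)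
    let F₀ : UFunctor X (O.obj 0) :=
      { obj := fun _ => default
        mor := fun _ => default
        src_mor := fun _ => Subsingleton.elim _ _
        tgt_mor := fun _ => Subsingleton.elim _ _
        mor_idt := fun _ => Subsingleton.elim _ _
        mor_comp := fun _ _ _ => Subsingleton.elim _ _ }
    exact ⟨⟨⟨⟨F₀⟩, fun _ => hob _ _⟩⟩,
      ⟨⟨⟨(X.functorCat (O.obj 0)).idt F₀⟩, fun _ => TransArrow.ext' (hob _ _) (hob _ _)
        fun _ => Subsingleton.elim _ _⟩⟩⟩
  act_refl n := by
    rw [O.act_refl]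
    exact GFunctor.ext' (fun _ => rfl) (fun _ => rfl)
  act_trans e e' := by
    rw [O.act_trans]
    exact GFunctor.ext' (fun _ => rfl) (fun _ => rfl)
  gam_one_left_obj n F := UFunctor.ext (funext fun x => O.gam_one_left_obj n (F.obj x))
    (funext fun f => O.gam_one_left_mor n (F.mor f))
  gam_one_left_mor n s := TransArrow.ext'
    (UFunctor.ext (funext fun x => O.gam_one_left_obj n (s.dom.obj x))
      (funext fun f => O.gam_one_left_mor n (s.dom.mor f)))
    (UFunctor.ext (funext fun x => O.gam_one_left_obj n (s.cod.obj x))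
      (funext fun f => O.gam_one_left_mor n (s.cod.mor f)))
    (fun x => O.gam_one_left_mor n (s.tr.app x))
  gam_one_right_obj n F := UFunctor.ext (funext fun x => O.gam_one_right_obj n (F.obj x))
    (funext fun f => O.gam_one_right_mor n (F.mor f))
  gam_one_right_mor n s := TransArrow.ext'
    (UFunctor.ext (funext fun x => O.gam_one_right_obj n (s.dom.obj x))
      (funext fun f => O.gam_one_right_mor n (s.dom.mor f)))
    (UFunctor.ext (funext fun x => O.gam_one_right_obj n (s.cod.obj x))
      (funext fun f => O.gam_one_right_mor n (s.cod.mor f)))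
    (fun x => O.gam_one_right_mor n (s.tr.app x))
  gam_equivariant_obj e d F K := UFunctor.ext
    (funext fun x => O.gam_equivariant_obj e d (F.obj x) fun i => (K i).obj x)
    (funext fun f => O.gam_equivariant_mor e d (F.mor f) fun i => (K i).mor f)
  gam_equivariant_mor e d s t := TransArrow.ext'
    (UFunctor.ext
      (funext fun x => O.gam_equivariant_obj e d (s.dom.obj x) fun i => (t i).dom.obj x)
      (funext fun f => O.gam_equivariant_mor e d (s.dom.mor f) fun i => (t i).dom.mor f))
    (UFunctor.ext
      (funext fun x => O.gam_equivariant_obj e d (s.cod.obj x) fun i => (t i).cod.obj x)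
      (funext fun f => O.gam_equivariant_mor e d (s.cod.mor f) fun i => (t i).cod.mor f))
    (fun x => O.gam_equivariant_mor e d (s.tr.app x) fun i => (t i).tr.app x)
  gam_assoc_obj m p F K L := UFunctor.ext
    (funext fun x => O.gam_assoc_obj m p (F.obj x) (fun i => (K i).obj x)
      fun i s => (L i s).obj x)
    (funext fun f => O.gam_assoc_mor m p (F.mor f) (fun i => (K i).mor f)
      fun i s => (L i s).mor f)
  gam_assoc_mor m p s t r := TransArrow.ext'
    (UFunctor.ext
      (funext fun x => O.gam_assoc_obj m p (s.dom.obj x) (fun i => (t i).dom.obj x)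
        fun i j => (r i j).dom.obj x)
      (funext fun f => O.gam_assoc_mor m p (s.dom.mor f) (fun i => (t i).dom.mor f)
        fun i j => (r i j).dom.mor f))
    (UFunctor.ext
      (funext fun x => O.gam_assoc_obj m p (s.cod.obj x) (fun i => (t i).cod.obj x)
        fun i j => (r i j).cod.obj x)
      (funext fun f => O.gam_assoc_mor m p (s.cod.mor f) (fun i => (t i).cod.mor f)
        fun i j => (r i j).cod.mor f))
    (fun x => O.gam_assoc_mor m p (s.tr.app x) (fun i => (t i).tr.app x)
      fun i j => (r i j).tr.app x)

/-- The `G`-category `𝓔G`: the chaotic category on `G`, with `G` acting by left multiplication. -/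
def EG (G : Type u) [Group G] : GCat.{u, u} G := GCat.chaotic G (Monoid.toMulAction G)

/-- The permutativity operad `𝓟 = 𝓔(Assoc)`, with trivial `G`-action. -/
def permOperad (G : Type u) [Group G] : Operad.{u, 0} G := chaoticOperad G Assoc

/-- The equivariant permutativity operad `𝓟_G = Cat(𝓔G, 𝓟)`. -/
def permOperadG (G : Type u) [Group G] : Operad.{u, u} G := functorOperad (EG G) (permOperad G)

/-! ### Pseudoalgebras over an operad -/

section Pseudoalgebras

variable (O : Operad.{u, u} G)

/-- The domain `O(n) × Aⁿ` of an action. -/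
abbrev actDom (A : GCat.{u, u} G) (n : ℕ) : GCat.{u, u} G := (O.obj n).prod (A.pow n)

/-- The domain `O(n) × ∏ᵣ (O(mᵣ) × A^{mᵣ})` of an iterated action. -/
abbrev nestDom (A : GCat.{u, u} G) {n : ℕ} (m : Fin n → ℕ) : GCat.{u, u} G :=
  (O.obj n).prod (GCat.pi fun r => actDom O A (m r))

/-- The functor `O(n) × ∏ᵣ (O(mᵣ) × A^{mᵣ}) ⥤ O(m) × A^m`, where `m = ∑ mᵣ`, that shuffles the
variables and applies the structure map of the operad. -/
@[simps!]
def muFun (A : GCat.{u, u} G) {n : ℕ} (m : Fin n → ℕ) :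
    GFunctor (nestDom O A m) (actDom O A (∑ r, m r)) where
  obj x := ((O.gam m).obj (x.1, fun r => (x.2 r).1), flat fun r => (x.2 r).2)
  mor f := ((O.gam m).mor (f.1, fun r => (f.2 r).1), flat fun r => (f.2 r).2)
  src_mor _ := Prod.ext ((O.gam m).src_mor _) rfl
  tgt_mor _ := Prod.ext ((O.gam m).tgt_mor _) rfl
  mor_idt x := Prod.ext ((O.gam m).mor_idt (x.1, fun r => (x.2 r).1)) rfl
  mor_comp f g h := Prod.ext
    ((O.gam m).mor_comp (f.1, fun r => (f.2 r).1) (g.1, fun r => (g.2 r).1)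
      (Prod.ext (congrArg (fun z : (nestDom O A m).Ob => z.1) h)
        (funext fun r => congrArg (fun z : (nestDom O A m).Ob => (z.2 r).1) h))) rfl
  obj_smul c x := Prod.ext ((O.gam m).obj_smul c (x.1, fun r => (x.2 r).1)) rfl
  mor_smul c f := Prod.ext ((O.gam m).mor_smul c (f.1, fun r => (f.2 r).1)) rfl

variable {O} in
/-- The composite `θ_n ∘ (id × ∏ θ_{mᵣ})`. -/
@[simps!]
def iterAct {A : GCat.{u, u} G} (theta : ∀ n, GFunctor (actDom O A n) A) {n : ℕ}
    (m : Fin n → ℕ) : GFunctor (nestDom O A m) A :=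
  ((GFunctor.id (O.obj n)).prodMap (GFunctor.piMap fun r => theta (m r))).comp (theta n)

variable {O} in
/-- The composite `θ_m ∘ (γ × id) ∘ π`. -/
@[simps!]
def compAct {A : GCat.{u, u} G} (theta : ∀ n, GFunctor (actDom O A n) A) {n : ℕ}
    (m : Fin n → ℕ) : GFunctor (nestDom O A m) A :=
  (muFun O A m).comp (theta (∑ r, m r))

/-- An object of `O(n)` is the operadic unit if `n = 1` and it is the unit object `1` of `O(1)`. -/
def Operad.IsOne {n : ℕ} (x : (O.obj n).Ob) : Prop :=
  ∃ e : Fin n ≃ Fin 1, x = (O.act e).obj O.one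

/-- A pseudoalgebra over a reduced operad `O` of `G`-categories. An equality of a whiskering of
`phi` with an identity, or of two pasting diagrams, is stated at every object of the domain. -/
structure PsAlg : Type (u + 1) where
  /-- The underlying `G`-category. -/
  cat : GCat.{u, u} G
  /-- The action functors `θ_n : O(n) × Aⁿ ⥤ A`. -/
  theta : ∀ n, GFunctor (actDom O cat n) cat
  /-- The composition transformations `φ(n; m₁, …, m_n)`. -/
  phi : ∀ {n : ℕ} (m : Fin n → ℕ), GTrans (iterAct theta m) (compAct theta m)
  phi_invertible : ∀ {n : ℕ} (m : Fin n → ℕ), (phi m).IsInvertible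
  /-- Equivariance of the action: `θ(o · e; a) = θ(o; e a)`. -/
  theta_equivariant_obj : ∀ {n n' : ℕ} (e : Fin n ≃ Fin n') (o : (O.obj n').Ob)
    (a : Fin n → cat.Ob),
    (theta n).obj ((O.act e).obj o, a) = (theta n').obj (o, fun j => a (e.symm j))
  theta_equivariant_mor : ∀ {n n' : ℕ} (e : Fin n ≃ Fin n') (o : (O.obj n').Mor)
    (a : Fin n → cat.Mor),
    (theta n).mor ((O.act e).mor o, a) = (theta n').mor (o, fun j => a (e.symm j))
  /-- Unit object: `φ(n; 1, …, 1, 0, 1, …, 1)` is the identity at the operations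
  `(o; 1, …, 1, 0, 1, …, 1)`. -/
  phi_unit_object : ∀ {n : ℕ} (m : Fin n → ℕ) (r : Fin n) (o : (O.obj n).Ob)
    (x : ∀ i, (O.obj (m i)).Ob) (a : ∀ i, Fin (m i) → cat.Ob), m r = 0 →
    (∀ i, i ≠ r → O.IsOne (x i)) →
    (phi m).app (o, fun i => (x i, a i)) =
      cat.idt ((theta n).obj (o, fun i => (theta (m i)).obj (x i, a i)))
  /-- Operadic identity: `θ(1; a) = a`. -/
  theta_one_obj : ∀ a : Fin 1 → cat.Ob, (theta 1).obj (O.one, a) = a 0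
  theta_one_mor : ∀ a : Fin 1 → cat.Mor, (theta 1).mor ((O.obj 1).idt O.one, a) = a 0
  /-- Equivariance of `φ` with respect to permutations of the blocks and inside the blocks. -/
  phi_equivariant : ∀ {k k' : ℕ} {m : Fin k → ℕ} {m' : Fin k' → ℕ} (e : Fin k ≃ Fin k')
    (d : ∀ i, Fin (m i) ≃ Fin (m' (e i))) (o : (O.obj k').Ob) (x : ∀ i, (O.obj (m' i)).Ob)
    (a : ∀ i, Fin (m' i) → cat.Ob),
    (phi m).app ((O.act e).obj o,
        fun i => ((O.act (d i)).obj (x (e i)), fun s => a (e i) (d i s))) =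
      (phi m').app (o, fun i => (x i, a i))
  /-- Operadic identity for `φ(1; n)`. -/
  phi_one_left : ∀ (n : ℕ) (x : (O.obj n).Ob) (a : Fin n → cat.Ob),
    (phi fun _ : Fin 1 => n).app (O.one, fun _ => (x, a)) = cat.idt ((theta n).obj (x, a))
  /-- Operadic identity for `φ(n; 1, …, 1)`. -/
  phi_one_right : ∀ (n : ℕ) (x : (O.obj n).Ob) (a : Fin n → cat.Ob),
    (phi fun _ : Fin n => 1).app (x, fun i => (O.one, fun _ => a i)) =
      cat.idt ((theta n).obj (x, a))
  /-- Operadic composition: the two ways to contract a threefold composite agree. -/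
  phi_assoc : ∀ {n : ℕ} (m : Fin n → ℕ) (p : ∀ r, Fin (m r) → ℕ) (o : (O.obj n).Ob)
    (x : ∀ r, (O.obj (m r)).Ob) (y : ∀ r s, (O.obj (p r s)).Ob)
    (a : ∀ r s, Fin (p r s) → cat.Ob),
    cat.comp
      ((phi m).app (o, fun r => (x r, fun s => (theta (p r s)).obj (y r s, a r s))))
      ((phi (flat p)).app ((O.gam m).obj (o, x),
        fun j => (y (blk m j).1 (blk m j).2, a (blk m j).1 (blk m j).2)))
      (by rw [UTrans.tgt_app, UTrans.src_app]; rfl) =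
    cat.comp
      ((theta n).mor ((O.obj n).idt o,
        fun r => (phi (p r)).app (x r, fun s => (y r s, a r s))))
      ((phi fun r => ∑ s, p r s).app
        (o, fun r => ((O.gam (p r)).obj (x r, y r), flat (a r))))
      (by
        rw [UFunctor.tgt_mor, UTrans.src_app]
        refine congrArg (theta n).obj (Prod.ext ((O.obj n).tgt_idt o) ?_)
        exact funext fun r => (phi (p r)).tgt_app _)

variable {O}

/-- A pseudoalgebra is a strict algebra if all `φ` are identities. -/
def PsAlg.IsStrict (A : PsAlg O) : Prop :=
  ∀ {n : ℕ} (m : Fin n → ℕ) (x : (nestDom O A.cat m).Ob),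
    (A.phi m).app x = A.cat.idt ((iterAct A.theta m).obj x)

/-- The composite `ξ_n ∘ (id × fⁿ)`. -/
@[simps!]
def actAfter (A B : PsAlg O) (f : GFunctor A.cat B.cat) (n : ℕ) :
    GFunctor (actDom O A.cat n) B.cat :=
  ((GFunctor.id (O.obj n)).prodMap (GFunctor.piMap fun _ => f)).comp (B.theta n)

/-- The composite `f ∘ θ_n`. -/
@[simps!]
def actBefore (A B : PsAlg O) (f : GFunctor A.cat B.cat) (n : ℕ) :
    GFunctor (actDom O A.cat n) B.cat :=
  (A.theta n).comp f

/-- A pseudomorphism `(f, ζ)` of pseudoalgebras. -/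
structure PsMor (A B : PsAlg O) : Type u where
  fn : GFunctor A.cat B.cat
  zeta : ∀ n, GTrans (actAfter A B fn n) (actBefore A B fn n)
  zeta_invertible : ∀ n, (zeta n).IsInvertible
  /-- `ζ₀` is the identity. -/
  zeta_zero : ∀ x : (actDom O A.cat 0).Ob,
    (zeta 0).app x = B.cat.idt (fn.obj ((A.theta 0).obj x))
  /-- `ζ₁` is the identity at the operadic unit. -/
  zeta_one : ∀ a : Fin 1 → A.cat.Ob, (zeta 1).app (O.one, a) = B.cat.idt (fn.obj (a 0))
  zeta_equivariant : ∀ {n n' : ℕ} (e : Fin n ≃ Fin n') (o : (O.obj n').Ob)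
    (a : Fin n' → A.cat.Ob),
    (zeta n).app ((O.act e).obj o, fun i => a (e i)) = (zeta n').app (o, a)
  /-- The compatibility of `ζ` with the composition transformations `φ` and `ψ`. -/
  zeta_phi : ∀ {n : ℕ} (m : Fin n → ℕ) (o : (O.obj n).Ob) (x : ∀ r, (O.obj (m r)).Ob)
    (a : ∀ r, Fin (m r) → A.cat.Ob),
    B.cat.comp
      (B.cat.comp
        ((B.theta n).mor ((O.obj n).idt o, fun r => (zeta (m r)).app (x r, a r)))
        ((zeta n).app (o, fun r => (A.theta (m r)).obj (x r, a r)))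
        (by
          rw [UFunctor.tgt_mor, UTrans.src_app]
          refine congrArg (B.theta n).obj (Prod.ext ((O.obj n).tgt_idt o) ?_)
          exact funext fun r => (zeta (m r)).tgt_app _))
      (fn.mor ((A.phi m).app (o, fun r => (x r, a r))))
      (by
        rw [GCat.tgt_comp, UTrans.tgt_app, UFunctor.src_mor, UTrans.src_app]
        rfl) =
    B.cat.comp
      ((B.phi m).app (o, fun r => (x r, fun s => fn.obj (a r s))))
      ((zeta (∑ r, m r)).app ((O.gam m).obj (o, x), flat a))
      (by rw [UTrans.tgt_app, UTrans.src_app]; rfl)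

/-- A pseudomorphism is a strict map if all `ζ_n` are identities. -/
def PsMor.IsStrict {A B : PsAlg O} (f : PsMor A B) : Prop :=
  ∀ (n : ℕ) (x : (actDom O A.cat n).Ob),
    (f.zeta n).app x = B.cat.idt (f.fn.obj ((A.theta n).obj x))

/-- An algebra 2-cell `(f, ζ) ⟹ (g, κ)`. -/
structure AlgCell {A B : PsAlg O} (f g : PsMor A B) extends GTrans f.fn g.fn where
  compat : ∀ (n : ℕ) (o : (O.obj n).Ob) (a : Fin n → A.cat.Ob),
    B.cat.comp
      ((B.theta n).mor ((O.obj n).idt o, fun i => app (a i)))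
      ((g.zeta n).app (o, a))
      (by
        rw [UFunctor.tgt_mor, UTrans.src_app]
        refine congrArg (B.theta n).obj (Prod.ext ((O.obj n).tgt_idt o) ?_)
        exact funext fun i => tgt_app (a i)) =
    B.cat.comp ((f.zeta n).app (o, a)) (app ((A.theta n).obj (o, a)))
      (by rw [UTrans.tgt_app, src_app]; rfl)


/-! ### The 2-category of pseudoalgebras -/

namespace GTrans

variable {A : GCat.{u, v} G} {B : GCat.{u, w} G} {C : GCat.{u, v'} G}

/-- Whiskering with a `G`-functor that is applied first. -/
@[simps!]
def pre (K : GFunctor A B) {F F' : GFunctor B C} (s : GTrans F F') :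
    GTrans (K.comp F) (K.comp F') where
  app x := s.app (K.obj x)
  src_app _ := by simp
  tgt_app _ := by simp
  naturality f := by
    have := s.naturality (K.mor f)
    simp only [K.src_mor, K.tgt_mor] at this
    exact this
  app_smul c x := by rw [K.obj_smul, s.app_smul]

/-- Whiskering with a `G`-functor that is applied last. -/
@[simps!]
def post {F F' : GFunctor A B} (s : GTrans F F') (K : GFunctor B C) :
    GTrans (F.comp K) (F'.comp K) where
  toUTrans := s.toUTrans.whisker K.toUFunctor
  app_smul c x := by
    change K.mor (s.app (c • x)) = c • K.mor (s.app x)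
    rw [s.app_smul, K.mor_smul]

theorem vcomp_assoc {F₁ F₂ F₃ F₄ : GFunctor A B} (s : GTrans F₁ F₂) (t : GTrans F₂ F₃)
    (r : GTrans F₃ F₄) : (s.vcomp t).vcomp r = s.vcomp (t.vcomp r) :=
  ext' fun _ => B.assoc' _ _ _ _ _

theorem id_vcomp {F F' : GFunctor A B} (s : GTrans F F') : (GTrans.id F).vcomp s = s :=
  ext' fun _ => B.idt_comp' _ _ _

theorem vcomp_id {F F' : GFunctor A B} (s : GTrans F F') : s.vcomp (GTrans.id F') = s :=
  ext' fun _ => B.comp_idt' _ _ _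

theorem isInvertible_id (F : GFunctor A B) : (GTrans.id F).IsInvertible :=
  ⟨GTrans.id F, id_vcomp _, id_vcomp _⟩

theorem IsInvertible.vcomp {F₁ F₂ F₃ : GFunctor A B} {s : GTrans F₁ F₂} {t : GTrans F₂ F₃}
    (hs : s.IsInvertible) (ht : t.IsInvertible) : (s.vcomp t).IsInvertible := by
  obtain ⟨s', h₁, h₂⟩ := hs
  obtain ⟨t', h₃, h₄⟩ := ht
  refine ⟨t'.vcomp s', ?_, ?_⟩
  · rw [vcomp_assoc, ← vcomp_assoc t, h₃, id_vcomp, h₁]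
  · rw [vcomp_assoc, ← vcomp_assoc s', h₂, id_vcomp, h₄]

theorem IsInvertible.pre (K : GFunctor A B) {F F' : GFunctor B C} {s : GTrans F F'}
    (hs : s.IsInvertible) : (s.pre K).IsInvertible := by
  obtain ⟨s', h₁, h₂⟩ := hs
  exact ⟨s'.pre K, ext' fun x => congrArg (fun t : GTrans F F => t.app (K.obj x)) h₁,
    ext' fun x => congrArg (fun t : GTrans F' F' => t.app (K.obj x)) h₂⟩

theorem IsInvertible.post {F F' : GFunctor A B} {s : GTrans F F'} (hs : s.IsInvertible)
    (K : GFunctor B C) : (s.post K).IsInvertible := by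
  obtain ⟨s', h₁, h₂⟩ := hs
  refine ⟨s'.post K, ext' fun x => ?_, ext' fun x => ?_⟩
  · have := congrArg (fun t : GTrans F F => K.mor (t.app x)) h₁
    simp only [vcomp_app, id_app, K.mor_comp, K.mor_idt] at this
    exact this
  · have := congrArg (fun t : GTrans F' F' => K.mor (t.app x)) h₂
    simp only [vcomp_app, id_app, K.mor_comp, K.mor_idt] at this
    exact this

end GTrans

namespace GCat

/-- Replace the two first factors of a threefold composite. -/
theorem reassoc (A : GCat.{u, v} G) {f g f' g' : A.Mor} {h : A.tgt f = A.src g}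
    {h' : A.tgt f' = A.src g'} (e : A.comp f g h = A.comp f' g' h') (k : A.Mor)
    (hk : A.tgt g = A.src k) (hk' : A.tgt g' = A.src k) :
    A.comp f (A.comp g k hk) (h.trans (A.src_comp _ _ _).symm) =
      A.comp f' (A.comp g' k hk') (h'.trans (A.src_comp _ _ _).symm) := by
  rw [← A.assoc f g k h hk, ← A.assoc f' g' k h' hk']
  exact A.comp_congr e rfl _

theorem paste_five (A : GCat.{u, v} G) {t₁ t₂ s₁ s₂ q k l b z w y : A.Mor}
    (h₁ : A.tgt t₁ = A.src t₂) (h₂ : A.tgt s₁ = A.src s₂)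
    (h₃ : A.tgt (A.comp t₁ t₂ h₁) = A.src (A.comp s₁ s₂ h₂))
    (h₄ : A.tgt (A.comp (A.comp t₁ t₂ h₁) (A.comp s₁ s₂ h₂) h₃) = A.src q)
    {h₅ : A.tgt t₂ = A.src s₁} {h₆ : A.tgt k = A.src l}
    (e₁ : A.comp t₂ s₁ h₅ = A.comp k l h₆)
    {h₇ : A.tgt l = A.src s₂} {h₈ : A.tgt (A.comp l s₂ h₇) = A.src q} {h₉ : A.tgt b = A.src z}
    (e₂ : A.comp (A.comp l s₂ h₇) q h₈ = A.comp b z h₉)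
    {h₁₀ : A.tgt t₁ = A.src k} {h₁₁ : A.tgt (A.comp t₁ k h₁₀) = A.src b}
    {h₁₂ : A.tgt w = A.src y}
    (e₃ : A.comp (A.comp t₁ k h₁₀) b h₁₁ = A.comp w y h₁₂)
    (h₁₃ : A.tgt y = A.src z) (h₁₄ : A.tgt w = A.src (A.comp y z h₁₃)) :
    A.comp (A.comp (A.comp t₁ t₂ h₁) (A.comp s₁ s₂ h₂) h₃) q h₄ =
      A.comp w (A.comp y z h₁₃) h₁₄ := by
  have hq : A.tgt s₂ = A.src q := (A.tgt_comp _ _ _).symm.trans h₈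
  rw [A.assoc'] at e₂
  have r₁ := A.reassoc e₁ (A.comp s₂ q hq) (h₂.trans (A.src_comp _ _ _).symm)
    (h₇.trans (A.src_comp _ _ _).symm)
  have r₃ := A.reassoc e₃ z h₉ h₁₃
  rw [A.assoc'] at r₃
  simp only [A.assoc']
  refine (A.comp_congr rfl (r₁.trans (A.comp_congr rfl e₂ _)) _).trans r₃

theorem paste_three (A : GCat.{u, v} G) {t k z a b c d e : A.Mor}
    (h₁ : A.tgt k = A.src z) (h₂ : A.tgt t = A.src (A.comp k z h₁))
    {h₃ : A.tgt t = A.src k} {h₄ : A.tgt a = A.src b} (e₁ : A.comp t k h₃ = A.comp a b h₄)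
    {h₅ : A.tgt b = A.src z} {h₆ : A.tgt d = A.src e}
    (e₂ : A.comp b z h₅ = A.comp d e h₆)
    (hc : a = c) (h₇ : A.tgt c = A.src d) (h₈ : A.tgt (A.comp c d h₇) = A.src e) :
    A.comp t (A.comp k z h₁) h₂ = A.comp (A.comp c d h₇) e h₈ := by
  subst hc
  rw [A.reassoc e₁ z h₁ h₅, A.assoc']
  exact A.comp_congr rfl e₂ _

end GCat

theorem theta_mor_comp (A : PsAlg O) {n : ℕ} (o : (O.obj n).Ob) (f g : Fin n → A.cat.Mor)
    (h : ∀ i, A.cat.tgt (f i) = A.cat.src (g i)) :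
    (A.theta n).mor ((O.obj n).idt o, fun i => A.cat.comp (f i) (g i) (h i)) =
      A.cat.comp ((A.theta n).mor ((O.obj n).idt o, f)) ((A.theta n).mor ((O.obj n).idt o, g))
        (by
          rw [UFunctor.tgt_mor, UFunctor.src_mor]
          exact congrArg (A.theta n).obj (Prod.ext (by simp) (funext h))) := by
  rw [← (A.theta n).mor_comp _ _ (Prod.ext (by simp) (funext h))]
  exact congrArg (A.theta n).mor (Prod.ext ((O.obj n).idt_comp' _ _ _).symm rfl)

theorem theta_mor_idt (A : PsAlg O) {n : ℕ} (o : (O.obj n).Ob) (a : Fin n → A.cat.Ob) :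
    (A.theta n).mor ((O.obj n).idt o, fun i => A.cat.idt (a i)) =
      A.cat.idt ((A.theta n).obj (o, a)) :=
  (A.theta n).mor_idt (o, a)

/-- Naturality of `ζ_n` in the variables of the algebra. -/
theorem PsMor.zeta_naturality {A B : PsAlg O} (f : PsMor A B) {n : ℕ} (o : (O.obj n).Ob)
    (s : Fin n → A.cat.Mor) (a b : Fin n → A.cat.Ob) (ha : ∀ i, A.cat.src (s i) = a i)
    (hb : ∀ i, A.cat.tgt (s i) = b i) :
    B.cat.comp ((B.theta n).mor ((O.obj n).idt o, fun i => f.fn.mor (s i)))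
        ((f.zeta n).app (o, b))
        (by
          rw [UFunctor.tgt_mor, UTrans.src_app]
          exact congrArg (B.theta n).obj (Prod.ext (by simp) (funext fun i => by simp [hb]))) =
      B.cat.comp ((f.zeta n).app (o, a)) (f.fn.mor ((A.theta n).mor ((O.obj n).idt o, s)))
        (by
          rw [UTrans.tgt_app, UFunctor.src_mor, UFunctor.src_mor]
          exact congrArg (fun z => f.fn.obj ((A.theta n).obj z))
            (Prod.ext (by simp) (funext fun i => (ha i).symm))) := by
  obtain rfl : (fun i => A.cat.src (s i)) = a := funext ha
  obtain rfl : (fun i => A.cat.tgt (s i)) = b := funext hb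
  have h := (f.zeta n).naturality ((O.obj n).idt o, s)
  simp only [GCat.src_idt, GCat.tgt_idt] at h
  exact h

theorem PsMor.ext' {A B : PsAlg O} {f g : PsMor A B} (hf : f.fn = g.fn)
    (hz : ∀ n x, (f.zeta n).app x = (g.zeta n).app x) : f = g := by
  cases f with | mk f zf _ _ _ _ _ => cases g with | mk g zg _ _ _ _ _ =>
  dsimp only at hf
  subst hf
  have : zf = zg := funext fun n => GTrans.ext' (hz n)
  subst this
  rfl

theorem AlgCell.ext' {A B : PsAlg O} {f g : PsMor A B} {s t : AlgCell f g}
    (h : ∀ x, s.app x = t.app x) : s = t := by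
  cases s with | mk s _ => cases t with | mk t _ =>
  have : s = t := GTrans.ext' h
  subst this; rfl

/-- The identity pseudomorphism. -/
def PsMor.id (A : PsAlg O) : PsMor A A where
  fn := GFunctor.id A.cat
  zeta n := GTrans.id (A.theta n)
  zeta_invertible n := GTrans.isInvertible_id (A.theta n)
  zeta_zero _ := rfl
  zeta_one a := congrArg A.cat.idt (A.theta_one_obj a)
  zeta_equivariant e o a := by
    refine congrArg A.cat.idt ((A.theta_equivariant_obj e o _).trans ?_)
    simp
  zeta_phi m o x a := by
    have h : A.cat.src ((A.phi m).app (o, fun r => (x r, a r))) =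
      (A.theta _).obj (o, fun r => (A.theta (m r)).obj (x r, a r)) := (A.phi m).src_app _
    have h₂ := theta_mor_idt A o fun r => (A.theta (m r)).obj (x r, a r)
    have h₃ := A.cat.comp_idt' ((A.theta (∑ r, m r)).obj ((O.gam m).obj (o, x), flat a))
      ((A.phi m).app (o, fun r => (x r, a r)))
      (by rw [UTrans.tgt_app, GCat.src_idt]; rfl)
    refine Eq.trans ?_ h₃.symm
    refine (A.cat.comp_congr ((A.cat.comp_congr h₂ rfl _).trans (A.cat.idt_comp' _ _ _)) rfl
      _).trans ?_
    exact A.cat.idt_comp' _ _ _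

/-- Composition of pseudomorphisms, in diagrammatic order. -/
def PsMor.comp {A B C : PsAlg O} (f : PsMor A B) (g : PsMor B C) : PsMor A C where
  fn := f.fn.comp g.fn
  zeta n := GTrans.vcomp (F' := (actAfter A B f.fn n).comp g.fn)
    ((g.zeta n).pre ((GFunctor.id (O.obj n)).prodMap (GFunctor.piMap fun _ => f.fn)))
    ((f.zeta n).post g.fn)
  zeta_invertible n := GTrans.IsInvertible.vcomp (F₂ := (actAfter A B f.fn n).comp g.fn)
    ((g.zeta_invertible n).pre _) ((f.zeta_invertible n).post _)
  zeta_zero x := by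
    refine (C.cat.comp_congr (g.zeta_zero _) rfl _).trans ((C.cat.idt_comp' _ _ _).trans ?_)
    exact (congrArg g.fn.mor (f.zeta_zero x)).trans (g.fn.mor_idt _)
  zeta_one a := by
    refine (C.cat.comp_congr (g.zeta_one fun i => f.fn.obj (a i)) rfl _).trans
      ((C.cat.idt_comp' _ _ _).trans ?_)
    exact (congrArg g.fn.mor (f.zeta_one a)).trans (g.fn.mor_idt _)
  zeta_equivariant e o a :=
    C.cat.comp_congr (g.zeta_equivariant e o fun i => f.fn.obj (a i))
      (congrArg g.fn.mor (f.zeta_equivariant e o a)) _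
  zeta_phi {n} m o x a := by
    have e₀ := theta_mor_comp C o
      (fun r => (g.zeta (m r)).app (x r, fun s => f.fn.obj (a r s)))
      (fun r => g.fn.mor ((f.zeta (m r)).app (x r, a r)))
      (fun r => by rw [UTrans.tgt_app, UFunctor.src_mor, UTrans.src_app]; rfl)
    have e₁ := g.zeta_naturality o (fun r => (f.zeta (m r)).app (x r, a r))
      (fun r => (B.theta (m r)).obj (x r, fun s => f.fn.obj (a r s)))
      (fun r => f.fn.obj ((A.theta (m r)).obj (x r, a r)))
      (fun r => (f.zeta (m r)).src_app _) (fun r => (f.zeta (m r)).tgt_app _)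
    have e₂ := congrArg g.fn.mor (f.zeta_phi m o x a)
    simp only [g.fn.mor_comp] at e₂
    have e₃ := g.zeta_phi m o x (fun r s => f.fn.obj (a r s))
    refine (C.cat.comp_congr (C.cat.comp_congr e₀ rfl _) rfl _).trans ?_
    exact C.cat.paste_five _ _ _ _ e₁ e₂ e₃ _ _

/-- The identity 2-cell. -/
def AlgCell.id {A B : PsAlg O} (f : PsMor A B) : AlgCell f f where
  toGTrans := GTrans.id f.fn
  compat n o a := by
    refine (B.cat.comp_congr (theta_mor_idt B o fun i => f.fn.obj (a i)) rfl _).trans ?_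
    exact (B.cat.idt_comp' _ _ _).trans (B.cat.comp_idt' _ _ _).symm

/-- Vertical composition of 2-cells. -/
def AlgCell.vcomp {A B : PsAlg O} {f g h : PsMor A B} (s : AlgCell f g) (t : AlgCell g h) :
    AlgCell f h where
  toGTrans := s.toGTrans.vcomp t.toGTrans
  compat n o a := by
    refine (B.cat.comp_congr (theta_mor_comp B o (fun i => s.app (a i)) (fun i => t.app (a i))
      (fun i => by rw [UTrans.tgt_app, UTrans.src_app])) rfl _).trans ?_
    exact (B.cat.paste_three _ _ (s.compat n o a).symm (t.compat n o a).symm rfl _ _).symm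

/-- Whiskering of a 2-cell with a pseudomorphism that is applied first. -/
def AlgCell.whiskerL {A B C : PsAlg O} (f : PsMor A B) {g h : PsMor B C} (s : AlgCell g h) :
    AlgCell (f.comp g) (f.comp h) where
  toGTrans := s.toGTrans.pre f.fn
  compat n o a := by
    have e := s.naturality ((f.zeta n).app (o, a))
    simp only [UTrans.src_app, UTrans.tgt_app] at e
    exact C.cat.paste_three _ _ (s.compat n o fun i => f.fn.obj (a i)) e.symm rfl _ _

/-- Whiskering of a 2-cell with a pseudomorphism that is applied last. -/
def AlgCell.whiskerR {A B C : PsAlg O} {f g : PsMor A B} (s : AlgCell f g) (h : PsMor B C) :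
    AlgCell (f.comp h) (g.comp h) where
  toGTrans := s.toGTrans.post h.fn
  compat n o a := by
    have e₁ := h.zeta_naturality o (fun i => s.app (a i)) (fun i => f.fn.obj (a i))
      (fun i => g.fn.obj (a i)) (fun i => s.src_app _) (fun i => s.tgt_app _)
    have e₂ := congrArg h.fn.mor (s.compat n o a)
    simp only [h.fn.mor_comp] at e₂
    exact C.cat.paste_three _ _ e₁ e₂ rfl _ _

theorem PsMor.id_comp {A B : PsAlg O} (f : PsMor A B) : (PsMor.id A).comp f = f :=
  PsMor.ext' rfl fun _ _ =>
    (B.cat.comp_congr rfl (f.fn.mor_idt _) _).trans (B.cat.comp_idt' _ _ _)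

theorem PsMor.comp_id {A B : PsAlg O} (f : PsMor A B) : f.comp (PsMor.id B) = f :=
  PsMor.ext' rfl fun _ _ => B.cat.idt_comp' _ _ _

theorem PsMor.comp_assoc {A B C D : PsAlg O} (f : PsMor A B) (g : PsMor B C) (h : PsMor C D) :
    (f.comp g).comp h = f.comp (g.comp h) :=
  PsMor.ext' rfl fun _ _ =>
    (D.cat.comp_congr rfl (h.fn.mor_comp _ _ _) _).trans (D.cat.assoc' _ _ _ _ _).symm

instance PsAlg.categoryStruct : CategoryStruct (PsAlg O) where
  Hom A B := PsMor A B
  id A := PsMor.id A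
  comp f g := PsMor.comp f g

instance PsAlg.homCategory (A B : PsAlg O) : Category (A ⟶ B) where
  Hom f g := AlgCell f g
  id f := AlgCell.id f
  comp s t := AlgCell.vcomp s t
  id_comp _ := AlgCell.ext' fun _ => B.cat.idt_comp' _ _ _
  comp_id _ := AlgCell.ext' fun _ => B.cat.comp_idt' _ _ _
  assoc _ _ _ := AlgCell.ext' fun _ => B.cat.assoc' _ _ _ _ _

theorem PsAlg.id_comp_eq {A B : PsAlg O} (f : A ⟶ B) : 𝟙 A ≫ f = f := PsMor.id_comp f

theorem PsAlg.comp_id_eq {A B : PsAlg O} (f : A ⟶ B) : f ≫ 𝟙 B = f := PsMor.comp_id f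

theorem PsAlg.assoc_eq {A B C D : PsAlg O} (f : A ⟶ B) (g : B ⟶ C) (h : C ⟶ D) :
    (f ≫ g) ≫ h = f ≫ g ≫ h := PsMor.comp_assoc f g h

theorem GTrans.naturality' {A : GCat.{u, v} G} {B : GCat.{u, w} G} {F F' : GFunctor A B}
    (s : GTrans F F') (f : A.Mor) (a b : A.Ob) (ha : A.src f = a) (hb : A.tgt f = b) :
    B.comp (F.mor f) (s.app b) (by simp [hb]) = B.comp (s.app a) (F'.mor f) (by simp [ha]) := by
  subst ha; subst hb; exact s.naturality f

theorem PsAlg.eqToHom_app {A B : PsAlg O} {f g : A ⟶ B} (h : f = g) (x : A.cat.Ob) :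
    (eqToHom h : AlgCell f g).app x = B.cat.idt (f.fn.obj x) := by
  subst h; rfl

theorem PsAlg.conj_app {A B : PsAlg O} {f f' g g' : A ⟶ B} (h : f = f') (s : f' ⟶ g')
    (h' : g' = g) (x : A.cat.Ob) :
    (AlgCell.toGTrans (eqToHom h ≫ s ≫ eqToHom h')).app x = (AlgCell.toGTrans s).app x := by
  subst h; subst h'; simp

theorem PsAlg.whiskerL_eqToHom {A B C : PsAlg O} (f : A ⟶ B) {g g' : B ⟶ C} (e : g = g') :
    AlgCell.whiskerL f (eqToHom e) = eqToHom (congrArg (fun k => f ≫ k) e) := by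
  subst e; rfl

theorem PsAlg.whiskerR_eqToHom {A B C : PsAlg O} {f f' : A ⟶ B} (e : f = f') (g : B ⟶ C) :
    AlgCell.whiskerR (eqToHom e) g = eqToHom (congrArg (fun k => k ≫ g) e) := by
  subst e; exact AlgCell.ext' fun _ => g.fn.mor_idt _

theorem PsAlg.pentagon_eq {A B C D E : PsAlg O} (f : A ⟶ B) (g : B ⟶ C) (h : C ⟶ D)
    (i : D ⟶ E) :
    (AlgCell.whiskerR (eqToHom (PsAlg.assoc_eq f g h)) i :
        ((f ≫ g) ≫ h) ≫ i ⟶ (f ≫ g ≫ h) ≫ i) ≫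
      eqToHom (PsAlg.assoc_eq f (g ≫ h) i) ≫
        (AlgCell.whiskerL f (eqToHom (PsAlg.assoc_eq g h i)) :
          f ≫ (g ≫ h) ≫ i ⟶ f ≫ g ≫ h ≫ i) =
      eqToHom (PsAlg.assoc_eq (f ≫ g) h i) ≫ eqToHom (PsAlg.assoc_eq f g (h ≫ i)) := by
  rw [PsAlg.whiskerL_eqToHom, PsAlg.whiskerR_eqToHom]
  simp only [eqToHom_trans]

theorem PsAlg.triangle_eq {A B C : PsAlg O} (f : A ⟶ B) (g : B ⟶ C) :
    eqToHom (PsAlg.assoc_eq f (𝟙 B) g) ≫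
      (AlgCell.whiskerL f (eqToHom (PsAlg.id_comp_eq g)) : f ≫ 𝟙 B ≫ g ⟶ f ≫ g) =
        AlgCell.whiskerR (eqToHom (PsAlg.comp_id_eq f)) g := by
  rw [PsAlg.whiskerL_eqToHom, PsAlg.whiskerR_eqToHom]
  simp only [eqToHom_trans]

/-- The 2-category of pseudoalgebras, pseudomorphisms and algebra 2-cells. -/
instance PsAlg.bicategory : Bicategory (PsAlg O) where
  whiskerLeft f _ _ s := AlgCell.whiskerL f s
  whiskerRight s h := AlgCell.whiskerR s h
  associator f g h := eqToIso (PsAlg.assoc_eq f g h)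
  leftUnitor f := eqToIso (PsAlg.id_comp_eq f)
  rightUnitor f := eqToIso (PsAlg.comp_id_eq f)
  whiskerLeft_id _ _ := rfl
  whiskerLeft_comp _ _ _ _ _ _ := rfl
  id_whiskerLeft s := AlgCell.ext' fun x => (PsAlg.conj_app (PsAlg.id_comp_eq _) s
    (PsAlg.id_comp_eq _).symm x).symm
  comp_whiskerLeft f g _ _ s := AlgCell.ext' fun x => (PsAlg.conj_app (PsAlg.assoc_eq _ _ _)
    (AlgCell.whiskerL f (AlgCell.whiskerL g s)) (PsAlg.assoc_eq _ _ _).symm x).symm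
  id_whiskerRight _ h := AlgCell.ext' fun _ => h.fn.mor_idt _
  comp_whiskerRight _ _ h := AlgCell.ext' fun _ => h.fn.mor_comp _ _ _
  whiskerRight_id s := AlgCell.ext' fun x => (PsAlg.conj_app (PsAlg.comp_id_eq _) s
    (PsAlg.comp_id_eq _).symm x).symm
  whiskerRight_comp s g h := AlgCell.ext' fun x =>
    (PsAlg.conj_app (PsAlg.assoc_eq _ _ _).symm (AlgCell.whiskerR (AlgCell.whiskerR s g) h)
      (PsAlg.assoc_eq _ _ _) x).symm
  whisker_assoc f _ _ s h := AlgCell.ext' fun x => (PsAlg.conj_app (PsAlg.assoc_eq _ _ _)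
    (AlgCell.whiskerL f (AlgCell.whiskerR s h)) (PsAlg.assoc_eq _ _ _).symm x).symm
  whisker_exchange s t := AlgCell.ext' fun x =>
    ((AlgCell.toGTrans t).naturality' ((AlgCell.toGTrans s).app x) _ _
      ((AlgCell.toGTrans s).src_app x) ((AlgCell.toGTrans s).tgt_app x)).symm
  pentagon f g h i := PsAlg.pentagon_eq f g h i
  triangle f g := PsAlg.triangle_eq f g

instance PsAlg.strict : Bicategory.Strict (PsAlg O) where
  id_comp := PsAlg.id_comp_eq
  comp_id := PsAlg.comp_id_eq
  assoc := PsAlg.assoc_eq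
  leftUnitor_eqToIso _ := rfl
  rightUnitor_eqToIso _ := rfl
  associator_eqToIso _ _ _ := rfl

/-! ### The 2-category of strict algebras and the inclusion -/

variable (O) in
/-- Strict algebras over an operad. -/
structure StrictAlg : Type (u + 1) where
  alg : PsAlg O
  isStrict : alg.IsStrict

/-- Strict maps of strict algebras. -/
structure StrictMor (A B : StrictAlg O) : Type u where
  mor : A.alg ⟶ B.alg
  isStrict : PsMor.IsStrict mor

theorem StrictMor.ext' {A B : StrictAlg O} {f g : StrictMor A B} (h : f.mor = g.mor) : f = g := by
  cases f; cases g; dsimp only at h; subst h; rfl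

instance StrictAlg.categoryStruct : CategoryStruct (StrictAlg O) where
  Hom A B := StrictMor A B
  id A := ⟨𝟙 A.alg, fun _ _ => rfl⟩
  comp {A B C} f g := ⟨f.mor ≫ g.mor, fun n x => by
    refine (C.alg.cat.comp_congr (g.isStrict n _) rfl _).trans
      ((C.alg.cat.idt_comp' _ _ _).trans ?_)
    exact (congrArg (PsMor.fn g.mor).mor (f.isStrict n x)).trans ((PsMor.fn g.mor).mor_idt _)⟩

/-- The 2-cells between strict maps are all algebra 2-cells. -/
@[ext]
structure StrictCell {A B : StrictAlg O} (f g : A ⟶ B) : Type u where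
  cell : f.mor ⟶ g.mor

instance StrictAlg.homCategory (A B : StrictAlg O) : Category (A ⟶ B) where
  Hom f g := StrictCell f g
  id f := StrictCell.mk (𝟙 f.mor)
  comp s t := StrictCell.mk (s.cell ≫ t.cell)
  id_comp _ := StrictCell.ext (Category.id_comp _)
  comp_id _ := StrictCell.ext (Category.comp_id _)
  assoc _ _ _ := StrictCell.ext (Category.assoc _ _ _)

/-- An invertible algebra 2-cell between strict maps. -/
def StrictCell.isoMk {A B : StrictAlg O} {f g : A ⟶ B} (e : f.mor ≅ g.mor) : f ≅ g where
  hom := StrictCell.mk e.hom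
  inv := StrictCell.mk e.inv
  hom_inv_id := StrictCell.ext e.hom_inv_id
  inv_hom_id := StrictCell.ext e.inv_hom_id

/-- The 2-category of strict algebras, strict maps and algebra 2-cells. -/
instance StrictAlg.bicategory : Bicategory (StrictAlg O) where
  whiskerLeft f _ _ s := StrictCell.mk (StrictMor.mor f ◁ StrictCell.cell s)
  whiskerRight s h := StrictCell.mk (StrictCell.cell s ▷ StrictMor.mor h)
  associator f g h := StrictCell.isoMk (α_ f.mor g.mor h.mor)
  leftUnitor f := StrictCell.isoMk (λ_ f.mor)
  rightUnitor f := StrictCell.isoMk (ρ_ f.mor)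
  whiskerLeft_id _ _ := StrictCell.ext (Bicategory.whiskerLeft_id _ _)
  whiskerLeft_comp _ _ _ _ _ _ := StrictCell.ext (Bicategory.whiskerLeft_comp _ _ _)
  id_whiskerLeft _ := StrictCell.ext (Bicategory.id_whiskerLeft _)
  comp_whiskerLeft _ _ _ _ _ := StrictCell.ext (Bicategory.comp_whiskerLeft _ _ _)
  id_whiskerRight _ _ := StrictCell.ext (Bicategory.id_whiskerRight _ _)
  comp_whiskerRight _ _ _ := StrictCell.ext (Bicategory.comp_whiskerRight _ _ _)
  whiskerRight_id _ := StrictCell.ext (Bicategory.whiskerRight_id _)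
  whiskerRight_comp _ _ _ := StrictCell.ext (Bicategory.whiskerRight_comp _ _ _)
  whisker_assoc _ _ _ _ _ := StrictCell.ext (Bicategory.whisker_assoc _ _ _)
  whisker_exchange _ _ := StrictCell.ext (Bicategory.whisker_exchange _ _)
  pentagon _ _ _ _ := StrictCell.ext (Bicategory.pentagon _ _ _ _)
  triangle _ _ := StrictCell.ext (Bicategory.triangle _ _)

theorem StrictAlg.eqToHom_cell {A B : StrictAlg O} {f g : A ⟶ B} (h : f = g) :
    StrictCell.cell (eqToHom h) = eqToHom (congrArg StrictMor.mor h) := by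
  subst h; rfl

theorem StrictAlg.eqToIso_eq {A B : StrictAlg O} {f g : A ⟶ B} (e : f ≅ g) (h : f = g)
    (he : StrictCell.cell e.hom = eqToHom (congrArg StrictMor.mor h)) : e = eqToIso h :=
  Iso.ext (StrictCell.ext (he.trans (StrictAlg.eqToHom_cell h).symm))

theorem StrictAlg.id_comp_eq {A B : StrictAlg O} (f : A ⟶ B) : 𝟙 A ≫ f = f :=
  StrictMor.ext' (PsAlg.id_comp_eq f.mor)

theorem StrictAlg.comp_id_eq {A B : StrictAlg O} (f : A ⟶ B) : f ≫ 𝟙 B = f :=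
  StrictMor.ext' (PsAlg.comp_id_eq f.mor)

theorem StrictAlg.assoc_eq {A B C D : StrictAlg O} (f : A ⟶ B) (g : B ⟶ C) (h : C ⟶ D) :
    (f ≫ g) ≫ h = f ≫ g ≫ h :=
  StrictMor.ext' (PsAlg.assoc_eq f.mor g.mor h.mor)

instance StrictAlg.strict : Bicategory.Strict (StrictAlg O) where
  id_comp := StrictAlg.id_comp_eq
  comp_id := StrictAlg.comp_id_eq
  assoc := StrictAlg.assoc_eq
  leftUnitor_eqToIso _ := StrictAlg.eqToIso_eq _ _ rfl
  rightUnitor_eqToIso _ := StrictAlg.eqToIso_eq _ _ rfl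
  associator_eqToIso _ _ _ := StrictAlg.eqToIso_eq _ _ rfl

variable (O) in
/-- The inclusion 2-functor from strict algebras and strict maps to pseudoalgebras and
pseudomorphisms. -/
def inclusion : StrictPseudofunctor (StrictAlg O) (PsAlg O) :=
  StrictPseudofunctor.mk''
    { obj := fun A => A.alg
      map := fun f => StrictMor.mor f
      map₂ := fun s => StrictCell.cell s
      map₂_id := fun _ => rfl
      map₂_comp := fun _ _ => rfl
      map_id := fun _ => rfl
      map_comp := fun _ _ => rfl
      map₂_whisker_left := fun _ _ _ _ => by simp; rfl
      map₂_whisker_right := fun _ _ => by simp; rfl }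

end Pseudoalgebras

/-! ### 2-adjunctions -/

section TwoAdjunction

universe w₁ w₂ v₁ v₂ u₁ u₂

variable {B : Type u₁} [Bicategory.{w₁, v₁} B] {C : Type u₂} [Bicategory.{w₂, v₂} C]

/-- A 2-natural transformation between 2-functors. -/
structure TwoNatTrans (F K : StrictPseudofunctor B C) where
  app : ∀ a, F.obj a ⟶ K.obj a
  naturality : ∀ {a b : B} (f : a ⟶ b), F.map f ≫ app b = app a ≫ K.map f
  naturality₂ : ∀ {a b : B} {f g : a ⟶ b} (s : f ⟶ g),
    F.map₂ s ▷ app b ≫ eqToHom (naturality g) = eqToHom (naturality f) ≫ app a ◁ K.map₂ s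

/-- A 2-adjunction between 2-categories: the 2-functor `L` is left 2-adjoint to `R`, with 2-natural
unit and counit that satisfy the triangle identities. -/
structure TwoAdjunction (L : StrictPseudofunctor B C) (R : StrictPseudofunctor C B) where
  unit : TwoNatTrans (StrictPseudofunctor.id B) (L.comp R)
  counit : TwoNatTrans (R.comp L) (StrictPseudofunctor.id C)
  left_triangle : ∀ b : B, L.map (unit.app b) ≫ counit.app (L.obj b) = 𝟙 (L.obj b)
  right_triangle : ∀ c : C, unit.app (R.obj c) ≫ R.map (counit.app c) = 𝟙 (R.obj c)

end TwoAdjunction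

/-! ### Symmetric monoidal and permutative `G`-categories -/

/-- A genuine symmetric monoidal `G`-category is a pseudoalgebra over `𝓟_G`. These form a
2-category with the strong symmetric monoidal functors, which are the pseudomorphisms, and their
transformations. -/
abbrev SymMonGCat (G : Type u) [Group G] : Type (u + 1) := PsAlg (permOperadG G)

/-- A genuine permutative `G`-category is a strict algebra over `𝓟_G`. These form a 2-category with
the strict maps and their transformations. -/
abbrev PermGCat (G : Type u) [Group G] : Type (u + 1) := StrictAlg (permOperadG G)

end GSym

/-! The argument applies to an arbitrary `Operad` and is specialised to `permOperadG G` only at the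
very end. For a pseudoalgebra X a word is an operation o of arity n with n objects of X, that is, an
unevaluated product. Two words are identified if they differ by a permutation or by deleting a
letter that is the unit object θ₀. The classes form `FreeOb`, the objects of the free strict algebra
on the based G-set of objects of X, and `ev` sends the class of (o; a) to θ(o; a). A morphism of the
strictification between two words is a morphism of X between their values, so evaluation is fully
faithful by construction, and it is onto on objects since θ₁(1; a) = a.

The operad acts on words by substitution, strictly, because every reindexing in the operad laws is a
permutation of letters and is lost in the class. The transformation φ becomes an isomorphism `evIso`
from θ(o; ev x) to ev(o x), and the action on morphisms is θ conjugated by `evIso`; its strict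
associativity is axiom (vi) together with naturality of φ. That φ is well defined on classes is
where the normalisations (ii) and (v) and the equivariance (iv) enter (`Word.Rel.phi_eq`).
Evaluation is then a pseudomorphism with ζ = `evIso`. The unit sends an object to its one-letter
word; followed by evaluation it is the identity, and in the other order the composite is isomorphic
to the identity through morphisms that lie over identities. Hence the unit is an equivalence.

Let f be a pseudomorphism from X to a strict algebra T. A strict map extending f must send the word
(o; a) to ξ(o; f(a)), which is the source of ζ(o, a), and must act on morphisms by conjugating f
with ζ. The conditions on ζ₀ and ζ₁ make ζ well defined on classes, and its compatibility with φ,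
where ψ is now an identity, makes the extension strict (`lift`). It is unique (`hom_ext`), as every
word is an operation applied to letters and every morphism is conjugate, by structure isomorphisms
of the unit, to one between letters. Since the unit is an equivalence, 2-cells also extend uniquely
(`liftCell`, `cell_ext`). So restriction along the unit is an isomorphism of hom-categories, and the
2-functor, the counit and the triangle identities follow from uniqueness.

One point of bookkeeping: axiom (ii) permits a single nullary inner operation. Therefore `Word.Rel`
inserts at most one at a time, and its flag `P` records in which of several words this is allowed to
happen; functions of several words are shown to descend one variable at a time. -/

namespace GSym

open CategoryTheory Bicategory

variable {G : Type u} [Group G]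

/-! ### Total composition and inverses in a `G`-category -/

namespace GCat

variable (A : GCat.{u, v} G)

open Classical in
/-- Composition, extended by the value `f` to pairs `f`, `g` that are not composable. It has no
proof argument, so that one can rewrite in it. -/
noncomputable def mul (f g : A.Mor) : A.Mor :=
  if h : A.tgt f = A.src g then A.comp f g h else f

theorem comp_eq_mul (f g : A.Mor) (h : A.tgt f = A.src g) : A.comp f g h = A.mul f g := by
  simp [mul, h]

@[simp]
theorem src_mul (f g : A.Mor) : A.src (A.mul f g) = A.src f := by
  unfold mul; split <;> simp

theorem tgt_mul {f g : A.Mor} (h : A.tgt f = A.src g) : A.tgt (A.mul f g) = A.tgt g := by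
  rw [← A.comp_eq_mul f g h, A.tgt_comp]

theorem mul_assoc {f g k : A.Mor} (h₁ : A.tgt f = A.src g) (h₂ : A.tgt g = A.src k) :
    A.mul (A.mul f g) k = A.mul f (A.mul g k) := by
  rw [← A.comp_eq_mul f g h₁, ← A.comp_eq_mul g k h₂, ← A.comp_eq_mul _ _ (by simp [h₂]),
    ← A.comp_eq_mul _ _ (by simp [h₁]), A.assoc']

theorem idt_mul {x : A.Ob} {f : A.Mor} (h : A.src f = x) : A.mul (A.idt x) f = f := by
  rw [← A.comp_eq_mul _ _ (by simp [h]), A.idt_comp']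

theorem mul_idt {x : A.Ob} {f : A.Mor} (h : A.tgt f = x) : A.mul f (A.idt x) = f := by
  rw [← A.comp_eq_mul _ _ (by simp [h]), A.comp_idt']

theorem smul_mul (c : G) {f g : A.Mor} (h : A.tgt f = A.src g) :
    c • A.mul f g = A.mul (c • f) (c • g) := by
  rw [← A.comp_eq_mul _ _ h, ← A.comp_eq_mul _ _ (by simp [h]), A.comp_smul]

/-- A morphism is invertible if it has a two-sided inverse. -/
def IsIso (f : A.Mor) : Prop :=
  ∃ g, A.src g = A.tgt f ∧ A.tgt g = A.src f ∧ A.mul f g = A.idt (A.src f) ∧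
    A.mul g f = A.idt (A.tgt f)

open Classical in
/-- The inverse of an invertible morphism, and `f` itself if `f` is not invertible. -/
noncomputable def inv (f : A.Mor) : A.Mor :=
  if h : A.IsIso f then h.choose else f

variable {A}

theorem IsIso.inv_spec {f : A.Mor} (h : A.IsIso f) :
    A.src (A.inv f) = A.tgt f ∧ A.tgt (A.inv f) = A.src f ∧
      A.mul f (A.inv f) = A.idt (A.src f) ∧ A.mul (A.inv f) f = A.idt (A.tgt f) := by
  have : A.inv f = h.choose := by simp [inv, h]
  rw [this]
  exact h.choose_spec

theorem IsIso.src_inv {f : A.Mor} (h : A.IsIso f) : A.src (A.inv f) = A.tgt f := h.inv_spec.1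

theorem IsIso.tgt_inv {f : A.Mor} (h : A.IsIso f) : A.tgt (A.inv f) = A.src f := h.inv_spec.2.1

theorem IsIso.mul_inv {f : A.Mor} (h : A.IsIso f) : A.mul f (A.inv f) = A.idt (A.src f) :=
  h.inv_spec.2.2.1

theorem IsIso.inv_mul {f : A.Mor} (h : A.IsIso f) : A.mul (A.inv f) f = A.idt (A.tgt f) :=
  h.inv_spec.2.2.2

theorem IsIso.cancel_left {f g g' : A.Mor} (hf : A.IsIso f) (h : A.tgt f = A.src g)
    (h' : A.tgt f = A.src g') (e : A.mul f g = A.mul f g') : g = g' := by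
  have := congrArg (A.mul (A.inv f)) e
  rwa [← mul_assoc A hf.tgt_inv h, ← mul_assoc A hf.tgt_inv h', hf.inv_mul, idt_mul A h.symm,
    idt_mul A h'.symm] at this

theorem IsIso.cancel_right {f g g' : A.Mor} (hf : A.IsIso f) (h : A.tgt g = A.src f)
    (h' : A.tgt g' = A.src f) (e : A.mul g f = A.mul g' f) : g = g' := by
  have := congrArg (fun k => A.mul k (A.inv f)) e
  rwa [mul_assoc A h hf.src_inv.symm, mul_assoc A h' hf.src_inv.symm, hf.mul_inv,
    mul_idt A h, mul_idt A h'] at this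

theorem IsIso.inv_mul_eq_iff {f g k : A.Mor} (hf : A.IsIso f) (h : A.src f = A.src g)
    (h' : A.tgt f = A.src k) : A.mul (A.inv f) g = k ↔ g = A.mul f k := by
  constructor
  · rintro rfl
    rw [← mul_assoc A hf.src_inv.symm (hf.tgt_inv.trans h), hf.mul_inv, idt_mul A h.symm]
  · rintro rfl
    rw [← mul_assoc A hf.tgt_inv h', hf.inv_mul, idt_mul A h'.symm]

theorem IsIso.mul_inv_eq_iff {f g k : A.Mor} (hf : A.IsIso f) (h : A.tgt g = A.tgt f)
    (h' : A.tgt k = A.src f) : A.mul g (A.inv f) = k ↔ g = A.mul k f := by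
  constructor
  · rintro rfl
    rw [mul_assoc A (h.trans hf.src_inv.symm) hf.tgt_inv, hf.inv_mul, mul_idt A h]
  · rintro rfl
    rw [mul_assoc A h' hf.src_inv.symm, hf.mul_inv, mul_idt A h']

theorem isIso_idt (x : A.Ob) : A.IsIso (A.idt x) :=
  ⟨A.idt x, by simp, by simp, by rw [idt_mul A (by simp)]; simp, by rw [idt_mul A (by simp)]; simp⟩

theorem IsIso.smul (c : G) {f : A.Mor} (h : A.IsIso f) : A.IsIso (c • f) :=
  ⟨c • A.inv f, by simp [h.src_inv], by simp [h.tgt_inv],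
    by rw [← smul_mul A c h.src_inv.symm, h.mul_inv, ← A.idt_smul, A.src_smul],
    by rw [← smul_mul A c h.tgt_inv, h.inv_mul, ← A.idt_smul, A.tgt_smul]⟩

/-- Inverses are unique, so the choice made in `inv` is automatically equivariant. -/
theorem IsIso.smul_inv (c : G) {f : A.Mor} (h : A.IsIso f) : c • A.inv f = A.inv (c • f) := by
  refine (h.smul c).cancel_left (by simp [h.src_inv]) (h.smul c).src_inv.symm ?_
  rw [← smul_mul A c h.src_inv.symm, h.mul_inv, (h.smul c).mul_inv, A.src_smul, A.idt_smul]

end GCat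

/-! ### Functors, transformations and invertible morphisms -/

section

variable {A : GCat.{u, v} G} {B : GCat.{u, w} G}

theorem UFunctor.mor_mul (F : UFunctor A B) {f g : A.Mor} (h : A.tgt f = A.src g) :
    F.mor (A.mul f g) = B.mul (F.mor f) (F.mor g) := by
  rw [← A.comp_eq_mul f g h, F.mor_comp, B.comp_eq_mul]

theorem GCat.IsIso.map {f : A.Mor} (h : A.IsIso f) (F : UFunctor A B) : B.IsIso (F.mor f) :=
  ⟨F.mor (A.inv f), by simp [h.src_inv], by simp [h.tgt_inv],
    by rw [← F.mor_mul h.src_inv.symm, h.mul_inv, F.mor_idt, F.src_mor],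
    by rw [← F.mor_mul h.tgt_inv, h.inv_mul, F.mor_idt, F.tgt_mor]⟩

theorem GTrans.naturality_mul {F F' : GFunctor A B} (s : GTrans F F') {f : A.Mor} {a b : A.Ob}
    (ha : A.src f = a) (hb : A.tgt f = b) :
    B.mul (F.mor f) (s.app b) = B.mul (s.app a) (F'.mor f) := by
  rw [← B.comp_eq_mul _ _ (by simp [hb]), ← B.comp_eq_mul _ _ (by simp [ha])]
  exact s.naturality' f a b ha hb

theorem GTrans.IsInvertible.isIso_app {F F' : GFunctor A B} {s : GTrans F F'}
    (h : s.IsInvertible) (x : A.Ob) : B.IsIso (s.app x) := by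
  obtain ⟨t, h₁, h₂⟩ := h
  have e₁ := congrArg (fun r : GTrans F F => r.app x) h₁
  have e₂ := congrArg (fun r : GTrans F' F' => r.app x) h₂
  simp only [GTrans.vcomp_app, GTrans.id_app, B.comp_eq_mul] at e₁ e₂
  exact ⟨t.app x, by simp, by simp, by simpa using e₁, by simpa using e₂⟩

/-- A `G`-transformation all of whose components are invertible is invertible. -/
theorem GTrans.isInvertible_of_isIso {F F' : GFunctor A B} (s : GTrans F F')
    (h : ∀ x, B.IsIso (s.app x)) : s.IsInvertible := by
  refine ⟨{ app := fun x => B.inv (s.app x)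
            src_app := fun x => by rw [(h x).src_inv, s.tgt_app]
            tgt_app := fun x => by rw [(h x).tgt_inv, s.src_app]
            naturality := fun f => ?_
            app_smul := fun c x => by rw [s.app_smul, (h x).smul_inv] }, ?_, ?_⟩
  · rw [B.comp_eq_mul, B.comp_eq_mul]
    have hs := (h (A.src f)).src_inv
    have ht := (h (A.tgt f)).src_inv
    rw [(h (A.tgt f)).mul_inv_eq_iff (by simp)
      (by rw [B.tgt_mul (by rw [(h _).tgt_inv]; simp)]; simp),
      B.mul_assoc (by rw [(h _).tgt_inv]; simp) (by simp), s.naturality_mul rfl rfl,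
      ← B.mul_assoc (by rw [(h _).tgt_inv]) (by simp), (h _).inv_mul, B.idt_mul (by simp)]
  · refine GTrans.ext' fun x => ?_
    simp only [GTrans.vcomp_app, GTrans.id_app, B.comp_eq_mul]
    rw [(h x).mul_inv, s.src_app]
  · refine GTrans.ext' fun x => ?_
    simp only [GTrans.vcomp_app, GTrans.id_app, B.comp_eq_mul]
    rw [(h x).inv_mul, s.tgt_app]

end

/-! ### Blocks -/

theorem blk_unitBlocks (n : ℕ) (c : Fin (∑ _i : Fin n, 1)) :
    (blk (fun _ : Fin n => 1) c).1 = unitBlocksEquiv n c := by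
  have := finSigmaFinEquiv_apply (blk (fun _ : Fin n => 1) c)
  simp only [blk, Equiv.apply_symm_apply, Finset.sum_const, smul_eq_mul, mul_one,
    Fin.val_eq_zero, add_zero] at this
  ext
  exact ((Finset.card_fin _).symm.trans this.symm)

theorem blk_oneBlock (n : ℕ) (c : Fin (∑ _i : Fin 1, n)) :
    (blk (fun _ : Fin 1 => n) c).2 = oneBlockEquiv n c := by
  have := finSigmaFinEquiv_one (blk (fun _ : Fin 1 => n) c)
  ext
  rw [← this]; simp [blk, oneBlockEquiv]

theorem blk_finSigma {k : ℕ} {m : Fin k → ℕ} (z : (i : Fin k) × Fin (m i)) :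
    blk m (finSigmaFinEquiv z) = z := by
  simp [blk]

/-- The equation for `blk m j` is substituted as a whole, since the type of its second component
depends on the first and the components cannot be rewritten separately. -/
theorem flat_eq_of_blk {k : ℕ} {m : Fin k → ℕ} {X : Type v} (a : ∀ i, Fin (m i) → X)
    {j : Fin (∑ i, m i)} {z : (i : Fin k) × Fin (m i)} (h : blk m j = z) :
    flat a j = a z.1 z.2 := by
  subst h; rfl

theorem flat_blockEquiv {k k' : ℕ} {m : Fin k → ℕ} {m' : Fin k' → ℕ} {X : Type v}
    (e : Fin k ≃ Fin k') (d : ∀ i, Fin (m i) ≃ Fin (m' (e i))) (a : ∀ i, Fin (m' i) → X)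
    (j : Fin (∑ i, m i)) :
    flat a (blockEquiv e d j) = flat (fun i s => a (e i) (d i s)) j :=
  flat_eq_of_blk a (blk_blockEquiv e d j)

/-- By `blk_assocEquiv` the outer block is known, and the place in it is again given by
`finSigmaFinEquiv`, so a second reading of blocks finishes. This lets the letters follow the
associativity of γ. -/
theorem flat_assocEquiv {k : ℕ} (m : Fin k → ℕ) (p : ∀ i, Fin (m i) → ℕ) {X : Type v}
    (a : ∀ i s, Fin (p i s) → X) (j : Fin (∑ j : Fin (∑ i, m i), flat p j)) :
    flat (fun i => flat (a i)) (assocEquiv m p j) =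
      flat (m := flat p) (fun j => a (blk m j).1 (blk m j).2) j := by
  refine (flat_eq_of_blk (fun i => flat (a i)) (blk_assocEquiv m p j)).trans ?_
  exact flat_eq_of_blk (a _) (blk_finSigma _)

/-! ### Functions of finitely many variables in a quotient -/

/-- A function of finitely many variables that does not change if a single variable is replaced by
a related one depends only on the classes of the variables. -/
theorem eq_of_quot_eq {ι : Type v} [Finite ι] {α : Type w} {R : α → α → Prop} {β : Type v'}
    (F : (ι → α) → β)
    (hF : ∀ (i₀ : ι) (r s : ι → α), (∀ i, i ≠ i₀ → r i = s i) → R (r i₀) (s i₀) → F r = F s)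
    {r s : ι → α} (h : ∀ i, Quot.mk R (r i) = Quot.mk R (s i)) : F r = F s := by
  classical
  have := Fintype.ofFinite ι
  -- Equality in the quotient only provides a zigzag of related elements, so the hypothesis is first
  -- extended, in one variable, to the generated equivalence relation.
  have hu : ∀ (p : ι → α) (i : ι) (a b : α), Relation.EqvGen R a b →
      F (Function.update p i a) = F (Function.update p i b) := by
    intro p i a b hab
    induction hab with
    | rel a b hab => exact hF i _ _ (fun j hj => by simp [hj]) (by simpa using hab)
    | refl a => rfl
    | symm a b _ ih => exact ih.symm
    | trans a b c _ _ ih₁ ih₂ => exact ih₁.trans ih₂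
  -- The variables are exchanged one by one; `S` is the set of those already exchanged.
  have key : ∀ S : Finset ι, F (S.piecewise s r) = F r := by
    intro S
    induction S using Finset.induction_on with
    | empty => simp
    | insert j S hj ih =>
      rw [Finset.piecewise_insert, ← ih]
      have := hu (S.piecewise s r) j _ _ (Quot.eqvGen_exact (h j))
      rw [← this]
      congr 1
      have e : r j = S.piecewise s r j := by simp [hj]
      rw [e, Function.update_eq_self]
  have := key Finset.univ
  simpa using this.symm

/-! ### Words in a pseudoalgebra -/

section Words

variable {O : Operad.{u, u} G}

theorem Operad.act_refl_obj {n : ℕ} (o : (O.obj n).Ob) :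
    (O.act (Equiv.refl (Fin n))).obj o = o := by
  rw [O.act_refl]; rfl

theorem Operad.act_trans_obj {n m k : ℕ} (e : Fin n ≃ Fin m) (e' : Fin m ≃ Fin k)
    (o : (O.obj k).Ob) : (O.act (e.trans e')).obj o = (O.act e).obj ((O.act e').obj o) := by
  rw [O.act_trans]; rfl

theorem Operad.act_symm_act_obj {n m : ℕ} (e : Fin n ≃ Fin m) (o : (O.obj m).Ob) :
    (O.act e.symm).obj ((O.act e).obj o) = o := by
  rw [← O.act_trans_obj, Equiv.symm_trans_self, O.act_refl_obj]

theorem Operad.isOne_one : O.IsOne O.one := ⟨Equiv.refl _, (O.act_refl_obj _).symm⟩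

theorem Operad.IsOne.smul (c : G) {n : ℕ} {x : (O.obj n).Ob} (h : O.IsOne x) :
    O.IsOne (c • x) := by
  obtain ⟨e, rfl⟩ := h
  exact ⟨e, by rw [← (O.act e).obj_smul, O.one_fixed]⟩

theorem Operad.isOne_smul_iff (c : G) {n : ℕ} {x : (O.obj n).Ob} :
    O.IsOne (c • x) ↔ O.IsOne x :=
  ⟨fun h => by simpa using h.smul c⁻¹, fun h => h.smul c⟩

/-- Equivariance of the composition under permutations inside the blocks. -/
theorem Operad.gam_act_obj {k : ℕ} {m m' : Fin k → ℕ} (d : ∀ i, Fin (m i) ≃ Fin (m' i))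
    (o : (O.obj k).Ob) (x : ∀ i, (O.obj (m' i)).Ob) :
    (O.gam m).obj (o, fun i => (O.act (d i)).obj (x i)) =
      (O.act (blockEquiv (Equiv.refl _) d)).obj ((O.gam m').obj (o, x)) := by
  have := O.gam_equivariant_obj (m := m) (m' := m') (Equiv.refl _) d o x
  rwa [O.act_refl_obj] at this

namespace PsAlg

variable (X : PsAlg O)

theorem theta_act_obj {n n' : ℕ} (e : Fin n ≃ Fin n') (o : (O.obj n').Ob)
    (a : Fin n' → X.cat.Ob) :
    (X.theta n).obj ((O.act e).obj o, fun i => a (e i)) = (X.theta n').obj (o, a) := by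
  rw [X.theta_equivariant_obj]; simp

theorem theta_act_mor {n n' : ℕ} (e : Fin n ≃ Fin n') (o : (O.obj n').Mor)
    (a : Fin n' → X.cat.Mor) :
    (X.theta n).mor ((O.act e).mor o, fun i => a (e i)) = (X.theta n').mor (o, a) := by
  rw [X.theta_equivariant_mor]; simp

/-- Equivariance of `φ` under permutations inside the blocks. -/
theorem phi_act {k : ℕ} {m m' : Fin k → ℕ} (d : ∀ i, Fin (m i) ≃ Fin (m' i)) (o : (O.obj k).Ob)
    (x : ∀ i, (O.obj (m' i)).Ob) (a : ∀ i, Fin (m' i) → X.cat.Ob) :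
    (X.phi m).app (o, fun i => ((O.act (d i)).obj (x i), fun s => a i (d i s))) =
      (X.phi m').app (o, fun i => (x i, a i)) := by
  have := X.phi_equivariant (m := m) (m' := m') (Equiv.refl _) d o x a
  rwa [O.act_refl_obj] at this

/-- `φ` is the identity if all inner operations are the unit. -/
theorem phi_isOne {n : ℕ} (m : Fin n → ℕ) (o : (O.obj n).Ob) (x : ∀ i, (O.obj (m i)).Ob)
    (a : ∀ i, Fin (m i) → X.cat.Ob) (h : ∀ i, O.IsOne (x i)) :
    (X.phi m).app (o, fun i => (x i, a i)) =
      X.cat.idt ((X.theta n).obj (o, fun i => (X.theta (m i)).obj (x i, a i))) := by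
  choose e he using h
  obtain rfl : x = fun i => (O.act (e i)).obj O.one := funext he
  -- Each `m i` is in bijection with a single place, so each inner tuple is one object, and
  -- equivariance reduces the claim to the second half of axiom (v).
  obtain ⟨b, rfl⟩ : ∃ b : Fin n → X.cat.Ob, a = fun i _ => b i :=
    ⟨fun i => a i ((e i).symm 0), funext fun i => funext fun s => congrArg (a i)
      ((e i).eq_symm_apply.mpr (Subsingleton.elim _ _))⟩
  refine (X.phi_act (m' := fun _ => 1) e o (fun _ => O.one) (fun i _ => b i)).trans ?_
  rw [X.phi_one_right]
  refine congrArg (fun z => X.cat.idt ((X.theta n).obj (o, z))) (funext fun i => ?_)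
  exact ((X.theta_act_obj (e i) O.one fun _ => b i).trans (X.theta_one_obj _)).symm

/-- `φ` is the identity for the empty product. -/
theorem phi_zero (m : Fin 0 → ℕ) (x : (nestDom O X.cat m).Ob) :
    (X.phi m).app x = X.cat.idt ((iterAct X.theta m).obj x) :=
  X.phi_isOne m x.1 (fun i => (x.2 i).1) (fun i => (x.2 i).2) fun i => i.elim0

end PsAlg

/-- All operations are the unit, with the exception of at most one, which is nullary. -/
def Operad.IsNearUnit (O : Operad.{u, u} G) {n : ℕ} {m : Fin n → ℕ}
    (x : ∀ i, (O.obj (m i)).Ob) : Prop :=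
  (∀ i, O.IsOne (x i) ∨ m i = 0) ∧ ∀ i j, ¬ O.IsOne (x i) → ¬ O.IsOne (x j) → i = j

namespace PsAlg

variable (X : PsAlg O)

/-- Either there is no exception and axiom (v) applies, or there is exactly one and it is nullary,
which is axiom (ii). Both normalisations are used below in this common form. -/
theorem phi_isNearUnit {n : ℕ} (m : Fin n → ℕ) (o : (O.obj n).Ob) (x : ∀ i, (O.obj (m i)).Ob)
    (a : ∀ i, Fin (m i) → X.cat.Ob) (h : O.IsNearUnit x) :
    (X.phi m).app (o, fun i => (x i, a i)) =
      X.cat.idt ((X.theta n).obj (o, fun i => (X.theta (m i)).obj (x i, a i))) := by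
  by_cases h' : ∀ i, O.IsOne (x i)
  · exact X.phi_isOne m o x a h'
  · obtain ⟨r, hr⟩ := not_forall.mp h'
    exact X.phi_unit_object m r o x a ((h.1 r).resolve_left hr) fun i hi =>
      not_not.mp fun hx => hi (h.2 i r hx hr)

/-- An identity has equal source and target, so wherever φ is an identity the action is strictly
associative on objects. -/
theorem theta_gam_of_phi {n : ℕ} (m : Fin n → ℕ) (o : (O.obj n).Ob) (x : ∀ i, (O.obj (m i)).Ob)
    (a : ∀ i, Fin (m i) → X.cat.Ob) {y : X.cat.Ob}
    (h : (X.phi m).app (o, fun i => (x i, a i)) = X.cat.idt y) :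
    (X.theta _).obj ((O.gam m).obj (o, x), flat a) =
      (X.theta n).obj (o, fun i => (X.theta (m i)).obj (x i, a i)) := by
  have h₁ := (X.phi m).tgt_app (o, fun i => (x i, a i))
  have h₂ := (X.phi m).src_app (o, fun i => (x i, a i))
  rw [h, GCat.tgt_idt] at h₁
  rw [h, GCat.src_idt] at h₂
  exact h₁.symm.trans h₂

/-- A word: an operation together with a tuple of objects to which it can be applied. -/
abbrev Word : Type u := (n : ℕ) × ((O.obj n).Ob × (Fin n → X.cat.Ob))

namespace Word

variable {X}

/-- The result of a permutation and an insertion of unit objects. If `P` fails, then only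
permutations are allowed. -/
def Rel (P : Prop) (r s : X.Word) : Prop :=
  ∃ (m : Fin s.1 → ℕ) (e : Fin r.1 ≃ Fin (∑ i, m i)) (x : ∀ i, (O.obj (m i)).Ob)
    (a : ∀ i, Fin (m i) → X.cat.Ob), O.IsNearUnit x ∧ (∀ i, ¬ O.IsOne (x i) → P) ∧
    r.2.1 = (O.act e).obj ((O.gam m).obj (s.2.1, x)) ∧ (∀ j, r.2.2 j = flat a (e j)) ∧
    ∀ i, s.2.2 i = (X.theta (m i)).obj (x i, a i)

/-- Substitution of words into an operation. -/
def subst {n : ℕ} (o : (O.obj n).Ob) (r : Fin n → X.Word) : X.Word :=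
  ⟨∑ i, (r i).1, (O.gam fun i => (r i).1).obj (o, fun i => (r i).2.1), flat fun i => (r i).2.2⟩

/-- A group element acts on the operation and on the objects of a word. -/
def smul (c : G) (r : X.Word) : X.Word := ⟨r.1, c • r.2.1, c • r.2.2⟩

/-- Inserting the unit operation at every letter only turns the arity into a sum of ones, and
`unitBlocksEquiv` undoes this. No exceptional letter occurs, so `P` is arbitrary. -/
theorem Rel.perm (P : Prop) {n n' : ℕ} (e : Fin n ≃ Fin n') (o : (O.obj n').Ob)
    (a : Fin n' → X.cat.Ob) :
    Rel P (X := X) ⟨n, (O.act e).obj o, fun i => a (e i)⟩ ⟨n', o, a⟩ := by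
  refine ⟨fun _ => 1, e.trans (unitBlocksEquiv n').symm, fun _ => O.one, fun i _ => a i,
    ⟨fun _ => Or.inl O.isOne_one, fun i _ h => absurd O.isOne_one h⟩,
    fun i h => absurd O.isOne_one h, ?_, fun j => ?_, fun i => (X.theta_one_obj fun _ => a i).symm⟩
  · dsimp only
    rw [O.gam_one_right_obj, O.act_trans_obj, O.act_symm_act_obj]
  · dsimp only [flat]
    rw [blk_unitBlocks]
    simp

theorem Rel.refl (P : Prop) (r : X.Word) : Rel P r r := by
  have := Rel.perm (X := X) P (Equiv.refl (Fin r.1)) r.2.1 r.2.2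
  rwa [O.act_refl_obj] at this

theorem Rel.unit {n : ℕ} (m : Fin n → ℕ) (o : (O.obj n).Ob) (x : ∀ i, (O.obj (m i)).Ob)
    (a : ∀ i, Fin (m i) → X.cat.Ob) (h : O.IsNearUnit x) :
    Rel True (X := X) ⟨∑ i, m i, (O.gam m).obj (o, x), flat a⟩
      ⟨n, o, fun i => (X.theta (m i)).obj (x i, a i)⟩ :=
  ⟨m, Equiv.refl _, x, a, h, fun _ _ => trivial, (O.act_refl_obj _).symm, fun _ => rfl,
    fun _ => rfl⟩

/-- The unit operation is fixed by `G`, so the exceptional places do not move, and the action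
functors are equivariant. -/
theorem Rel.smul (c : G) {P : Prop} {r s : X.Word} (h : Rel P r s) :
    Rel P (r.smul c) (s.smul c) := by
  obtain ⟨m, e, x, a, h₁, h₂, h₃, h₄, h₅⟩ := h
  refine ⟨m, e, fun i => c • x i, fun i => c • a i, ⟨fun i => (h₁.1 i).imp_left (·.smul c),
    fun i j hi hj => h₁.2 i j (fun h => hi (h.smul c)) fun h => hj (h.smul c)⟩,
    fun i => by simpa only [O.isOne_smul_iff] using h₂ i, ?_, fun j => ?_, fun i => ?_⟩
  · change c • r.2.1 = _
    rw [h₃, ← (O.act e).obj_smul, ← (O.gam m).obj_smul]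
    rfl
  · exact congrArg (c • ·) (h₄ j)
  · refine (congrArg (c • ·) (h₅ i)).trans ?_
    exact ((X.theta (m i)).obj_smul c (x i, a i)).symm

/-- Related words have the same value. -/
theorem Rel.theta_eq {P : Prop} {r s : X.Word} (h : Rel P r s) :
    (X.theta r.1).obj r.2 = (X.theta s.1).obj s.2 := by
  obtain ⟨m, e, x, a, h₁, -, h₃, h₄, h₅⟩ := h
  have hr : r.2 = ((O.act e).obj ((O.gam m).obj (s.2.1, x)), fun j => flat a (e j)) :=
    Prod.ext h₃ (funext h₄)
  have hs : s.2 = (s.2.1, fun i => (X.theta (m i)).obj (x i, a i)) := Prod.ext rfl (funext h₅)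
  -- Permutations do not change the value by axiom (i), and the inserted operations do not because φ
  -- is an identity there.
  rw [hr, X.theta_act_obj e _ (flat a), hs]
  exact X.theta_gam_of_phi m _ x a (X.phi_isNearUnit m _ x a h₁)

/-- As `P` holds for at most one block, all exceptions lie in that block, which has at most one.
Without the flag two blocks could each contribute a nullary operation, a case that axiom (ii) does
not cover. -/
theorem isNearUnit_flat {k : ℕ} {m : Fin k → ℕ} {p : ∀ i, Fin (m i) → ℕ} {P : Fin k → Prop}
    (hP : ∀ i j, P i → P j → i = j) (x : ∀ i s, (O.obj (p i s)).Ob)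
    (h₁ : ∀ i, O.IsNearUnit (x i)) (h₂ : ∀ i s, ¬ O.IsOne (x i s) → P i) :
    O.IsNearUnit (m := flat p) fun j => x (blk m j).1 (blk m j).2 := by
  refine ⟨fun j => (h₁ _).1 _, fun j j' hj hj' => ?_⟩
  have key : ∀ z z' : (i : Fin k) × Fin (m i), ¬ O.IsOne (x z.1 z.2) → ¬ O.IsOne (x z'.1 z'.2) →
      z = z' := by
    rintro ⟨i, s⟩ ⟨i', s'⟩ h h'
    obtain rfl := hP i i' (h₂ i s h) (h₂ i' s' h')
    obtain rfl := (h₁ i).2 s s' h h'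
    rfl
  exact finSigmaFinEquiv.symm.injective (key _ _ hj hj')

/-- Substitution of related words gives related words. -/
theorem Rel.subst {n : ℕ} {P : Fin n → Prop} (hP : ∀ i j, P i → P j → i = j)
    (o : (O.obj n).Ob) {r s : Fin n → X.Word} (h : ∀ i, Rel (P i) (r i) (s i)) :
    Rel True (Word.subst o r) (Word.subst o s) := by
  choose m e x a h₁ h₂ h₃ h₄ h₅ using h
  -- The permutations of the single words act inside their blocks; `assocEquiv` then turns blocks of
  -- blocks into one concatenation.
  let E : Fin (∑ i, (r i).1) ≃ Fin (∑ i, ∑ j, m i j) := blockEquiv (Equiv.refl _) e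
  refine ⟨flat m, E.trans (assocEquiv _ m).symm,
    fun j => x (blk _ j).1 (blk _ j).2, fun j => a (blk _ j).1 (blk _ j).2,
    isNearUnit_flat hP x h₁ h₂, fun _ _ => trivial, ?_, fun j => ?_, fun j => h₅ _ _⟩
  -- Associativity of γ produces `assocEquiv`, which cancels against its inverse in the chosen
  -- bijection and leaves `E`.
  · refine Eq.trans ?_ ((congrArg (O.act (E.trans (assocEquiv _ m).symm)).obj
      (O.gam_assoc_obj _ m o (fun i => (s i).2.1) x)).trans ((O.act_trans_obj _ _ _).trans
        (congrArg (O.act E).obj (O.act_symm_act_obj _ _)))).symm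
    refine Eq.trans ?_ (O.gam_act_obj e o fun i => (O.gam (m i)).obj ((s i).2.1, x i))
    exact congrArg (O.gam _).obj (Prod.ext rfl (funext h₃))
  · have e₁ := flat_assocEquiv (fun i => (s i).1) m a
      ((assocEquiv (fun i => (s i).1) m).symm (E j))
    rw [Equiv.apply_symm_apply] at e₁
    have e₂ : flat (fun i => flat (a i)) (E j) = flat (fun i s => flat (a i) (e i s)) j :=
      flat_blockEquiv (m := fun i => (r i).1) (m' := fun i => ∑ j, m i j) (Equiv.refl _) e
        (fun i => flat (a i)) j
    exact (h₄ _ _).trans (e₂.symm.trans e₁)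

/-- `φ` depends only on the classes of the inner words. -/
theorem Rel.phi_eq {n : ℕ} {P : Fin n → Prop} (hP : ∀ i j, P i → P j → i = j)
    (o : (O.obj n).Ob) {r s : Fin n → X.Word} (h : ∀ i, Rel (P i) (r i) (s i)) :
    (X.phi fun i => (r i).1).app (o, fun i => (r i).2) =
      (X.phi fun i => (s i).1).app (o, fun i => (s i).2) := by
  choose m e x a h₁ h₂ h₃ h₄ h₅ using h
  have hr : (fun i => (r i).2) = fun i => ((O.act (e i)).obj ((O.gam (m i)).obj ((s i).2.1, x i)),
      fun j => flat (a i) (e i j)) := funext fun i => Prod.ext (h₃ i) (funext (h₄ i))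
  have hs : (fun i => (s i).2) = fun i => ((s i).2.1,
      fun j => (X.theta (m i j)).obj (x i j, a i j)) :=
    funext fun i => Prod.ext rfl (funext (h₅ i))
  rw [hr, X.phi_act e o (fun i => (O.gam (m i)).obj ((s i).2.1, x i)) (fun i => flat (a i)), hs]
  -- Of the four factors in axiom (vi) two are identities: the one that inserts into the
  -- concatenated word and the one that inserts into the single words. The two others are the sides
  -- of the claim.
  have key := X.phi_assoc (fun i => (s i).1) m o (fun i => (s i).2.1) x a
  have e₁ := X.phi_isNearUnit (flat m) ((O.gam fun i => (s i).1).obj (o, fun i => (s i).2.1))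
    (fun j => x (blk _ j).1 (blk _ j).2) (fun j => a (blk _ j).1 (blk _ j).2)
    (isNearUnit_flat hP x h₁ h₂)
  have e₂ := fun i => X.phi_isNearUnit (m i) (s i).2.1 (x i) (a i) (h₁ i)
  simp only [X.cat.comp_eq_mul, e₁, e₂] at key
  rw [theta_mor_idt, GCat.mul_idt, GCat.idt_mul] at key
  · exact key.symm
  · rw [UTrans.src_app]
    refine congrArg (fun z => (X.theta n).obj (o, z)) (funext fun i => ?_)
    exact X.theta_gam_of_phi (m i) _ (x i) (a i) (e₂ i)
  · rw [UTrans.tgt_app]; rfl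

end Word

/-! ### The free algebra on the objects -/

/-- The objects of the free strict algebra on the based set of objects of `X`. -/
def FreeOb : Type u := Quot (Word.Rel (X := X) True)

namespace FreeOb

variable {X}

/-- The class of a word. -/
def mk (r : X.Word) : X.FreeOb := Quot.mk _ r

theorem exists_rep (x : X.FreeOb) : ∃ r, mk r = x := Quot.exists_rep x

theorem exists_reps {ι : Type v} (x : ι → X.FreeOb) : ∃ r : ι → X.Word, x = fun i => mk (r i) := by
  choose r hr using fun i => exists_rep (x i)
  exact ⟨r, funext fun i => (hr i).symm⟩

/-- A representative of a class. -/
noncomputable def rep (x : X.FreeOb) : X.Word := x.exists_rep.choose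

theorem mk_rep (x : X.FreeOb) : mk x.rep = x := x.exists_rep.choose_spec

theorem sound {r s : X.Word} (h : Word.Rel True r s) : mk r = mk s := Quot.sound h

instance : MulAction G X.FreeOb where
  smul c := Quot.map (Word.smul c) fun _ _ h => h.smul c
  one_smul x := by
    obtain ⟨⟨n, o, a⟩, rfl⟩ := exists_rep x
    change mk ⟨n, (1 : G) • o, (1 : G) • a⟩ = _
    rw [one_smul, one_smul]
  mul_smul c d x := by
    obtain ⟨⟨n, o, a⟩, rfl⟩ := exists_rep x
    change mk ⟨n, (c * d) • o, (c * d) • a⟩ = mk ⟨n, c • d • o, c • d • a⟩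
    rw [mul_smul, mul_smul]

theorem smul_mk (c : G) (r : X.Word) : c • mk r = mk (r.smul c) := rfl

theorem mk_perm {n n' : ℕ} (e : Fin n ≃ Fin n') (o : (O.obj n').Ob) (a : Fin n' → X.cat.Ob) :
    mk (X := X) ⟨n, (O.act e).obj o, fun i => a (e i)⟩ = mk ⟨n', o, a⟩ :=
  sound (Word.Rel.perm True e o a)

/-- A function of finitely many words that does not change if one of the words is replaced by a
related one depends only on the classes of the words. -/
theorem eq_of_mk_eq {n : ℕ} {β : Type v} (F : (Fin n → X.Word) → β)
    (hF : ∀ (P : Fin n → Prop) (r s : Fin n → X.Word), (∀ i j, P i → P j → i = j) →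
      (∀ i, Word.Rel (P i) (r i) (s i)) → F r = F s)
    {r s : Fin n → X.Word} (h : ∀ i, mk (r i) = mk (s i)) : F r = F s := by
  refine eq_of_quot_eq F (fun i₀ r s h h' => ?_) h
  -- Only the word at `i₀` changes. The others are related to themselves by the identity
  -- permutation, which is available when the flag is false.
  refine hF (· = i₀) r s (fun i j hi hj => hi.trans hj.symm) fun i => ?_
  by_cases hi : i = i₀
  · subst hi; simpa using h'
  · rw [h i hi]; exact Word.Rel.refl _ _

end FreeOb

/-- The evaluation of a class of words. -/
def ev : X.FreeOb → X.cat.Ob :=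
  Quot.lift (fun r => (X.theta r.1).obj r.2) fun _ _ h => h.theta_eq

theorem ev_mk (r : X.Word) : X.ev (FreeOb.mk r) = (X.theta r.1).obj r.2 := rfl

theorem ev_smul (c : G) (x : X.FreeOb) : X.ev (c • x) = c • X.ev x := by
  obtain ⟨r, rfl⟩ := x.exists_rep
  exact (X.theta r.1).obj_smul c r.2

/-- The action of the operad on classes of words. -/
noncomputable def freeAct {n : ℕ} (o : (O.obj n).Ob) (x : Fin n → X.FreeOb) : X.FreeOb :=
  FreeOb.mk (Word.subst o fun i => (x i).rep)

/-- The chosen representatives in `freeAct` are immaterial, because substitution respects the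
relation in each variable. -/
theorem freeAct_mk {n : ℕ} (o : (O.obj n).Ob) (r : Fin n → X.Word) :
    X.freeAct o (fun i => FreeOb.mk (r i)) = FreeOb.mk (Word.subst o r) :=
  FreeOb.eq_of_mk_eq (fun r => FreeOb.mk (Word.subst o r))
    (fun _ _ _ hP h => FreeOb.sound (Word.Rel.subst hP o h)) fun _ => FreeOb.mk_rep _

/-- The isomorphism between the value of an operation at evaluations of words and the evaluation of
the value of the operation. -/
noncomputable def evIso {n : ℕ} (o : (O.obj n).Ob) (x : Fin n → X.FreeOb) : X.cat.Mor :=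
  (X.phi fun i => (x i).rep.1).app (o, fun i => (x i).rep.2)

/-- Independence of representatives comes from `Word.Rel.phi_eq`; from here on `evIso` can be
treated as φ at any words in the given classes. -/
theorem evIso_mk {n : ℕ} (o : (O.obj n).Ob) (r : Fin n → X.Word) :
    X.evIso o (fun i => FreeOb.mk (r i)) = (X.phi fun i => (r i).1).app (o, fun i => (r i).2) :=
  FreeOb.eq_of_mk_eq (fun r : Fin n → X.Word =>
    (X.phi fun i => (r i).1).app (o, fun i => (r i).2))
    (fun _ _ _ hP h => Word.Rel.phi_eq hP o h) fun _ => FreeOb.mk_rep _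

@[simp]
theorem src_evIso {n : ℕ} (o : (O.obj n).Ob) (x : Fin n → X.FreeOb) :
    X.cat.src (X.evIso o x) = (X.theta n).obj (o, fun i => X.ev (x i)) := by
  obtain ⟨r, rfl⟩ := FreeOb.exists_reps x
  rw [evIso_mk, UTrans.src_app]
  rfl

@[simp]
theorem tgt_evIso {n : ℕ} (o : (O.obj n).Ob) (x : Fin n → X.FreeOb) :
    X.cat.tgt (X.evIso o x) = X.ev (X.freeAct o x) := by
  obtain ⟨r, rfl⟩ := FreeOb.exists_reps x
  rw [evIso_mk, UTrans.tgt_app, freeAct_mk]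
  rfl

theorem isIso_evIso {n : ℕ} (o : (O.obj n).Ob) (x : Fin n → X.FreeOb) :
    X.cat.IsIso (X.evIso o x) :=
  (X.phi_invertible _).isIso_app _

theorem freeAct_smul (c : G) {n : ℕ} (o : (O.obj n).Ob) (x : Fin n → X.FreeOb) :
    X.freeAct (c • o) (fun i => c • x i) = c • X.freeAct o x := by
  obtain ⟨r, rfl⟩ := FreeOb.exists_reps x
  simp only [FreeOb.smul_mk]
  rw [freeAct_mk, freeAct_mk, FreeOb.smul_mk]
  refine congrArg FreeOb.mk (Sigma.ext rfl (heq_of_eq (Prod.ext ?_ rfl)))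
  exact (O.gam fun i => (r i).1).obj_smul c (o, fun i => (r i).2.1)

theorem evIso_smul (c : G) {n : ℕ} (o : (O.obj n).Ob) (x : Fin n → X.FreeOb) :
    X.evIso (c • o) (fun i => c • x i) = c • X.evIso o x := by
  obtain ⟨r, rfl⟩ := FreeOb.exists_reps x
  simp only [FreeOb.smul_mk]
  rw [evIso_mk, evIso_mk]
  exact (X.phi fun i => (r i).1).app_smul c (o, fun i => (r i).2)

/-- By equivariance of γ, a permutation of the inputs is a permutation of blocks of letters, and
this disappears in the class. -/
theorem freeAct_act {n n' : ℕ} (e : Fin n ≃ Fin n') (o : (O.obj n').Ob) (x : Fin n' → X.FreeOb) :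
    X.freeAct ((O.act e).obj o) (fun i => x (e i)) = X.freeAct o x := by
  obtain ⟨r, rfl⟩ := FreeOb.exists_reps x
  rw [X.freeAct_mk _ fun i => r (e i), freeAct_mk]
  have h := O.gam_equivariant_obj (m := fun i => (r (e i)).1) (m' := fun i => (r i).1) e
    (fun i => Equiv.refl _) o fun i => (r i).2.1
  simp only [O.act_refl_obj] at h
  refine Eq.trans ?_ (FreeOb.mk_perm (blockEquiv (m := fun i => (r (e i)).1)
    (m' := fun i => (r i).1) e (fun i => Equiv.refl _)) _ _)
  refine congrArg FreeOb.mk (Sigma.ext rfl (heq_of_eq (Prod.ext h ?_)))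
  exact funext fun j => (flat_blockEquiv (m := fun i => (r (e i)).1) (m' := fun i => (r i).1) e
    (fun i => Equiv.refl _) (fun i => (r i).2.2) j).symm

theorem evIso_act {n n' : ℕ} (e : Fin n ≃ Fin n') (o : (O.obj n').Ob) (x : Fin n' → X.FreeOb) :
    X.evIso ((O.act e).obj o) (fun i => x (e i)) = X.evIso o x := by
  obtain ⟨r, rfl⟩ := FreeOb.exists_reps x
  rw [X.evIso_mk _ fun i => r (e i), evIso_mk]
  have h := X.phi_equivariant (m := fun i => (r (e i)).1) (m' := fun i => (r i).1) e
    (fun i => Equiv.refl _) o (fun i => (r i).2.1) fun i => (r i).2.2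
  simp only [O.act_refl_obj] at h
  exact h

theorem freeAct_one (x : Fin 1 → X.FreeOb) : X.freeAct O.one x = x 0 := by
  obtain ⟨⟨n, o, a⟩, hr⟩ := (x 0).exists_rep
  obtain rfl : x = fun _ => FreeOb.mk ⟨n, o, a⟩ :=
    funext fun i => by rw [hr, Subsingleton.elim i 0]
  rw [X.freeAct_mk O.one fun _ => ⟨n, o, a⟩]
  refine Eq.trans ?_ (FreeOb.mk_perm (oneBlockEquiv n) o a)
  refine congrArg FreeOb.mk (Sigma.ext rfl (heq_of_eq (Prod.ext (O.gam_one_left_obj n o) ?_)))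
  exact funext fun j => congrArg a (blk_oneBlock n j)

/-- This is the first half of axiom (v). -/
theorem evIso_one (x : Fin 1 → X.FreeOb) : X.evIso O.one x = X.cat.idt (X.ev (x 0)) := by
  obtain ⟨⟨n, o, a⟩, hr⟩ := (x 0).exists_rep
  obtain rfl : x = fun _ => FreeOb.mk ⟨n, o, a⟩ :=
    funext fun i => by rw [hr, Subsingleton.elim i 0]
  rw [X.evIso_mk O.one fun _ => ⟨n, o, a⟩]
  exact X.phi_one_left n o a

/-- With no inner operations, all of them are vacuously units. This will be the condition on ζ₀ for
the evaluation. -/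
theorem evIso_zero (o : (O.obj 0).Ob) (x : Fin 0 → X.FreeOb) :
    X.evIso o x = X.cat.idt (X.ev (X.freeAct o x)) := by
  have h : X.evIso o x = X.cat.idt _ := X.phi_zero _ _
  have h' := X.tgt_evIso o x
  rw [h, GCat.tgt_idt] at h'
  rw [h, h']

/-- Associativity of γ holds up to `assocEquiv`, which is a reindexing of letters and so invisible
in classes. This is why the action on words is strict. -/
theorem freeAct_gam {n : ℕ} (m : Fin n → ℕ) (o : (O.obj n).Ob) (x : ∀ i, (O.obj (m i)).Ob)
    (a : ∀ i, Fin (m i) → X.FreeOb) :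
    X.freeAct o (fun i => X.freeAct (x i) (a i)) =
      X.freeAct ((O.gam m).obj (o, x)) (flat a) := by
  choose r hr using fun i => FreeOb.exists_reps (a i)
  obtain rfl : a = fun i s => FreeOb.mk (r i s) := funext hr
  have e₁ : (fun i => X.freeAct (x i) fun s => FreeOb.mk (r i s)) =
      fun i => FreeOb.mk (Word.subst (x i) (r i)) := funext fun i => X.freeAct_mk _ _
  rw [e₁, X.freeAct_mk, X.freeAct_mk _ fun j => r (blk m j).1 (blk m j).2]
  refine (FreeOb.mk_perm (assocEquiv m fun i s => (r i s).1) _ _).symm.trans ?_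
  refine congrArg FreeOb.mk (Sigma.ext rfl (heq_of_eq (Prod.ext
    (O.gam_assoc_obj m (fun i s => (r i s).1) o x fun i s => (r i s).2.1).symm ?_)))
  exact funext fun j => flat_assocEquiv m (fun i s => (r i s).1) (fun i s => (r i s).2.2) j

/-- Axiom (vi) at representatives. With words as a strict algebra and `evIso` as ζ, it is the
compatibility required of a pseudomorphism. -/
theorem evIso_gam {n : ℕ} (m : Fin n → ℕ) (o : (O.obj n).Ob) (x : ∀ i, (O.obj (m i)).Ob)
    (a : ∀ i, Fin (m i) → X.FreeOb) :
    X.cat.mul ((X.theta n).mor ((O.obj n).idt o, fun i => X.evIso (x i) (a i)))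
        (X.evIso o fun i => X.freeAct (x i) (a i)) =
      X.cat.mul ((X.phi m).app (o, fun i => (x i, fun s => X.ev (a i s))))
        (X.evIso ((O.gam m).obj (o, x)) (flat a)) := by
  choose r hr using fun i => FreeOb.exists_reps (a i)
  obtain rfl : a = fun i s => FreeOb.mk (r i s) := funext hr
  have e₁ : (fun i => X.freeAct (x i) fun s => FreeOb.mk (r i s)) =
      fun i => FreeOb.mk (Word.subst (x i) (r i)) := funext fun i => X.freeAct_mk _ _
  have e₂ : (fun i => X.evIso (x i) fun s => FreeOb.mk (r i s)) =
      fun i => (X.phi fun s => (r i s).1).app (x i, fun s => (r i s).2) :=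
    funext fun i => X.evIso_mk _ _
  rw [e₁, e₂, X.evIso_mk, X.evIso_mk _ fun j => r (blk m j).1 (blk m j).2]
  have key := X.phi_assoc m (fun i s => (r i s).1) o x (fun i s => (r i s).2.1)
    fun i s => (r i s).2.2
  rw [X.cat.comp_eq_mul, X.cat.comp_eq_mul] at key
  exact key.symm

end PsAlg

end Words

/-! ### Strict algebras from strict data -/

/-- The identity transformation between equal functors. -/
def GTrans.ofEq {A : GCat.{u, v} G} {B : GCat.{u, w} G} {F F' : GFunctor A B} (h : F = F') :
    GTrans F F' where
  app x := B.idt (F.obj x)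
  src_app _ := by simp
  tgt_app _ := by simp [h]
  naturality f := by subst h; rw [B.comp_idt', B.idt_comp']
  app_smul _ _ := by rw [F.obj_smul, B.idt_smul]

theorem GTrans.isInvertible_ofEq {A : GCat.{u, v} G} {B : GCat.{u, w} G} {F F' : GFunctor A B}
    (h : F = F') : (GTrans.ofEq h).IsInvertible :=
  isInvertible_of_isIso _ fun _ => GCat.isIso_idt _

section

variable {O : Operad.{u, u} G}

/-- The strict algebra given by a strictly associative action. -/
def StrictAlg.ofAction (A : GCat.{u, u} G) (theta : ∀ n, GFunctor (actDom O A n) A)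
    (hobj : ∀ {n n' : ℕ} (e : Fin n ≃ Fin n') (o : (O.obj n').Ob) (a : Fin n' → A.Ob),
      (theta n).obj ((O.act e).obj o, fun i => a (e i)) = (theta n').obj (o, a))
    (hmor : ∀ {n n' : ℕ} (e : Fin n ≃ Fin n') (o : (O.obj n').Mor) (a : Fin n' → A.Mor),
      (theta n).mor ((O.act e).mor o, fun i => a (e i)) = (theta n').mor (o, a))
    (hobj₁ : ∀ a : Fin 1 → A.Ob, (theta 1).obj (O.one, a) = a 0)
    (hmor₁ : ∀ a : Fin 1 → A.Mor, (theta 1).mor ((O.obj 1).idt O.one, a) = a 0)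
    (hassoc : ∀ {n : ℕ} (m : Fin n → ℕ), iterAct theta m = compAct theta m) : StrictAlg O where
  alg :=
    { cat := A
      theta := theta
      phi := fun m => GTrans.ofEq (hassoc m)
      phi_invertible := fun m => GTrans.isInvertible_ofEq _
      theta_equivariant_obj := fun e o a => by
        rw [← hobj e]; simp
      theta_equivariant_mor := fun e o a => by
        rw [← hmor e]; simp
      phi_unit_object := fun _ _ _ _ _ _ _ => rfl
      theta_one_obj := hobj₁
      theta_one_mor := hmor₁
      phi_equivariant := fun {k k' m m'} e d o x a => by
        refine congrArg A.idt ?_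
        refine Eq.trans (congrArg (fun z => (theta k).obj ((O.act e).obj o, z))
          (funext fun i => ?_)) (hobj e o fun i => (theta (m' i)).obj (x i, a i))
        exact hobj (d i) (x (e i)) (a (e i))
      phi_one_left := fun n x a => congrArg A.idt (hobj₁ fun _ => (theta n).obj (x, a))
      phi_one_right := fun n x a => congrArg (fun z => A.idt ((theta n).obj (x, z)))
        (funext fun i => hobj₁ fun _ => a i)
      phi_assoc := fun {n} m p o x y a => by
        refine (A.comp_idt' _ _ _).trans (Eq.trans ?_ (A.comp_idt' _ _ _).symm)
        exact ((theta n).mor_idt (o, fun r =>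
          (theta (m r)).obj (x r, fun s => (theta (p r s)).obj (y r s, a r s)))).symm }
  isStrict _ _ := rfl

/-- The strict map of strict algebras given by a functor that commutes with the actions. -/
def StrictMor.ofFunctor {A B : StrictAlg O} (f : GFunctor A.alg.cat B.alg.cat)
    (h : ∀ n, actAfter A.alg B.alg f n = actBefore A.alg B.alg f n) : A ⟶ B where
  mor :=
    { fn := f
      zeta := fun n => GTrans.ofEq (h n)
      zeta_invertible := fun n => GTrans.isInvertible_ofEq _
      zeta_zero := fun x => congrArg (fun F : GFunctor _ _ => B.alg.cat.idt (F.obj x)) (h 0)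
      zeta_one := fun a => congrArg B.alg.cat.idt (B.alg.theta_one_obj fun i => f.obj (a i))
      zeta_equivariant := fun e o a => congrArg B.alg.cat.idt
        (B.alg.theta_act_obj e o fun i => f.obj (a i))
      zeta_phi := fun {n} m o x a => by
        have e₁ : f.mor ((A.alg.phi m).app (o, fun r => (x r, a r))) =
            B.alg.cat.idt (f.obj ((iterAct A.alg.theta m).obj (o, fun r => (x r, a r)))) := by
          rw [A.isStrict, f.mor_idt]
        simp only [e₁]
        refine (B.alg.cat.comp_idt' _ _ _).trans ((B.alg.cat.comp_idt' _ _ _).trans ?_)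
        refine Eq.trans ?_ (B.alg.cat.comp_idt' _ _ _).symm
        rw [B.isStrict]
        exact theta_mor_idt B.alg o _ }
  isStrict n x := congrArg (fun F : GFunctor _ _ => B.alg.cat.idt (F.obj x)) (h n)

end

/-! ### Pulling back a category structure along a map of objects -/

/-- A morphism of `A` whose source and target are values of `t`. -/
@[ext]
structure PullMor (A : GCat.{u, v} G) {Q : Type v} (t : Q → A.Ob) where
  dom : Q
  cod : Q
  hom : A.Mor
  src_hom : A.src hom = t dom
  tgt_hom : A.tgt hom = t cod

attribute [simp] PullMor.src_hom PullMor.tgt_hom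

/-- The `G`-category with the given `G`-set of objects and the morphisms of `A`. -/
@[reducible]
noncomputable def GCat.pull (A : GCat.{u, v} G) {Q : Type v} [MulAction G Q] (t : Q → A.Ob)
    (ht : ∀ (c : G) x, t (c • x) = c • t x) : GCat.{u, v} G where
  Ob := Q
  Mor := PullMor A t
  obAct := inferInstance
  morAct :=
    { smul := fun c f => ⟨c • f.dom, c • f.cod, c • f.hom, by simp [ht], by simp [ht]⟩
      one_smul := fun f => PullMor.ext (one_smul G f.dom) (one_smul G f.cod) (one_smul G f.hom)
      mul_smul := fun c d f => PullMor.ext (mul_smul c d f.dom) (mul_smul c d f.cod)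
        (mul_smul c d f.hom) }
  src f := f.dom
  tgt f := f.cod
  idt x := ⟨x, x, A.idt (t x), by simp, by simp⟩
  comp f g h := ⟨f.dom, g.cod, A.mul f.hom g.hom, by simp, by rw [A.tgt_mul (by simp [h])]; simp⟩
  src_idt _ := rfl
  tgt_idt _ := rfl
  src_comp _ _ _ := rfl
  tgt_comp _ _ _ := rfl
  idt_comp f := PullMor.ext rfl rfl (A.idt_mul f.src_hom)
  comp_idt f := PullMor.ext rfl rfl (A.mul_idt f.tgt_hom)
  assoc f g k h₁ h₂ := PullMor.ext rfl rfl (A.mul_assoc (by simp [h₁]) (by simp [h₂]))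
  src_smul _ _ := rfl
  tgt_smul _ _ := rfl
  idt_smul c x := PullMor.ext rfl rfl (by
    change A.idt (t (c • x)) = c • A.idt (t x)
    rw [ht, A.idt_smul])
  comp_smul c f g h := PullMor.ext rfl rfl (A.smul_mul c (by simp [h])).symm

/-! ### The strictification of a pseudoalgebra -/

/-- After `a` is cancelled, the diagram is filled by the squares `sq`, `nat` and `fin` and the
coherences `h₁` and `h₂`. -/
theorem GCat.paste_hexagon (A : GCat.{u, v} G) {a h e e' k b p p' q c c' l : A.Mor}
    (ha : A.IsIso a) (sq : A.mul a h = A.mul k b) (h₁ : A.mul b e' = A.mul p' c')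
    (nat : A.mul k p' = A.mul p q) (h₂ : A.mul a e = A.mul p c) (fin : A.mul c l = A.mul q c')
    (ah : A.tgt a = A.src h) (he' : A.tgt h = A.src e') (kb : A.tgt k = A.src b)
    (be' : A.tgt b = A.src e') (kp' : A.tgt k = A.src p') (pc' : A.tgt p' = A.src c')
    (pq : A.tgt p = A.src q) (qc' : A.tgt q = A.src c') (ae : A.tgt a = A.src e)
    (pc : A.tgt p = A.src c) (cl : A.tgt c = A.src l) (el : A.tgt e = A.src l) :
    A.mul h e' = A.mul e l := by
  refine ha.cancel_left (by rw [A.src_mul, ah]) (by rw [A.src_mul, ae]) ?_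
  rw [← A.mul_assoc ah he', sq, A.mul_assoc kb be', h₁, ← A.mul_assoc kp' pc', nat,
    A.mul_assoc pq qc', ← fin, ← A.mul_assoc pc cl, ← h₂, A.mul_assoc ae el]

section

variable {O : Operad.{u, u} G}

namespace PsAlg

variable (X : PsAlg O)

theorem src_theta_idt_mor {n : ℕ} (o : (O.obj n).Ob) (f : Fin n → X.cat.Mor) :
    X.cat.src ((X.theta n).mor ((O.obj n).idt o, f)) =
      (X.theta n).obj (o, fun i => X.cat.src (f i)) := by
  rw [UFunctor.src_mor]
  exact congrArg (X.theta n).obj (Prod.ext (GCat.src_idt _ _) rfl)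

theorem tgt_theta_idt_mor {n : ℕ} (o : (O.obj n).Ob) (f : Fin n → X.cat.Mor) :
    X.cat.tgt ((X.theta n).mor ((O.obj n).idt o, f)) =
      (X.theta n).obj (o, fun i => X.cat.tgt (f i)) := by
  rw [UFunctor.tgt_mor]
  exact congrArg (X.theta n).obj (Prod.ext (GCat.tgt_idt _ _) rfl)

theorem theta_idt_mul {n : ℕ} (o : (O.obj n).Ob) {f g : Fin n → X.cat.Mor}
    (h : ∀ i, X.cat.tgt (f i) = X.cat.src (g i)) :
    (X.theta n).mor ((O.obj n).idt o, fun i => X.cat.mul (f i) (g i)) =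
      X.cat.mul ((X.theta n).mor ((O.obj n).idt o, f)) ((X.theta n).mor ((O.obj n).idt o, g)) := by
  have := theta_mor_comp X o f g h
  rw [X.cat.comp_eq_mul] at this
  rw [← this]
  exact congrArg (fun z => (X.theta n).mor ((O.obj n).idt o, z))
    (funext fun i => (X.cat.comp_eq_mul _ _ _).symm)

theorem isIso_theta_idt {n : ℕ} (o : (O.obj n).Ob) {f : Fin n → X.cat.Mor}
    (h : ∀ i, X.cat.IsIso (f i)) : X.cat.IsIso ((X.theta n).mor ((O.obj n).idt o, f)) := by
  refine ⟨(X.theta n).mor ((O.obj n).idt o, fun i => X.cat.inv (f i)), ?_, ?_, ?_, ?_⟩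
  · rw [src_theta_idt_mor, tgt_theta_idt_mor]
    simp only [fun i => (h i).src_inv]
  · rw [src_theta_idt_mor, tgt_theta_idt_mor]
    simp only [fun i => (h i).tgt_inv]
  · rw [← X.theta_idt_mul o fun i => (h i).src_inv.symm, src_theta_idt_mor]
    simp only [fun i => (h i).mul_inv]
    exact theta_mor_idt X o _
  · rw [← X.theta_idt_mul o fun i => (h i).tgt_inv, tgt_theta_idt_mor]
    simp only [fun i => (h i).inv_mul]
    exact theta_mor_idt X o _

/-- The naturality square of the action in both variables. -/
theorem theta_square {n : ℕ} (o : (O.obj n).Mor) {f g h k : Fin n → X.cat.Mor}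
    (hfg : ∀ i, X.cat.tgt (f i) = X.cat.src (g i)) (hhk : ∀ i, X.cat.tgt (h i) = X.cat.src (k i))
    (e : ∀ i, X.cat.mul (f i) (g i) = X.cat.mul (h i) (k i)) :
    X.cat.mul ((X.theta n).mor ((O.obj n).idt ((O.obj n).src o), f)) ((X.theta n).mor (o, g)) =
      X.cat.mul ((X.theta n).mor (o, h)) ((X.theta n).mor ((O.obj n).idt ((O.obj n).tgt o), k)) := by
  have h₁ : (actDom O X.cat n).tgt ((O.obj n).idt ((O.obj n).src o), f) =
      (actDom O X.cat n).src (o, g) := Prod.ext (by simp) (funext hfg)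
  have h₂ : (actDom O X.cat n).tgt (o, h) =
      (actDom O X.cat n).src ((O.obj n).idt ((O.obj n).tgt o), k) :=
    Prod.ext (by simp) (funext hhk)
  rw [← (X.theta n).mor_mul h₁, ← (X.theta n).mor_mul h₂, ← GCat.comp_eq_mul _ _ _ h₁,
    ← GCat.comp_eq_mul _ _ _ h₂]
  refine congrArg (X.theta n).mor (Prod.ext ?_ (funext fun i => ?_))
  · exact ((O.obj n).idt_comp' _ _ _).trans ((O.obj n).comp_idt' _ _ _).symm
  · exact (X.cat.comp_eq_mul _ _ _).trans ((e i).trans (X.cat.comp_eq_mul _ _ _).symm)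

/-- The underlying `G`-category of the strictification. -/
@[reducible]
noncomputable def strCat : GCat.{u, u} G := X.cat.pull X.ev X.ev_smul

variable {X} in
/-- The action on morphisms of the strictification, as a morphism of `X`. -/
noncomputable def strHom {n : ℕ} (o : (O.obj n).Mor) (f : Fin n → X.strCat.Mor) : X.cat.Mor :=
  X.cat.mul (X.cat.inv (X.evIso ((O.obj n).src o) fun i => (f i).dom))
    (X.cat.mul ((X.theta n).mor (o, fun i => (f i).hom))
      (X.evIso ((O.obj n).tgt o) fun i => (f i).cod))

variable {X}

theorem src_theta_hom {n : ℕ} (o : (O.obj n).Mor) (f : Fin n → X.strCat.Mor) :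
    X.cat.src ((X.theta n).mor (o, fun i => (f i).hom)) =
      (X.theta n).obj ((O.obj n).src o, fun i => X.ev (f i).dom) := by
  rw [UFunctor.src_mor]
  exact congrArg (X.theta n).obj (Prod.ext rfl (funext fun i => (f i).src_hom))

theorem tgt_theta_hom {n : ℕ} (o : (O.obj n).Mor) (f : Fin n → X.strCat.Mor) :
    X.cat.tgt ((X.theta n).mor (o, fun i => (f i).hom)) =
      (X.theta n).obj ((O.obj n).tgt o, fun i => X.ev (f i).cod) := by
  rw [UFunctor.tgt_mor]
  exact congrArg (X.theta n).obj (Prod.ext rfl (funext fun i => (f i).tgt_hom))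

theorem src_strHom {n : ℕ} (o : (O.obj n).Mor) (f : Fin n → X.strCat.Mor) :
    X.cat.src (strHom o f) = X.ev (X.freeAct ((O.obj n).src o) fun i => (f i).dom) := by
  rw [strHom, GCat.src_mul, (X.isIso_evIso _ _).src_inv, tgt_evIso]

theorem tgt_strHom {n : ℕ} (o : (O.obj n).Mor) (f : Fin n → X.strCat.Mor) :
    X.cat.tgt (strHom o f) = X.ev (X.freeAct ((O.obj n).tgt o) fun i => (f i).cod) := by
  rw [strHom, GCat.tgt_mul, GCat.tgt_mul, tgt_evIso]
  · rw [tgt_theta_hom, src_evIso]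
  · rw [(X.isIso_evIso _ _).tgt_inv, GCat.src_mul, src_theta_hom, src_evIso]

/-- Conjugation by `evIso` is exactly what makes `evIso` natural. -/
theorem evIso_mul_strHom {n : ℕ} (o : (O.obj n).Mor) (f : Fin n → X.strCat.Mor) :
    X.cat.mul (X.evIso ((O.obj n).src o) fun i => (f i).dom) (strHom o f) =
      X.cat.mul ((X.theta n).mor (o, fun i => (f i).hom))
        (X.evIso ((O.obj n).tgt o) fun i => (f i).cod) := by
  symm
  refine ((X.isIso_evIso _ _).inv_mul_eq_iff ?_ ?_).mp rfl
  · rw [src_evIso, GCat.src_mul, src_theta_hom]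
  · rw [tgt_evIso, src_strHom]

/-- As `evIso` is invertible, its naturality square determines `strHom`. The laws of the action on
morphisms are verified through this characterisation, without manipulating inverses. -/
theorem strHom_eq {n : ℕ} (o : (O.obj n).Mor) (f : Fin n → X.strCat.Mor) {g : X.cat.Mor}
    (hg : X.cat.src g = X.ev (X.freeAct ((O.obj n).src o) fun i => (f i).dom))
    (h : X.cat.mul ((X.theta n).mor (o, fun i => (f i).hom))
        (X.evIso ((O.obj n).tgt o) fun i => (f i).cod) =
      X.cat.mul (X.evIso ((O.obj n).src o) fun i => (f i).dom) g) : strHom o f = g := by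
  refine ((X.isIso_evIso _ _).inv_mul_eq_iff ?_ ?_).mpr h
  · rw [src_evIso, GCat.src_mul, src_theta_hom]
  · rw [tgt_evIso, hg]

variable (X)

/-- The action of the operad on the strictification. -/
noncomputable def strTheta (n : ℕ) : GFunctor (actDom O X.strCat n) X.strCat where
  obj x := X.freeAct x.1 x.2
  mor f := ⟨X.freeAct ((O.obj n).src f.1) fun i => (f.2 i).dom,
    X.freeAct ((O.obj n).tgt f.1) fun i => (f.2 i).cod, strHom f.1 f.2, src_strHom _ _,
    tgt_strHom _ _⟩
  src_mor _ := rfl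
  tgt_mor _ := rfl
  mor_idt x := by
    refine PullMor.ext (by simp) (by simp) ?_
    refine strHom_eq _ _ (by simp) ?_
    simp only [GCat.src_idt, GCat.tgt_idt]
    rw [theta_mor_idt, X.cat.idt_mul (by simp), X.cat.mul_idt (by simp)]
  mor_comp f g h := by
    have h₁ : (O.obj n).tgt f.1 = (O.obj n).src g.1 := congrArg Prod.fst h
    have h₂ : ∀ i, (f.2 i).cod = (g.2 i).dom := fun i => congrFun (congrArg Prod.snd h) i
    have h₂' : (fun i => (f.2 i).cod) = fun i => (g.2 i).dom := funext h₂
    refine PullMor.ext (by simp) (by simp) ?_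
    have hc : X.cat.tgt (strHom f.1 f.2) = X.cat.src (strHom g.1 g.2) := by
      rw [tgt_strHom, src_strHom, h₁, h₂']
    -- The naturality squares of the two factors are pasted along their common edge; functoriality
    -- of θ does the rest.
    refine strHom_eq _ _ (by rw [GCat.src_mul, src_strHom]; simp) ?_
    simp only [GCat.src_comp, GCat.tgt_comp]
    rw [← X.cat.mul_assoc (by rw [tgt_evIso, src_strHom]) hc, evIso_mul_strHom,
      X.cat.mul_assoc (by rw [tgt_theta_hom, src_evIso])
        (by rw [tgt_evIso, src_strHom, h₁, h₂']), h₁, h₂', evIso_mul_strHom,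
      ← X.cat.mul_assoc (by rw [tgt_theta_hom, src_theta_hom, h₁]; simp only [h₂])
        (by rw [tgt_theta_hom, src_evIso])]
    refine congrArg (fun z => X.cat.mul z _) ?_
    have hd : (actDom O X.cat n).tgt (f.1, fun i => (f.2 i).hom) =
        (actDom O X.cat n).src (g.1, fun i => (g.2 i).hom) :=
      Prod.ext h₁ (funext fun i => by simp [h₂])
    rw [← X.cat.comp_eq_mul _ _ (by rw [UFunctor.tgt_mor, UFunctor.src_mor, hd]),
      ← (X.theta n).mor_comp _ _ hd]
    refine congrArg (X.theta n).mor (Prod.ext rfl (funext fun i => ?_))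
    exact (X.cat.comp_eq_mul _ _ _).symm
  obj_smul c x := X.freeAct_smul c x.1 x.2
  mor_smul c f := by
    refine PullMor.ext ?_ ?_ ?_
    · change X.freeAct ((O.obj n).src (c • f.1)) _ = c • X.freeAct _ _
      rw [GCat.src_smul, ← X.freeAct_smul]
      rfl
    · change X.freeAct ((O.obj n).tgt (c • f.1)) _ = c • X.freeAct _ _
      rw [GCat.tgt_smul, ← X.freeAct_smul]
      rfl
    · change strHom _ _ = c • strHom f.1 f.2
      refine strHom_eq _ _ ?_ ?_
      · rw [GCat.src_smul, src_strHom, ← X.ev_smul, ← X.freeAct_smul, ← GCat.src_smul]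
        rfl
      -- Since `evIso` and θ are equivariant, acting by `c` on the square of `f` gives the square of
      -- `c • f`.
      · have h := congrArg (c • ·) (evIso_mul_strHom f.1 f.2)
        dsimp only at h
        rw [X.cat.smul_mul c (by rw [tgt_evIso, src_strHom]),
          X.cat.smul_mul c (by rw [tgt_theta_hom, src_evIso]), ← X.evIso_smul, ← X.evIso_smul,
          ← (X.theta n).mor_smul, ← GCat.src_smul, ← GCat.tgt_smul] at h
        exact h.symm

theorem strTheta_act_mor {n n' : ℕ} (e : Fin n ≃ Fin n') (o : (O.obj n').Mor)
    (f : Fin n' → X.strCat.Mor) :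
    (X.strTheta n).mor ((O.act e).mor o, fun i => f (e i)) = (X.strTheta n').mor (o, f) := by
  have hs := X.freeAct_act e ((O.obj n').src o) fun i => (f i).dom
  have ht := X.freeAct_act e ((O.obj n').tgt o) fun i => (f i).cod
  have hs' := X.evIso_act e ((O.obj n').src o) fun i => (f i).dom
  have ht' := X.evIso_act e ((O.obj n').tgt o) fun i => (f i).cod
  rw [← (O.act e).src_mor] at hs hs'
  rw [← (O.act e).tgt_mor] at ht ht'
  refine PullMor.ext hs ht ?_
  refine strHom_eq _ _ ?_ ?_
  · rw [hs]; exact src_strHom _ _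
  · rw [hs', ht', X.theta_act_mor e o fun i => (f i).hom]
    exact (evIso_mul_strHom _ _).symm

theorem strTheta_one_mor (f : Fin 1 → X.strCat.Mor) :
    (X.strTheta 1).mor ((O.obj 1).idt O.one, f) = f 0 := by
  refine PullMor.ext ?_ ?_ ?_
  · refine Eq.trans ?_ (X.freeAct_one fun i => (f i).dom)
    simp [strTheta]
  · refine Eq.trans ?_ (X.freeAct_one fun i => (f i).cod)
    simp [strTheta]
  · refine strHom_eq _ _ ?_ ?_
    · rw [GCat.src_idt, freeAct_one, PullMor.src_hom]
    · rw [GCat.src_idt, GCat.tgt_idt, evIso_one, evIso_one, X.theta_one_mor,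
        X.cat.idt_mul (by simp), X.cat.mul_idt (by simp)]

/-- The faces of a prism: `evIso_gam` at the sources and at the targets, naturality of φ, and the
defining squares of the inner and outer conjugations. The remaining face commutes because the edge
θ(o; `evIso`) is invertible. -/
theorem strHom_gam {n : ℕ} (m : Fin n → ℕ) (o : (O.obj n).Mor) (p : ∀ i, (O.obj (m i)).Mor)
    (f : ∀ i, Fin (m i) → X.strCat.Mor) :
    strHom o (fun i => (X.strTheta (m i)).mor (p i, f i)) =
      strHom ((O.gam m).mor (o, p)) (flat f) := by
  have hs := X.freeAct_gam m ((O.obj n).src o) (fun i => (O.obj (m i)).src (p i))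
    fun i s => (f i s).dom
  have hs' := X.evIso_gam m ((O.obj n).src o) (fun i => (O.obj (m i)).src (p i))
    fun i s => (f i s).dom
  have ht' := X.evIso_gam m ((O.obj n).tgt o) (fun i => (O.obj (m i)).tgt (p i))
    fun i s => (f i s).cod
  have hgs : (O.gam m).obj ((O.obj n).src o, fun i => (O.obj (m i)).src (p i)) =
    (O.obj _).src ((O.gam m).mor (o, p)) := ((O.gam m).src_mor (o, p)).symm
  have hgt : (O.gam m).obj ((O.obj n).tgt o, fun i => (O.obj (m i)).tgt (p i)) =
    (O.obj _).tgt ((O.gam m).mor (o, p)) := ((O.gam m).tgt_mor (o, p)).symm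
  rw [hgs] at hs hs'
  rw [hgt] at ht'
  have hsrc : X.cat.src (strHom ((O.gam m).mor (o, p)) (flat f)) =
      X.ev (X.freeAct ((O.obj n).src o) fun i => X.freeAct ((O.obj (m i)).src (p i))
        fun s => (f i s).dom) := by rw [src_strHom, hs]
  refine strHom_eq _ _ hsrc ?_
  have inner_src : ∀ i, X.cat.tgt (X.evIso ((O.obj (m i)).src (p i)) fun s => (f i s).dom) =
      X.cat.src (strHom (p i) (f i)) := fun i => by rw [tgt_evIso, src_strHom]
  have inner_tgt : ∀ i, X.cat.tgt ((X.theta (m i)).mor (p i, fun s => (f i s).hom)) =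
      X.cat.src (X.evIso ((O.obj (m i)).tgt (p i)) fun s => (f i s).cod) :=
    fun i => by rw [tgt_theta_hom, src_evIso]
  have sq := X.theta_square o inner_src inner_tgt fun i => evIso_mul_strHom (p i) (f i)
  have nat : X.cat.mul
      ((X.theta n).mor (o, fun i => (X.theta (m i)).mor (p i, fun s => (f i s).hom)))
      ((X.phi m).app ((O.obj n).tgt o,
        fun i => ((O.obj (m i)).tgt (p i), fun s => X.ev (f i s).cod))) =
    X.cat.mul
      ((X.phi m).app ((O.obj n).src o,
        fun i => ((O.obj (m i)).src (p i), fun s => X.ev (f i s).dom)))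
      ((X.theta _).mor ((O.gam m).mor (o, p), flat fun i s => (f i s).hom)) :=
    (X.phi m).naturality_mul (f := (o, fun i => (p i, fun s => (f i s).hom)))
      (Prod.ext rfl (funext fun i => Prod.ext rfl (funext fun s => (f i s).src_hom)))
      (Prod.ext rfl (funext fun i => Prod.ext rfl (funext fun s => (f i s).tgt_hom)))
  have fin := evIso_mul_strHom ((O.gam m).mor (o, p)) (flat f)
  -- The goals that remain after the pasting say that consecutive edges are composable.
  refine X.cat.paste_hexagon
    (X.isIso_theta_idt ((O.obj n).src o) fun i => X.isIso_evIso _ _) sq ht' nat hs' fin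
    ?_ ?_ ?_ ?_ ?_ ?_ ?_ ?_ ?_ ?_ ?_ ?_
  · rw [tgt_theta_idt_mor, UFunctor.src_mor]
    exact congrArg (X.theta n).obj (Prod.ext rfl (funext inner_src))
  · rw [UFunctor.tgt_mor, src_evIso]
    exact congrArg (X.theta n).obj (Prod.ext rfl (funext fun i => tgt_strHom _ _))
  · rw [src_theta_idt_mor, UFunctor.tgt_mor]
    exact congrArg (X.theta n).obj (Prod.ext rfl (funext inner_tgt))
  · rw [tgt_theta_idt_mor, src_evIso]
    exact congrArg (X.theta n).obj (Prod.ext rfl (funext fun i => tgt_evIso _ _ _))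
  · rw [UFunctor.tgt_mor, UTrans.src_app]
    exact congrArg (X.theta n).obj (Prod.ext rfl (funext fun i => tgt_theta_hom _ _))
  · rw [UTrans.tgt_app, src_evIso, ← hgt]; rfl
  · rw [UTrans.tgt_app, UFunctor.src_mor]
    exact congrArg (X.theta _).obj (Prod.ext hgs (funext fun i => (PullMor.src_hom _).symm))
  · rw [UFunctor.tgt_mor, src_evIso]
    exact congrArg (X.theta _).obj (Prod.ext rfl (funext fun i => PullMor.tgt_hom _))
  · rw [tgt_theta_idt_mor, src_evIso]
    exact congrArg (X.theta n).obj (Prod.ext rfl (funext fun i => tgt_evIso _ _ _))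
  · rw [UTrans.tgt_app, src_evIso, ← hgs]; rfl
  · rw [tgt_evIso, src_strHom]
  · rw [tgt_evIso]; exact hsrc.symm

/-- The strictification of a pseudoalgebra. -/
noncomputable def str : StrictAlg O :=
  StrictAlg.ofAction X.strCat X.strTheta X.freeAct_act X.strTheta_act_mor X.freeAct_one
    X.strTheta_one_mor fun {n} m => GFunctor.ext'
      (fun x => X.freeAct_gam m x.1 (fun i => (x.2 i).1) fun i => (x.2 i).2)
      (fun f => by
        have hs := X.freeAct_gam m ((O.obj n).src f.1) (fun i => (O.obj (m i)).src (f.2 i).1)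
          fun i s => ((f.2 i).2 s).dom
        have ht := X.freeAct_gam m ((O.obj n).tgt f.1) (fun i => (O.obj (m i)).tgt (f.2 i).1)
          fun i s => ((f.2 i).2 s).cod
        refine PullMor.ext (hs.trans ?_) (ht.trans ?_)
          (X.strHom_gam m f.1 (fun i => (f.2 i).1) fun i => (f.2 i).2)
        · exact congrArg (X.freeAct · _)
            ((O.gam m).src_mor (f.1, fun i => (f.2 i).1)).symm
        · exact congrArg (X.freeAct · _)
            ((O.gam m).tgt_mor (f.1, fun i => (f.2 i).1)).symm)

end PsAlg

end

/-! ### Isomorphisms in a pulled back category -/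

theorem GCat.pull_mul_hom {A : GCat.{u, v} G} {Q : Type v} [MulAction G Q] {t : Q → A.Ob}
    {ht : ∀ (c : G) x, t (c • x) = c • t x} {f g : PullMor A t} (h : f.cod = g.dom) :
    ((A.pull t ht).mul f g).hom = A.mul f.hom g.hom := by
  exact congrArg PullMor.hom (GCat.comp_eq_mul (A.pull t ht) f g h).symm

/-- The projection to `A` is fully faithful, so it reflects isomorphisms. -/
theorem GCat.pull_isIso {A : GCat.{u, v} G} {Q : Type v} [MulAction G Q] {t : Q → A.Ob}
    {ht : ∀ (c : G) x, t (c • x) = c • t x} {f : PullMor A t} (h : A.IsIso f.hom) :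
    (A.pull t ht).IsIso f := by
  refine ⟨⟨f.cod, f.dom, A.inv f.hom, by rw [h.src_inv, f.tgt_hom], by rw [h.tgt_inv, f.src_hom]⟩,
    rfl, rfl, ?_, ?_⟩
  · refine PullMor.ext (by rw [← GCat.comp_eq_mul _ _ _ rfl]) (by rw [← GCat.comp_eq_mul _ _ _ rfl])
      ?_
    rw [GCat.pull_mul_hom rfl, h.mul_inv, f.src_hom]
  · refine PullMor.ext (by rw [← GCat.comp_eq_mul _ _ _ rfl]) (by rw [← GCat.comp_eq_mul _ _ _ rfl])
      ?_
    rw [GCat.pull_mul_hom rfl, h.inv_mul, f.tgt_hom]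

section

variable {O : Operad.{u, u} G}

/-! ### Invertible algebra 2-cells -/

theorem AlgCell.compat_mul {A B : PsAlg O} {f g : PsMor A B} (s : AlgCell f g) {n : ℕ}
    (o : (O.obj n).Ob) (a : Fin n → A.cat.Ob) :
    B.cat.mul ((B.theta n).mor ((O.obj n).idt o, fun i => s.app (a i))) ((g.zeta n).app (o, a)) =
      B.cat.mul ((f.zeta n).app (o, a)) (s.app ((A.theta n).obj (o, a))) := by
  have := s.compat n o a
  rwa [B.cat.comp_eq_mul, B.cat.comp_eq_mul] at this

theorem AlgCell.comp_app {A B : PsAlg O} {f g h : A ⟶ B} (s : f ⟶ g) (t : g ⟶ h)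
    (x : A.cat.Ob) : (AlgCell.toGTrans (s ≫ t)).app x =
      B.cat.mul ((AlgCell.toGTrans s).app x) ((AlgCell.toGTrans t).app x) :=
  B.cat.comp_eq_mul _ _ _

/-- An algebra 2-cell with invertible components is invertible. -/
noncomputable def AlgCell.toIso {A B : PsAlg O} {f g : A ⟶ B} (s : f ⟶ g)
    (h : ∀ x, B.cat.IsIso ((AlgCell.toGTrans s).app x)) : f ≅ g where
  hom := s
  inv :=
    { toGTrans := (GTrans.isInvertible_of_isIso (AlgCell.toGTrans s) h).choose
      compat := fun n o a => by
        set t := (GTrans.isInvertible_of_isIso (AlgCell.toGTrans s) h).choose with ht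
        obtain ⟨h₁, h₂⟩ := (GTrans.isInvertible_of_isIso (AlgCell.toGTrans s) h).choose_spec
        rw [← ht] at h₁ h₂
        have e₁ : ∀ x, B.cat.mul ((AlgCell.toGTrans s).app x) (t.app x) =
            B.cat.idt ((PsMor.fn f).obj x) := fun x => by
          rw [← B.cat.comp_eq_mul _ _ (by simp)]
          exact congrArg (fun r : GTrans _ _ => r.app x) h₁
        have key := AlgCell.compat_mul s o a
        rw [B.cat.comp_eq_mul, B.cat.comp_eq_mul]
        have hz : B.cat.tgt ((PsMor.zeta f n).app (o, a)) =
          B.cat.src ((AlgCell.toGTrans s).app ((A.theta n).obj (o, a))) := by simp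
        have hz' : B.cat.tgt ((PsMor.zeta g n).app (o, a)) =
          B.cat.src (t.app ((A.theta n).obj (o, a))) := by simp
        have hs : B.cat.tgt ((B.theta n).mor ((O.obj n).idt o,
            fun i => (AlgCell.toGTrans s).app (a i))) =
            B.cat.src ((PsMor.zeta g n).app (o, a)) := by
          rw [B.tgt_theta_idt_mor, UTrans.src_app]
          simp only [UTrans.tgt_app]
          rfl
        have ht' : B.cat.tgt ((B.theta n).mor ((O.obj n).idt o, fun i => t.app (a i))) =
            B.cat.src ((PsMor.zeta f n).app (o, a)) := by
          rw [B.tgt_theta_idt_mor, UTrans.src_app]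
          simp only [UTrans.tgt_app]
          rfl
        have hst : B.cat.tgt ((B.theta n).mor ((O.obj n).idt o,
            fun i => (AlgCell.toGTrans s).app (a i))) =
            B.cat.src ((B.theta n).mor ((O.obj n).idt o, fun i => t.app (a i))) := by
          rw [B.tgt_theta_idt_mor, B.src_theta_idt_mor]
          simp
        -- Composition with the invertible morphism θ(o; s) turns compatibility of the inverse into
        -- compatibility of `s`.
        refine (B.isIso_theta_idt o fun i => h (a i)).cancel_left
          (by rw [B.cat.src_mul, hst]) (by rw [B.cat.src_mul, hs]) ?_
        rw [← B.cat.mul_assoc hs hz', key, B.cat.mul_assoc hz (by simp), e₁,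
          B.cat.mul_idt (by simp), ← B.cat.mul_assoc hst ht',
          ← B.theta_idt_mul o fun i => by simp]
        simp only [e₁]
        rw [theta_mor_idt, B.cat.idt_mul]
        rw [UTrans.src_app]; rfl }
  hom_inv_id := AlgCell.ext' fun x => congrArg (fun r : GTrans _ _ => r.app x)
    (GTrans.isInvertible_of_isIso (AlgCell.toGTrans s) h).choose_spec.1
  inv_hom_id := AlgCell.ext' fun x => congrArg (fun r : GTrans _ _ => r.app x)
    (GTrans.isInvertible_of_isIso (AlgCell.toGTrans s) h).choose_spec.2

namespace PsAlg

variable (X : PsAlg O)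

/-! ### Evaluation as a pseudomorphism -/

/-- The evaluation functor from the strictification. -/
noncomputable def evFn : GFunctor X.strCat X.cat where
  obj := X.ev
  mor f := f.hom
  src_mor f := f.src_hom
  tgt_mor f := f.tgt_hom
  mor_idt _ := rfl
  mor_comp _ _ _ := (X.cat.comp_eq_mul _ _ _).symm
  obj_smul := X.ev_smul
  mor_smul _ _ := rfl

/-- The evaluation as a pseudomorphism from the strictification. -/
noncomputable def evMor : X.str.alg ⟶ X where
  fn := X.evFn
  zeta n :=
    { app := fun z => X.evIso z.1 z.2
      src_app := fun z => X.src_evIso z.1 z.2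
      tgt_app := fun z => X.tgt_evIso z.1 z.2
      naturality := fun f => by
        rw [X.cat.comp_eq_mul, X.cat.comp_eq_mul]
        exact (evIso_mul_strHom f.1 f.2).symm
      app_smul := fun c z => X.evIso_smul c z.1 z.2 }
  zeta_invertible n := GTrans.isInvertible_of_isIso _ fun z => X.isIso_evIso _ _
  zeta_zero z := X.evIso_zero z.1 z.2
  zeta_one a := X.evIso_one a
  zeta_equivariant e o a := X.evIso_act e o a
  zeta_phi m o x a := by
    -- In the strictification φ is an identity, and so is its image under evaluation.
    refine (X.cat.comp_idt' _ _ _).trans ?_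
    rw [X.cat.comp_eq_mul, X.cat.comp_eq_mul]
    exact X.evIso_gam m o x a

/-! ### The unit -/

variable {X} in
/-- An object as a word with the unit operation. -/
def FreeOb.of (a : X.cat.Ob) : X.FreeOb := mk ⟨1, O.one, fun _ => a⟩

@[simp]
theorem ev_of (a : X.cat.Ob) : X.ev (FreeOb.of a) = a := X.theta_one_obj fun _ => a

theorem of_smul (c : G) (a : X.cat.Ob) : FreeOb.of (c • a) = c • FreeOb.of a := by
  rw [FreeOb.of, FreeOb.of, FreeOb.smul_mk, Word.smul, O.one_fixed]
  rfl

/-- γ(o; 1, …, 1) is o up to `unitBlocksEquiv`. Hence every word is an operation applied to letters,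
and strict maps are determined on objects by the letters. -/
theorem freeAct_of {n : ℕ} (o : (O.obj n).Ob) (a : Fin n → X.cat.Ob) :
    X.freeAct o (fun i => FreeOb.of (a i)) = FreeOb.mk ⟨n, o, a⟩ := by
  refine (X.freeAct_mk o fun i => ⟨1, O.one, fun _ => a i⟩).trans ?_
  refine Eq.trans ?_ (FreeOb.mk_perm (unitBlocksEquiv n) o a)
  refine congrArg FreeOb.mk (Sigma.ext rfl (heq_of_eq (Prod.ext (O.gam_one_right_obj n o) ?_)))
  exact funext fun j => congrArg a (blk_unitBlocks n j)

theorem ev_freeAct_of {n : ℕ} (o : (O.obj n).Ob) (a : Fin n → X.cat.Ob) :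
    X.ev (X.freeAct o fun i => FreeOb.of (a i)) = (X.theta n).obj (o, a) := by
  rw [freeAct_of, ev_mk]

/-- This is the second half of axiom (v): on letters the comparison with X is strict. -/
theorem evIso_of {n : ℕ} (o : (O.obj n).Ob) (a : Fin n → X.cat.Ob) :
    X.evIso o (fun i => FreeOb.of (a i)) = X.cat.idt ((X.theta n).obj (o, a)) :=
  (X.evIso_mk o fun i => ⟨1, O.one, fun _ => a i⟩).trans (X.phi_one_right n o a)

/-- Words with a nullary operation are objects. -/
theorem freeAct_of_zero (o : (O.obj 0).Ob) (a : Fin 0 → X.cat.Ob) :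
    X.freeAct o (fun i => FreeOb.of (a i)) = FreeOb.of ((X.theta 0).obj (o, a)) := by
  -- A nullary operation is inserted into the unit operation, so the single letter θ₀(o; a) may be
  -- deleted. This identification makes ζ₀ of the unit an identity.
  have h := FreeOb.sound (Word.Rel.unit (X := X) (fun _ : Fin 1 => 0) O.one (fun _ => o)
    (fun _ => a) ⟨fun _ => Or.inr rfl, fun _ _ _ _ => Subsingleton.elim _ _⟩)
  rw [freeAct_of, FreeOb.of, ← h, ← FreeOb.mk_perm (oneBlockEquiv 0) o a]
  refine congrArg FreeOb.mk (Sigma.ext rfl (heq_of_eq (Prod.ext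
    (O.gam_one_left_obj 0 o).symm ?_)))
  exact funext fun j => (oneBlockEquiv 0 j).elim0

variable {X} in
/-- A morphism between objects as a morphism between words. -/
def unitHom (f : X.cat.Mor) : PullMor X.cat X.ev :=
  ⟨FreeOb.of (X.cat.src f), FreeOb.of (X.cat.tgt f), f, (X.ev_of _).symm, (X.ev_of _).symm⟩

/-- The inclusion functor into the strictification. -/
noncomputable def unitFn : GFunctor X.cat X.strCat where
  obj a := FreeOb.of a
  mor f := unitHom f
  src_mor _ := rfl
  tgt_mor _ := rfl
  mor_idt a := PullMor.ext (congrArg FreeOb.of (X.cat.src_idt a))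
    (congrArg FreeOb.of (X.cat.tgt_idt a)) (congrArg X.cat.idt (X.ev_of a).symm)
  mor_comp f g h := PullMor.ext (congrArg FreeOb.of (X.cat.src_comp f g h))
    (congrArg FreeOb.of (X.cat.tgt_comp f g h)) (X.cat.comp_eq_mul f g h)
  obj_smul c a := X.of_smul c a
  mor_smul c f := PullMor.ext ((congrArg FreeOb.of (X.cat.src_smul c f)).trans (X.of_smul c _))
    ((congrArg FreeOb.of (X.cat.tgt_smul c f)).trans (X.of_smul c _)) rfl

-- On letters the conjugating isomorphisms are identities by `evIso_of`, so only θ is left.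
variable {X} in
theorem strHom_unitHom {n : ℕ} (o : (O.obj n).Mor) (f : Fin n → X.cat.Mor) :
    strHom o (fun i => (unitHom (f i) : X.strCat.Mor)) = (X.theta n).mor (o, f) := by
  have hs : (X.theta n).obj ((O.obj n).src o, fun i => X.cat.src (f i)) =
    X.cat.src ((X.theta n).mor (o, f)) := ((X.theta n).src_mor (o, f)).symm
  have ht : (X.theta n).obj ((O.obj n).tgt o, fun i => X.cat.tgt (f i)) =
    X.cat.tgt ((X.theta n).mor (o, f)) := ((X.theta n).tgt_mor (o, f)).symm
  refine strHom_eq _ _ (hs.symm.trans (X.ev_freeAct_of _ _).symm) ?_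
  dsimp only [unitHom]
  rw [X.evIso_of _ fun i => X.cat.src (f i), X.evIso_of _ fun i => X.cat.tgt (f i),
    X.cat.mul_idt ht.symm, X.cat.idt_mul hs.symm]

/-- The comparison between an operation on words with the unit operation and the word of the
result. -/
noncomputable def unitIso {n : ℕ} (o : (O.obj n).Ob) (a : Fin n → X.cat.Ob) :
    PullMor X.cat X.ev :=
  ⟨X.freeAct o (fun i => FreeOb.of (a i)), FreeOb.of ((X.theta n).obj (o, a)),
    X.cat.idt ((X.theta n).obj (o, a)), by rw [GCat.src_idt, ev_freeAct_of],
    by rw [GCat.tgt_idt, ev_of]⟩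

/-- θ of identities is an identity, so only the conjugating isomorphisms count. At the source, which
is built from words, `evIso` is φ; at the target, which is built from letters, it is an identity.
The inverse of φ remains. -/
theorem strHom_unitIso {n : ℕ} (m : Fin n → ℕ) (o : (O.obj n).Ob) (x : ∀ r, (O.obj (m r)).Ob)
    (a : ∀ r, Fin (m r) → X.cat.Ob) :
    strHom ((O.obj n).idt o) (fun r => (X.unitIso (x r) (a r) : X.strCat.Mor)) =
      X.cat.inv ((X.phi m).app (o, fun r => (x r, a r))) := by
  have hI := (X.phi_invertible m).isIso_app (o, fun r => (x r, a r))
  have e : X.evIso o (fun r => X.freeAct (x r) fun i => FreeOb.of (a r i)) =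
      (X.phi m).app (o, fun r => (x r, a r)) := by
    simp only [freeAct_of]
    exact X.evIso_mk o fun r => ⟨m r, x r, a r⟩
  refine strHom_eq _ _ ?_ ?_
  · dsimp only [unitIso]
    rw [hI.src_inv, GCat.src_idt, ← e, tgt_evIso]
  · dsimp only [unitIso]
    rw [GCat.src_idt, GCat.tgt_idt, e, hI.mul_inv, X.evIso_of o, theta_mor_idt,
      X.cat.mul_idt (by simp), UTrans.src_app]
    rfl

/-- The unit of the strictification as a pseudomorphism. -/
noncomputable def unitMor : X ⟶ X.str.alg where
  fn := X.unitFn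
  zeta n :=
    { app := fun z => X.unitIso z.1 z.2
      src_app := fun z => rfl
      tgt_app := fun z => rfl
      naturality := fun f => by
        refine PullMor.ext rfl (congrArg FreeOb.of ((X.theta n).tgt_mor f).symm) ?_
        refine (X.cat.mul_idt ?_).trans ((strHom_unitHom f.1 f.2).trans (X.cat.idt_mul ?_).symm)
        · exact (congrArg X.cat.tgt (strHom_unitHom f.1 f.2)).trans ((X.theta n).tgt_mor f)
        · exact (X.theta n).src_mor f
      app_smul := fun c z => by
        refine PullMor.ext ?_ ((congrArg FreeOb.of ((X.theta n).obj_smul c z)).trans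
          (X.of_smul c _)) ((congrArg X.cat.idt ((X.theta n).obj_smul c z)).trans
            (X.cat.idt_smul c _))
        refine Eq.trans ?_ (X.freeAct_smul c z.1 fun i => FreeOb.of (z.2 i))
        exact congrArg (X.freeAct (c • z.1)) (funext fun i => X.of_smul c (z.2 i)) }
  zeta_invertible n := GTrans.isInvertible_of_isIso _ fun z =>
    GCat.pull_isIso (ht := X.ev_smul) (GCat.isIso_idt _)
  zeta_zero z := PullMor.ext (X.freeAct_of_zero z.1 z.2) rfl (congrArg X.cat.idt (X.ev_of _).symm)
  zeta_one a := by
    have h := X.theta_one_obj a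
    refine PullMor.ext (X.freeAct_one fun i => FreeOb.of (a i)) (congrArg FreeOb.of h)
      (congrArg X.cat.idt (h.trans (X.ev_of _).symm))
  zeta_equivariant e o a := PullMor.ext (X.freeAct_act e o fun i => FreeOb.of (a i))
    (congrArg FreeOb.of (X.theta_act_obj e o a)) (congrArg X.cat.idt (X.theta_act_obj e o a))
  zeta_phi {n} m o x a := by
    have hI := (X.phi_invertible m).isIso_app (o, fun r => (x r, a r))
    have ht := (X.phi m).tgt_app (o, fun r => (x r, a r))
    have hs := (X.phi m).src_app (o, fun r => (x r, a r))
    refine PullMor.ext ?_ (congrArg FreeOb.of ht) ?_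
    · exact congrArg (fun z => X.freeAct z fun r => X.freeAct (x r) fun i => FreeOb.of (a r i))
        ((O.obj n).src_idt o)
    · have hev : X.ev (X.freeAct o fun r => X.freeAct (x r) fun i => FreeOb.of (a r i)) =
          (X.theta _).obj ((O.gam m).obj (o, x), flat a) := by
        rw [freeAct_gam]
        exact X.ev_freeAct_of _ (flat a)
      -- The first factor is the inverse of φ and the last one, the image of φ under the unit, is φ
      -- itself; they cancel. The other side of the equation consists of identities.
      have e₁ := X.strHom_unitIso m o x a
      have e₂ := X.cat.mul_idt (hI.tgt_inv.trans hs)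
      refine (congrArg (fun z => X.cat.mul (X.cat.mul z _) _) e₁).trans ?_
      refine (congrArg (fun z => X.cat.mul z _) e₂).trans (hI.inv_mul.trans ?_)
      refine (congrArg X.cat.idt ht).trans (X.cat.idt_mul ?_).symm
      exact (X.cat.src_idt _).trans hev.symm

/-! ### The unit is an equivalence -/

/-- The value of a letter is θ₁(1; a) = a, and both contributions to ζ are identities on letters, so
the composite is the identity on the nose. -/
theorem unitMor_comp_evMor : X.unitMor ≫ X.evMor = 𝟙 X := by
  refine PsMor.ext' (GFunctor.ext' X.ev_of fun _ => rfl) fun n z => ?_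
  refine (X.cat.comp_eq_mul _ _ _).trans ?_
  refine (congrArg (X.cat.mul · _) (X.evIso_of z.1 z.2)).trans (X.cat.idt_mul ?_)
  exact X.cat.src_idt _

/-- The comparison between the word of the value of a word and the word. -/
noncomputable def counitHom (x : X.FreeOb) : PullMor X.cat X.ev :=
  ⟨FreeOb.of (X.ev x), x, X.cat.idt (X.ev x), by simp, by simp⟩

/-- The morphisms `counitHom` lie over identities and the conjugation at the source is trivial on
letters, so only the conjugation at the target survives. This yields the compatibility of
`counitCell` with ζ. -/
theorem strHom_counitHom {n : ℕ} (o : (O.obj n).Ob) (x : Fin n → X.FreeOb) :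
    strHom ((O.obj n).idt o) (fun i => (X.counitHom (x i) : X.strCat.Mor)) = X.evIso o x := by
  refine strHom_eq _ _ ?_ ?_
  · dsimp only [counitHom]
    rw [GCat.src_idt, ev_freeAct_of, src_evIso]
  · dsimp only [counitHom]
    rw [GCat.src_idt, GCat.tgt_idt, X.evIso_of o, theta_mor_idt]

/-- The words of the values of words are naturally isomorphic to the words. -/
noncomputable def counitCell : X.evMor ≫ X.unitMor ⟶ 𝟙 X.str.alg where
  app := X.counitHom
  src_app _ := rfl
  tgt_app _ := rfl
  naturality f := by
    refine PullMor.ext (congrArg FreeOb.of f.src_hom) rfl ?_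
    exact (X.cat.mul_idt f.tgt_hom).trans (X.cat.idt_mul f.src_hom).symm
  app_smul c x := PullMor.ext ((congrArg FreeOb.of (X.ev_smul c x)).trans (X.of_smul c _)) rfl
    ((congrArg X.cat.idt (X.ev_smul c x)).trans (X.cat.idt_smul c _))
  compat n o x := by
    refine PullMor.ext (congrArg (fun z => X.freeAct z fun i => FreeOb.of (X.ev (x i)))
      ((O.obj n).src_idt o)) rfl ?_
    refine (X.cat.mul_idt ?_).trans ((X.strHom_counitHom o x).trans ?_)
    · exact (congrArg X.cat.tgt (X.strHom_counitHom o x)).trans (X.tgt_evIso o x)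
    · refine Eq.trans ?_ (X.cat.mul_idt ?_).symm
      · exact (X.cat.idt_mul (X.src_evIso o x)).symm
      · exact (congrArg X.cat.tgt (X.cat.idt_mul (X.src_evIso o x))).trans (X.tgt_evIso o x)

/-- The invertible 2-cell between the word of the value of a word and the word. -/
noncomputable def counitIso : X.evMor ≫ X.unitMor ≅ 𝟙 X.str.alg :=
  AlgCell.toIso X.counitCell fun _ => GCat.pull_isIso (ht := X.ev_smul) (GCat.isIso_idt _)

/-- The unit of the strictification is an adjoint equivalence. -/
noncomputable def unitEquivalence : Bicategory.Equivalence X X.str.alg :=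
  -- No triangle identity has to be verified: the counit is adjusted, while the 1-cell stays
  -- `unitMor`.
  Equivalence.mkOfAdjointifyCounit (eqToIso X.unitMor_comp_evMor.symm) X.counitIso

end PsAlg

end

section

variable {O : Operad.{u, u} G}

/-! ### The value of a pseudomorphism at words -/

namespace PsMor

variable {X Y : PsAlg O} (f : PsMor X Y)

theorem zeta_phi_mul {n : ℕ} (m : Fin n → ℕ) (o : (O.obj n).Ob) (x : ∀ r, (O.obj (m r)).Ob)
    (a : ∀ r, Fin (m r) → X.cat.Ob) :
    Y.cat.mul
      (Y.cat.mul
        ((Y.theta n).mor ((O.obj n).idt o, fun r => (f.zeta (m r)).app (x r, a r)))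
        ((f.zeta n).app (o, fun r => (X.theta (m r)).obj (x r, a r))))
      (f.fn.mor ((X.phi m).app (o, fun r => (x r, a r)))) =
    Y.cat.mul
      ((Y.phi m).app (o, fun r => (x r, fun s => f.fn.obj (a r s))))
      ((f.zeta (∑ r, m r)).app ((O.gam m).obj (o, x), flat a)) := by
  have := f.zeta_phi m o x a
  rwa [Y.cat.comp_eq_mul, Y.cat.comp_eq_mul, Y.cat.comp_eq_mul] at this

/-- Equivariance reduces this to the condition on ζ₁ at the operadic unit. -/
theorem zeta_isOne {n : ℕ} (x : (O.obj n).Ob) (a : Fin n → X.cat.Ob) (h : O.IsOne x) :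
    (f.zeta n).app (x, a) = Y.cat.idt (f.fn.obj ((X.theta n).obj (x, a))) := by
  obtain ⟨e, rfl⟩ := h
  obtain ⟨b, rfl⟩ : ∃ b : Fin 1 → X.cat.Ob, a = fun i => b (e i) :=
    ⟨fun i => a (e.symm i), by simp⟩
  rw [f.zeta_equivariant, f.zeta_one, X.theta_act_obj, X.theta_one_obj]

theorem zeta_nullary {n : ℕ} (x : (O.obj n).Ob) (a : Fin n → X.cat.Ob) (h : n = 0) :
    (f.zeta n).app (x, a) = Y.cat.idt (f.fn.obj ((X.theta n).obj (x, a))) := by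
  subst h
  exact f.zeta_zero _

/-- `ζ` depends only on the class of a word. -/
theorem zeta_eq_of_rel {P : Prop} {r s : X.Word} (h : PsAlg.Word.Rel P r s) :
    (f.zeta r.1).app r.2 = (f.zeta s.1).app s.2 := by
  obtain ⟨m, e, x, a, h₁, -, h₃, h₄, h₅⟩ := h
  have hr : r.2 = ((O.act e).obj ((O.gam m).obj (s.2.1, x)), fun j => flat a (e j)) :=
    Prod.ext h₃ (funext h₄)
  have hs : s.2 = (s.2.1, fun i => (X.theta (m i)).obj (x i, a i)) := Prod.ext rfl (funext h₅)
  rw [hr, f.zeta_equivariant e, hs]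
  -- By the conditions on ζ₀ and ζ₁, ζ is an identity at the inserted operations. Both φ and ψ are
  -- identities there too, so the compatibility with φ reduces to the claim.
  have hz : ∀ i, (f.zeta (m i)).app (x i, a i) =
      Y.cat.idt (f.fn.obj ((X.theta (m i)).obj (x i, a i))) := fun i =>
    (h₁.1 i).elim (f.zeta_isOne _ _) (f.zeta_nullary _ _)
  have key := f.zeta_phi_mul m s.2.1 x a
  simp only [hz] at key
  have hs' := (f.zeta (∑ i, m i)).src_app ((O.gam m).obj (s.2.1, x), flat a)
  have hφ := Y.phi_isNearUnit m s.2.1 x (fun i s => f.fn.obj (a i s)) h₁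
  rw [theta_mor_idt, X.phi_isNearUnit m _ x a h₁, hφ, f.fn.mor_idt, GCat.idt_mul, GCat.mul_idt,
    GCat.idt_mul] at key
  · exact key.symm
  · rw [hs']
    exact Y.theta_gam_of_phi m _ x (fun i s => f.fn.obj (a i s)) hφ
  · rw [UTrans.tgt_app]; rfl
  · rw [UTrans.src_app]; rfl

/-- The extension of `ζ` to classes of words. -/
def freeZeta : X.FreeOb → Y.cat.Mor :=
  Quot.lift (fun r => (f.zeta r.1).app r.2) fun _ _ h => f.zeta_eq_of_rel h

theorem freeZeta_mk (r : X.Word) : f.freeZeta (PsAlg.FreeOb.mk r) = (f.zeta r.1).app r.2 := rfl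

theorem freeZeta_of (a : X.cat.Ob) :
    f.freeZeta (PsAlg.FreeOb.of a) = Y.cat.idt (f.fn.obj a) := f.zeta_one fun _ => a

@[simp]
theorem tgt_freeZeta (x : X.FreeOb) : Y.cat.tgt (f.freeZeta x) = f.fn.obj (X.ev x) := by
  obtain ⟨r, rfl⟩ := x.exists_rep
  exact (f.zeta r.1).tgt_app r.2

theorem isIso_freeZeta (x : X.FreeOb) : Y.cat.IsIso (f.freeZeta x) := by
  obtain ⟨r, rfl⟩ := x.exists_rep
  exact (f.zeta_invertible r.1).isIso_app r.2

theorem freeZeta_smul (c : G) (x : X.FreeOb) : f.freeZeta (c • x) = c • f.freeZeta x := by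
  obtain ⟨r, rfl⟩ := x.exists_rep
  exact (f.zeta r.1).app_smul c r.2

/-- The compatibility of ζ with φ and ψ, in which ψ is an identity. It expresses ζ at a substituted
word through ζ at its parts. -/
theorem freeZeta_freeAct (hY : Y.IsStrict) {n : ℕ} (o : (O.obj n).Ob) (x : Fin n → X.FreeOb) :
    f.freeZeta (X.freeAct o x) =
      Y.cat.mul
        (Y.cat.mul ((Y.theta n).mor ((O.obj n).idt o, fun i => f.freeZeta (x i)))
          ((f.zeta n).app (o, fun i => X.ev (x i))))
        (f.fn.mor (X.evIso o x)) := by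
  obtain ⟨r, rfl⟩ := PsAlg.FreeOb.exists_reps x
  rw [X.freeAct_mk, X.evIso_mk]
  have key := f.zeta_phi_mul (fun i => (r i).1) o (fun i => (r i).2.1) (fun i => (r i).2.2)
  have h := hY (fun i => (r i).1) (o, fun i => ((r i).2.1, fun s => f.fn.obj ((r i).2.2 s)))
  rw [h, GCat.idt_mul] at key
  · exact key.symm
  · have hφ := Y.theta_gam_of_phi (fun i => (r i).1) o (fun i => (r i).2.1)
      (fun i s => f.fn.obj ((r i).2.2 s)) h
    rw [UTrans.src_app]
    exact hφ

/-! ### The extension of a pseudomorphism to the strictification -/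

/-- The extension of a pseudomorphism to morphisms of words. -/
noncomputable def liftHom (g : PullMor X.cat X.ev) : Y.cat.Mor :=
  Y.cat.mul (Y.cat.mul (f.freeZeta g.dom) (f.fn.mor g.hom)) (Y.cat.inv (f.freeZeta g.cod))

@[simp]
theorem src_liftHom (g : PullMor X.cat X.ev) :
    Y.cat.src (f.liftHom g) = Y.cat.src (f.freeZeta g.dom) := by
  simp [liftHom]

theorem freeZeta_comp_mor (g : PullMor X.cat X.ev) :
    Y.cat.tgt (f.freeZeta g.dom) = Y.cat.src (f.fn.mor g.hom) := by simp

theorem tgt_mul_mor (g : PullMor X.cat X.ev) :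
    Y.cat.tgt (Y.cat.mul (f.freeZeta g.dom) (f.fn.mor g.hom)) =
      Y.cat.tgt (f.freeZeta g.cod) := by
  rw [Y.cat.tgt_mul (f.freeZeta_comp_mor g)]; simp

@[simp]
theorem tgt_liftHom (g : PullMor X.cat X.ev) :
    Y.cat.tgt (f.liftHom g) = Y.cat.src (f.freeZeta g.cod) := by
  have h := f.isIso_freeZeta g.cod
  rw [liftHom, Y.cat.tgt_mul ((f.tgt_mul_mor g).trans h.src_inv.symm), h.tgt_inv]

/-- The conjugate is the only morphism that completes the naturality square of ζ; this plays the
role of `strHom_eq`. -/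
theorem liftHom_eq (g : PullMor X.cat X.ev) {k : Y.cat.Mor}
    (hk : Y.cat.tgt k = Y.cat.src (f.freeZeta g.cod))
    (h : Y.cat.mul (f.freeZeta g.dom) (f.fn.mor g.hom) = Y.cat.mul k (f.freeZeta g.cod)) :
    f.liftHom g = k :=
  ((f.isIso_freeZeta g.cod).mul_inv_eq_iff (f.tgt_mul_mor g) hk).mpr h

theorem liftHom_mul (g : PullMor X.cat X.ev) :
    Y.cat.mul (f.liftHom g) (f.freeZeta g.cod) =
      Y.cat.mul (f.freeZeta g.dom) (f.fn.mor g.hom) :=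
  (((f.isIso_freeZeta g.cod).mul_inv_eq_iff (f.tgt_mul_mor g) (f.tgt_liftHom g)).mp rfl).symm

/-- The extension of a pseudomorphism to a functor on the strictification. -/
noncomputable def liftFn : GFunctor X.strCat Y.cat where
  -- The source of ζ at (o; a) is ξ(o; f(a)), the value forced on a strict extension; in this form
  -- it is already known to depend only on the class.
  obj x := Y.cat.src (f.freeZeta x)
  mor g := f.liftHom g
  src_mor g := f.src_liftHom g
  tgt_mor g := f.tgt_liftHom g
  mor_idt x := by
    refine f.liftHom_eq _ (by simp) ?_
    rw [f.fn.mor_idt, Y.cat.mul_idt (by simp), Y.cat.idt_mul rfl]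
  mor_comp g h e := by
    have e' : g.cod = h.dom := e
    have e₁ : Y.cat.tgt (f.liftHom g) = Y.cat.src (f.liftHom h) := by simp [e']
    rw [Y.cat.comp_eq_mul]
    refine f.liftHom_eq _ (by rw [Y.cat.tgt_mul e₁]; simp) ?_
    rw [Y.cat.mul_assoc e₁ (by simp), f.liftHom_mul, ← e',
      ← Y.cat.mul_assoc (by simp) (by simp [e']), f.liftHom_mul,
      Y.cat.mul_assoc (by simp) (by simp [e']), ← f.fn.mor_mul (by simp [e'])]
  obj_smul c x := by rw [f.freeZeta_smul, GCat.src_smul]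
  mor_smul c g := by
    have h := congrArg (c • ·) (f.liftHom_mul g)
    rw [Y.cat.smul_mul c (by simp), Y.cat.smul_mul c (by simp), ← f.freeZeta_smul,
      ← f.freeZeta_smul, ← f.fn.mor_smul] at h
    refine f.liftHom_eq _ ?_ h.symm
    rw [GCat.tgt_smul, tgt_liftHom, ← GCat.src_smul, ← f.freeZeta_smul]
    rfl

end PsMor

/-- Three adjacent squares with horizontal sides `d`, `z`, `e` and `c`, `z'`, `e'`. These sides will
be the factorisations of ζ at substituted words from `freeZeta_freeAct`. -/
theorem GCat.paste_ladder (A : GCat.{u, v} G) {d z e s t e' q z' l c : A.Mor}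
    (h₁ : A.mul e s = A.mul t e') (h₂ : A.mul q z' = A.mul z t) (h₃ : A.mul d q = A.mul l c)
    (dz : A.tgt d = A.src z) (ze : A.tgt z = A.src e) (es : A.tgt e = A.src s)
    (zt : A.tgt z = A.src t) (te' : A.tgt t = A.src e') (dq : A.tgt d = A.src q)
    (qz' : A.tgt q = A.src z') (ze' : A.tgt z' = A.src e') (lc : A.tgt l = A.src c)
    (cz' : A.tgt c = A.src z') :
    A.mul (A.mul (A.mul d z) e) s = A.mul l (A.mul (A.mul c z') e') := by
  rw [A.mul_assoc (by rw [A.tgt_mul dz, ze]) es, h₁, A.mul_assoc dz (by rw [A.src_mul, zt]),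
    ← A.mul_assoc zt te', ← h₂, A.mul_assoc qz' ze', ← A.mul_assoc dq (by rw [A.src_mul, qz']),
    h₃, A.mul_assoc lc (by rw [A.src_mul, cz']), A.mul_assoc cz' ze']

theorem PsMor.zeta_natural {X Y : PsAlg O} (f : PsMor X Y) {n : ℕ} (o : (O.obj n).Mor)
    (g : Fin n → X.strCat.Mor) :
    Y.cat.mul ((Y.theta n).mor (o, fun i => f.fn.mor (g i).hom))
        ((f.zeta n).app ((O.obj n).tgt o, fun i => X.ev (g i).cod)) =
      Y.cat.mul ((f.zeta n).app ((O.obj n).src o, fun i => X.ev (g i).dom))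
        (f.fn.mor ((X.theta n).mor (o, fun i => (g i).hom))) :=
  (f.zeta n).naturality_mul (f := (o, fun i => (g i).hom))
    (Prod.ext rfl (funext fun i => (g i).src_hom)) (Prod.ext rfl (funext fun i => (g i).tgt_hom))

/-! ### The universal property of the unit -/

namespace StrictAlg

variable {X : PsAlg O} {T : StrictAlg O} (f : X ⟶ T.alg)

/-- Both sides are the source of ζ at the substituted word, as computed by `freeZeta_freeAct`. -/
theorem liftFn_obj_freeAct {n : ℕ} (o : (O.obj n).Ob) (x : Fin n → X.FreeOb) :
    (T.alg.theta n).obj (o, fun i => (PsMor.liftFn f).obj (x i)) =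
      (PsMor.liftFn f).obj (X.freeAct o x) := by
  have h := congrArg T.alg.cat.src (PsMor.freeZeta_freeAct f T.isStrict o x)
  rw [GCat.src_mul, GCat.src_mul, T.alg.src_theta_idt_mor] at h
  exact h.symm

/-- ζ at a substituted word has three factors. The squares between the factors at the source and at
the target are θ of the squares of `liftHom`, naturality of ζ, and the image under f of the square
of `strHom`. -/
theorem liftFn_mor_strTheta {n : ℕ} (o : (O.obj n).Mor) (g : Fin n → X.strCat.Mor) :
    (T.alg.theta n).mor (o, fun i => (PsMor.liftFn f).mor (g i)) =
      (PsMor.liftFn f).mor ((X.strTheta n).mor (o, g)) := by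
  have hsq := T.alg.theta_square o (f := fun i => PsMor.freeZeta f (g i).dom)
    (g := fun i => (PsMor.fn f).mor (g i).hom) (h := fun i => PsMor.liftHom f (g i))
    (k := fun i => PsMor.freeZeta f (g i).cod) (fun i => by simp) (fun i => by simp)
    (fun i => (PsMor.liftHom_mul f (g i)).symm)
  have hnat := PsMor.zeta_natural f o g
  have hst := congrArg (PsMor.fn f).mor (PsAlg.evIso_mul_strHom o g)
  rw [(PsMor.fn f).mor_mul (by rw [X.tgt_evIso, PsAlg.src_strHom]),
    (PsMor.fn f).mor_mul (by rw [PsAlg.tgt_theta_hom, X.src_evIso])] at hst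
  symm
  refine PsMor.liftHom_eq f _ ?_ ?_
  · rw [UFunctor.tgt_mor]
    refine Eq.trans ?_ (liftFn_obj_freeAct f ((O.obj n).tgt o) fun i => (g i).cod)
    exact congrArg (T.alg.theta n).obj (Prod.ext rfl (funext fun i => PsMor.tgt_liftHom f (g i)))
  · have hd := PsMor.freeZeta_freeAct f T.isStrict ((O.obj n).src o) fun i => (g i).dom
    have hc := PsMor.freeZeta_freeAct f T.isStrict ((O.obj n).tgt o) fun i => (g i).cod
    refine (congrArg (fun z => T.alg.cat.mul z _) hd).trans
      (Eq.trans ?_ (congrArg (T.alg.cat.mul _) hc).symm)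
    refine T.alg.cat.paste_ladder hst hnat hsq ?_ ?_ ?_ ?_ ?_ ?_ ?_ ?_ ?_ ?_
    · rw [T.alg.tgt_theta_idt_mor, UTrans.src_app]
      simp only [PsMor.tgt_freeZeta]
      rfl
    · rw [UTrans.tgt_app, UFunctor.src_mor, X.src_evIso]
      rfl
    · rw [UFunctor.tgt_mor, UFunctor.src_mor, X.tgt_evIso]
      exact congrArg (PsMor.fn f).obj (PsAlg.src_strHom o g).symm
    · rw [UTrans.tgt_app, UFunctor.src_mor, PsAlg.src_theta_hom]
      rfl
    · rw [UFunctor.tgt_mor, UFunctor.src_mor, X.src_evIso, PsAlg.tgt_theta_hom]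
    · rw [T.alg.tgt_theta_idt_mor, UFunctor.src_mor]
      exact congrArg (T.alg.theta n).obj (Prod.ext rfl (funext fun i => by simp))
    · rw [UFunctor.tgt_mor, UTrans.src_app]
      exact congrArg (T.alg.theta n).obj (Prod.ext rfl (funext fun i => by simp))
    · rw [UTrans.tgt_app, UFunctor.src_mor, X.src_evIso]
      rfl
    · rw [T.alg.src_theta_idt_mor, UFunctor.tgt_mor]
      exact congrArg (T.alg.theta n).obj
        (Prod.ext rfl (funext fun i => PsMor.tgt_liftHom f (g i)))
    · rw [T.alg.tgt_theta_idt_mor, UTrans.src_app]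
      simp only [PsMor.tgt_freeZeta]
      rfl

/-- The strict map from the strictification that extends a pseudomorphism. -/
noncomputable def lift : X.str ⟶ T :=
  StrictMor.ofFunctor (PsMor.liftFn f) fun _ => GFunctor.ext'
    (fun x => liftFn_obj_freeAct f x.1 x.2) (fun g => liftFn_mor_strTheta f g.1 g.2)

/-- On letters ζ is an identity, so the extension restricts to f. For the structure transformations:
`unitIso` lies over an identity, ζ is trivial at its target letter and is ζ(o, a) at its source
word, so conjugation returns ζ of f. -/
theorem unitMor_comp_lift : X.unitMor ≫ (lift f).mor = f := by
  refine PsMor.ext' (GFunctor.ext' (fun a => ?_) fun g => ?_) fun n z => ?_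
  · exact (congrArg T.alg.cat.src (PsMor.freeZeta_of f a)).trans (T.alg.cat.src_idt _)
  · refine PsMor.liftHom_eq f (PsAlg.unitHom g) ?_ ?_
    · dsimp only [PsAlg.unitHom]
      rw [PsMor.freeZeta_of, GCat.src_idt, UFunctor.tgt_mor]
    · dsimp only [PsAlg.unitHom]
      rw [PsMor.freeZeta_of, PsMor.freeZeta_of, T.alg.cat.mul_idt (by simp),
        T.alg.cat.idt_mul (by simp)]
  · refine (T.alg.cat.idt_comp' _ _ _).trans (PsMor.liftHom_eq f (X.unitIso z.1 z.2) ?_ ?_)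
    · dsimp only [PsAlg.unitIso]
      rw [PsMor.freeZeta_of, GCat.src_idt, UTrans.tgt_app]
      rfl
    · dsimp only [PsAlg.unitIso]
      rw [PsMor.freeZeta_of, X.freeAct_of, PsMor.freeZeta_mk, (PsMor.fn f).mor_idt]

/-- A strict map contributes only identities. Hence its values on the morphisms `unitIso` can be
read off from its restriction along the unit. -/
theorem unitMor_comp_zeta (g : X.str ⟶ T) (n : ℕ) (z : (actDom O X.cat n).Ob) :
    (PsMor.zeta (X.unitMor ≫ g.mor) n).app z =
      (PsMor.fn g.mor).mor (X.unitIso z.1 z.2 : X.strCat.Mor) := by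
  refine (T.alg.cat.comp_congr (g.isStrict n _) rfl _).trans (T.alg.cat.idt_comp' _ _ _)

/-- A functor on the strictification is determined by its values on the image of the unit and on
its structure isomorphisms. -/
theorem strCat_functor_ext {C : GCat.{u, u} G} {F F' : GFunctor X.strCat C}
    (hz : ∀ (n : ℕ) (z : (actDom O X.cat n).Ob),
      F.mor (X.unitIso z.1 z.2) = F'.mor (X.unitIso z.1 z.2))
    (hu : ∀ f : X.cat.Mor, F.mor (PsAlg.unitHom f) = F'.mor (PsAlg.unitHom f)) : F = F' := by
  refine GFunctor.ext' (fun x => ?_) fun p => ?_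
  · obtain ⟨⟨n, z⟩, rfl⟩ := x.exists_rep
    have e := congrArg C.src (hz n z)
    rw [UFunctor.src_mor, UFunctor.src_mor] at e
    rw [← X.freeAct_of]
    exact e
  · obtain ⟨⟨n, z⟩, hd⟩ := p.dom.exists_rep
    obtain ⟨⟨n', z'⟩, hc⟩ := p.cod.exists_rep
    rw [← X.freeAct_of] at hd hc
    have hs : X.cat.src p.hom = (X.theta n).obj z := by
      rw [p.src_hom, ← hd, X.ev_freeAct_of]
    have ht : X.cat.tgt p.hom = (X.theta n').obj z' := by
      rw [p.tgt_hom, ← hc, X.ev_freeAct_of]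
    have h₁ : X.strCat.tgt p = X.strCat.src (X.unitIso z'.1 z'.2) := hc.symm
    have h₂ : X.strCat.tgt (X.unitIso z.1 z.2) = X.strCat.src (PsAlg.unitHom p.hom) :=
      congrArg PsAlg.FreeOb.of hs.symm
    -- The morphisms `unitIso` join every word to the letter of its value and lie over identities,
    -- so `p` is conjugate to a morphism between letters.
    have sq : X.strCat.comp p (X.unitIso z'.1 z'.2) h₁ =
        X.strCat.comp (X.unitIso z.1 z.2) (PsAlg.unitHom p.hom) h₂ :=
      PullMor.ext hd.symm (congrArg PsAlg.FreeOb.of ht.symm)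
        ((X.cat.mul_idt ht).trans (X.cat.idt_mul hs).symm)
    have e := congrArg F.mor sq
    have e' := congrArg F'.mor sq
    rw [UFunctor.mor_comp, UFunctor.mor_comp, C.comp_eq_mul, C.comp_eq_mul, hz n' z', hz n z, hu] at e
    rw [UFunctor.mor_comp, UFunctor.mor_comp, C.comp_eq_mul, C.comp_eq_mul, ← e] at e'
    have hI : X.strCat.IsIso (X.unitIso z'.1 z'.2) :=
      GCat.pull_isIso (ht := X.ev_smul) (GCat.isIso_idt _)
    refine (hI.map F'.toUFunctor).cancel_right ?_ ?_ e'.symm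
    · rw [← hz, UFunctor.tgt_mor, UFunctor.src_mor, h₁]
    · rw [UFunctor.tgt_mor, UFunctor.src_mor, h₁]

/-- A transformation on the strictification is determined by its values on the image of the
unit. -/
theorem strCat_trans_ext {C : GCat.{u, u} G} {F F' : GFunctor X.strCat C} {s t : GTrans F F'}
    (h : ∀ a : X.cat.Ob, s.app (PsAlg.FreeOb.of a) = t.app (PsAlg.FreeOb.of a)) (x : X.FreeOb) :
    s.app x = t.app x := by
  -- Naturality along the isomorphism from the letter of the value to `x` reduces the component at
  -- `x` to the one at a letter.
  have e := s.naturality_mul (f := X.counitHom x) (a := PsAlg.FreeOb.of (X.ev x)) (b := x) rfl rfl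
  have e' := t.naturality_mul (f := X.counitHom x) (a := PsAlg.FreeOb.of (X.ev x)) (b := x) rfl rfl
  rw [h, ← e'] at e
  have hI : X.strCat.IsIso (X.counitHom x) :=
    GCat.pull_isIso (ht := X.ev_smul) (GCat.isIso_idt _)
  refine (hI.map F.toUFunctor).cancel_left ?_ ?_ e
  · rw [UFunctor.tgt_mor, UTrans.src_app]; rfl
  · rw [UFunctor.tgt_mor, UTrans.src_app]; rfl

/-- A strict map from the strictification is determined by its composite with the unit. -/
theorem hom_ext {g g' : X.str ⟶ T} (h : X.unitMor ≫ g.mor = X.unitMor ≫ g'.mor) : g = g' := by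
  have hfn : PsMor.fn g.mor = PsMor.fn g'.mor := by
    refine strCat_functor_ext (fun n z => ?_) fun f => ?_
    · exact (unitMor_comp_zeta g n z).symm.trans
        ((congrArg (fun k : X ⟶ T.alg => (PsMor.zeta k n).app z) h).trans (unitMor_comp_zeta g' n z))
    · exact congrArg (fun k : X ⟶ T.alg => (PsMor.fn k).mor f) h
  refine StrictMor.ext' (PsMor.ext' hfn fun n z => ?_)
  rw [g.isStrict, g'.isStrict, hfn]

/-! ### The extension of 2-cells to the strictification -/

theorem counitHom_of (a : X.cat.Ob) :
    (X.counitHom (PsAlg.FreeOb.of a) : X.strCat.Mor) = X.strCat.idt (PsAlg.FreeOb.of a) :=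
  PullMor.ext (congrArg PsAlg.FreeOb.of (X.ev_of a)) rfl rfl

/-- The inverse 2-cell comes from an existence statement, so its components are reached through
`Iso.hom_inv_id`. -/
theorem counitIso_inv_app_of (a : X.cat.Ob) :
    (AlgCell.toGTrans X.counitIso.inv).app (PsAlg.FreeOb.of a : X.FreeOb) =
      X.strCat.idt (PsAlg.FreeOb.of a) := by
  have h := AlgCell.comp_app X.counitIso.hom X.counitIso.inv (PsAlg.FreeOb.of a : X.FreeOb)
  rw [Iso.hom_inv_id] at h
  have h₁ : (AlgCell.toGTrans X.counitIso.hom).app (PsAlg.FreeOb.of a : X.FreeOb) =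
    X.strCat.idt (PsAlg.FreeOb.of a) := counitHom_of a
  have h₂ : X.strCat.src ((AlgCell.toGTrans X.counitIso.inv).app (PsAlg.FreeOb.of a : X.FreeOb)) =
    PsAlg.FreeOb.of a := (AlgCell.toGTrans X.counitIso.inv).src_app _
  rw [h₁] at h
  refine ((X.strCat.idt_mul h₂).symm.trans h.symm).trans ?_
  exact congrArg (fun z => X.strCat.idt (PsAlg.FreeOb.of z)) (X.ev_of a)

/-- The extension of a 2-cell along the unit. -/
noncomputable def liftCell {g g' : X.str ⟶ T} (s : X.unitMor ≫ g.mor ⟶ X.unitMor ≫ g'.mor) :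
    g ⟶ g' where
  -- Replace `g` by its composite with `evMor ≫ unitMor`, apply `s` in the middle and return: this
  -- is fullness of restriction along an equivalence.
  cell := (λ_ g.mor).inv ≫ X.counitIso.inv ▷ g.mor ≫ (α_ _ _ _).hom ≫ X.evMor ◁ s ≫
    (α_ _ _ _).inv ≫ X.counitIso.hom ▷ g'.mor ≫ (λ_ g'.mor).hom

/-- A 2-cell between strict maps from the strictification is determined by its values on the image
of the unit. -/
theorem cell_ext {g g' : X.str ⟶ T} {s t : g ⟶ g'}
    (h : ∀ a, (AlgCell.toGTrans s.cell).app (PsAlg.FreeOb.of a : X.FreeOb) =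
      (AlgCell.toGTrans t.cell).app (PsAlg.FreeOb.of a : X.FreeOb)) : s = t := by
  exact StrictCell.ext (AlgCell.ext' (strCat_trans_ext h))

/-- At letters `counitHom` is an identity, and associators and unitors have identity components
everywhere. Only `s` is left, so the 2-cell does extend `s`. -/
theorem liftCell_app_of {g g' : X.str ⟶ T} (s : X.unitMor ≫ g.mor ⟶ X.unitMor ≫ g'.mor)
    (a : X.cat.Ob) :
    (AlgCell.toGTrans (liftCell s).cell).app (PsAlg.FreeOb.of a : X.FreeOb) =
      (AlgCell.toGTrans s).app a := by
  change (AlgCell.toGTrans (liftCell s).cell).app ((PsMor.fn X.unitMor).obj a) = _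
  have h₁ : (AlgCell.toGTrans (X.counitIso.inv ▷ g.mor)).app ((PsMor.fn X.unitMor).obj a) =
      T.alg.cat.idt ((PsMor.fn g.mor).obj ((PsMor.fn X.unitMor).obj a)) :=
    (congrArg (PsMor.fn g.mor).mor (counitIso_inv_app_of a)).trans ((PsMor.fn g.mor).mor_idt _)
  have h₂ : (AlgCell.toGTrans (X.counitIso.hom ▷ g'.mor)).app ((PsMor.fn X.unitMor).obj a) =
      T.alg.cat.idt ((PsMor.fn g'.mor).obj ((PsMor.fn X.unitMor).obj a)) :=
    (congrArg (PsMor.fn g'.mor).mor (counitHom_of a)).trans ((PsMor.fn g'.mor).mor_idt _)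
  have h₃ : (AlgCell.toGTrans (X.evMor ◁ s)).app ((PsMor.fn X.unitMor).obj a) =
      (AlgCell.toGTrans s).app a :=
    congrArg (AlgCell.toGTrans s).app (X.ev_of a)
  have hs : T.alg.cat.src ((AlgCell.toGTrans s).app a) =
    (PsMor.fn g.mor).obj ((PsMor.fn X.unitMor).obj a) := (AlgCell.toGTrans s).src_app a
  have ht : T.alg.cat.tgt ((AlgCell.toGTrans s).app a) =
    (PsMor.fn g'.mor).obj ((PsMor.fn X.unitMor).obj a) := (AlgCell.toGTrans s).tgt_app a
  have l₁ : (AlgCell.toGTrans (λ_ g.mor).inv).app ((PsMor.fn X.unitMor).obj a) =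
      T.alg.cat.idt ((PsMor.fn g.mor).obj ((PsMor.fn X.unitMor).obj a)) :=
    PsAlg.eqToHom_app (PsAlg.id_comp_eq g.mor).symm _
  have l₂ : (AlgCell.toGTrans (λ_ g'.mor).hom).app ((PsMor.fn X.unitMor).obj a) =
      T.alg.cat.idt ((PsMor.fn g'.mor).obj ((PsMor.fn X.unitMor).obj a)) :=
    PsAlg.eqToHom_app (PsAlg.id_comp_eq g'.mor) _
  have hev : (PsMor.fn X.unitMor).obj ((PsMor.fn X.evMor).obj ((PsMor.fn X.unitMor).obj a)) =
    ((PsMor.fn X.unitMor).obj a) := congrArg PsAlg.FreeOb.of (X.ev_of a)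
  have a₁ : (AlgCell.toGTrans (α_ X.evMor X.unitMor g.mor).hom).app ((PsMor.fn X.unitMor).obj a) =
      T.alg.cat.idt ((PsMor.fn g.mor).obj ((PsMor.fn X.unitMor).obj a)) :=
    (PsAlg.eqToHom_app (PsAlg.assoc_eq X.evMor X.unitMor g.mor) _).trans
      (congrArg (fun z => T.alg.cat.idt ((PsMor.fn g.mor).obj z)) hev)
  have a₂ : (AlgCell.toGTrans (α_ X.evMor X.unitMor g'.mor).inv).app
      ((PsMor.fn X.unitMor).obj a) =
      T.alg.cat.idt ((PsMor.fn g'.mor).obj ((PsMor.fn X.unitMor).obj a)) :=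
    (PsAlg.eqToHom_app (PsAlg.assoc_eq X.evMor X.unitMor g'.mor).symm _).trans
      (congrArg (fun z => T.alg.cat.idt ((PsMor.fn g'.mor).obj z)) hev)
  simp only [liftCell, AlgCell.comp_app]
  rw [l₁, h₁, a₁, h₃, a₂, h₂, l₂]
  have i₁ := T.alg.cat.idt_mul (T.alg.cat.src_idt
    ((PsMor.fn g'.mor).obj ((PsMor.fn X.unitMor).obj a)))
  rw [i₁, i₁, T.alg.cat.mul_idt ht, T.alg.cat.idt_mul hs, T.alg.cat.idt_mul hs,
    T.alg.cat.idt_mul hs]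

end StrictAlg

end

section

variable {O : Operad.{u, u} G}

/-! ### The strictification 2-functor -/

namespace StrictAlg

/-- The strictification of a pseudomorphism. -/
noncomputable def strMap {X Y : PsAlg O} (f : X ⟶ Y) : X.str ⟶ Y.str := lift (f ≫ Y.unitMor)

theorem unitMor_comp_strMap {X Y : PsAlg O} (f : X ⟶ Y) :
    X.unitMor ≫ (strMap f).mor = f ≫ Y.unitMor := unitMor_comp_lift _

theorem strMap_obj_of {X Y : PsAlg O} (f : X ⟶ Y) (a : X.cat.Ob) :
    (PsMor.fn (strMap f).mor).obj (PsAlg.FreeOb.of a : X.FreeOb) =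
      (PsAlg.FreeOb.of ((PsMor.fn f).obj a) : Y.FreeOb) :=
  congrArg (fun k : X ⟶ Y.str.alg => (PsMor.fn k).obj a) (unitMor_comp_strMap f)

theorem strMap_mor_unitHom {X Y : PsAlg O} (f : X ⟶ Y) (g : X.cat.Mor) :
    (PsMor.fn (strMap f).mor).mor (PsAlg.unitHom g : X.strCat.Mor) =
      (PsAlg.unitHom ((PsMor.fn f).mor g) : Y.strCat.Mor) :=
  congrArg (fun k : X ⟶ Y.str.alg => (PsMor.fn k).mor g) (unitMor_comp_strMap f)

/-- The strictification of a 2-cell. -/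
noncomputable def strMap₂ {X Y : PsAlg O} {f g : X ⟶ Y} (s : f ⟶ g) : strMap f ⟶ strMap g :=
  liftCell (eqToHom (unitMor_comp_strMap f) ≫ s ▷ Y.unitMor ≫
    eqToHom (unitMor_comp_strMap g).symm)

theorem strMap₂_app_of {X Y : PsAlg O} {f g : X ⟶ Y} (s : f ⟶ g) (a : X.cat.Ob) :
    (AlgCell.toGTrans (strMap₂ s).cell).app (PsAlg.FreeOb.of a : X.FreeOb) =
      (PsAlg.unitHom ((AlgCell.toGTrans s).app a) : Y.strCat.Mor) :=
  (liftCell_app_of _ a).trans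
    (PsAlg.conj_app (unitMor_comp_strMap f) (s ▷ Y.unitMor) (unitMor_comp_strMap g).symm a)

/-- An `eqToHom` has identity components, so the transports in the laws of 2-functors vanish at each
object. -/
theorem conj_app {A B : StrictAlg O} {f f' g g' : A ⟶ B} (h : f = f') (s : f' ⟶ g') (h' : g' = g)
    (x : A.alg.cat.Ob) :
    (AlgCell.toGTrans (StrictCell.cell (eqToHom h ≫ s ≫ eqToHom h'))).app x =
      (AlgCell.toGTrans (StrictCell.cell s)).app x := by
  subst h; subst h'; simp

/-- By uniqueness of extensions, functoriality need only be tested after composition with the unit,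
where it follows from `unitMor_comp_strMap`. -/
theorem strMap_id (X : PsAlg O) : strMap (𝟙 X) = 𝟙 X.str :=
  hom_ext ((unitMor_comp_strMap _).trans
    ((PsAlg.id_comp_eq _).trans (PsAlg.comp_id_eq X.unitMor).symm))

theorem strMap_comp {X Y Z : PsAlg O} (f : X ⟶ Y) (g : Y ⟶ Z) :
    strMap (f ≫ g) = strMap f ≫ strMap g := by
  refine hom_ext ((unitMor_comp_strMap _).trans ?_)
  change (f ≫ g) ≫ Z.unitMor = X.unitMor ≫ (strMap f).mor ≫ (strMap g).mor
  rw [← PsAlg.assoc_eq X.unitMor, unitMor_comp_strMap, PsAlg.assoc_eq f Y.unitMor,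
    unitMor_comp_strMap, PsAlg.assoc_eq]

variable (O) in
/-- The strictification 2-functor. -/
noncomputable def strictification : StrictPseudofunctor (PsAlg O) (StrictAlg O) :=
  StrictPseudofunctor.mk''
    { obj := fun X => X.str
      map := fun f => strMap f
      map₂ := fun s => strMap₂ s
      -- All equations of 2-cells are tested on letters, where `strMap₂ s` is the image of the
      -- component of `s` under the unit.
      map₂_id := fun {X Y} f => cell_ext fun a => by
        rw [strMap₂_app_of]
        refine (Y.unitFn.mor_idt ((PsMor.fn f).obj a)).trans ?_
        exact congrArg Y.strCat.idt (strMap_obj_of f a).symm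
      map₂_comp := fun {X Y _ _ _} s t => cell_ext fun a => by
        rw [strMap₂_app_of]
        refine (Y.unitFn.mor_comp _ _ _).trans ((Y.strCat.comp_eq_mul _ _ _).trans ?_)
        exact (congrArg₂ Y.strCat.mul (strMap₂_app_of s a).symm (strMap₂_app_of t a).symm).trans
          (AlgCell.comp_app (strMap₂ s).cell (strMap₂ t).cell _).symm
      map_id := strMap_id
      map_comp := strMap_comp
      map₂_whisker_left := fun {X Y Z} f g g' s => cell_ext fun a => by
        rw [strMap₂_app_of]
        refine Eq.trans ?_ (conj_app (strMap_comp f g) (strMap f ◁ strMap₂ s)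
          (strMap_comp f g').symm _).symm
        refine (strMap₂_app_of s ((PsMor.fn f).obj a)).symm.trans ?_
        exact congrArg (AlgCell.toGTrans (strMap₂ s).cell).app (strMap_obj_of f a).symm
      map₂_whisker_right := fun {X Y Z f f'} s g => cell_ext fun a => by
        rw [strMap₂_app_of]
        refine Eq.trans ?_ (conj_app (strMap_comp f g) (strMap₂ s ▷ strMap g)
          (strMap_comp f' g).symm _).symm
        refine (strMap_mor_unitHom g ((AlgCell.toGTrans s).app a)).symm.trans ?_
        exact congrArg (PsMor.fn (strMap g).mor).mor (strMap₂_app_of s a).symm }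

/-! ### The 2-adjunction -/

/-- The evaluation of the strictification of a strict algebra. -/
noncomputable def counit (T : StrictAlg O) : T.alg.str ⟶ T := lift (𝟙 T.alg)

theorem unitMor_comp_counit (T : StrictAlg O) : T.alg.unitMor ≫ T.counit.mor = 𝟙 T.alg :=
  unitMor_comp_lift _

/-- Both sides restrict to `f` along the unit. As `f` is strict, both are strict maps, and
uniqueness applies. -/
theorem strMap_comp_counit {A B : StrictAlg O} (f : A ⟶ B) :
    strMap f.mor ≫ B.counit = A.counit ≫ f := by
  refine hom_ext ?_
  change A.alg.unitMor ≫ (strMap f.mor).mor ≫ B.counit.mor =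
    A.alg.unitMor ≫ A.counit.mor ≫ f.mor
  rw [← PsAlg.assoc_eq A.alg.unitMor, ← PsAlg.assoc_eq A.alg.unitMor, unitMor_comp_strMap,
    unitMor_comp_counit, PsAlg.assoc_eq, unitMor_comp_counit, PsAlg.id_comp_eq, PsAlg.comp_id_eq]

theorem comp_eqToHom_app {A B : PsAlg O} {f g g' : A ⟶ B} (s : f ⟶ g) (h : g = g')
    (x : A.cat.Ob) :
    (AlgCell.toGTrans (s ≫ eqToHom h)).app x = (AlgCell.toGTrans s).app x := by
  subst h; simp

theorem eqToHom_comp_app {A B : PsAlg O} {f f' g : A ⟶ B} (h : f = f') (s : f' ⟶ g)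
    (x : A.cat.Ob) :
    (AlgCell.toGTrans (eqToHom h ≫ s)).app x = (AlgCell.toGTrans s).app x := by
  subst h; simp

theorem cell_comp_eqToHom_app {A B : StrictAlg O} {f g g' : A ⟶ B} (s : f ⟶ g) (h : g = g')
    (x : A.alg.cat.Ob) :
    (AlgCell.toGTrans (StrictCell.cell (s ≫ eqToHom h))).app x =
      (AlgCell.toGTrans (StrictCell.cell s)).app x := by
  subst h; simp

theorem cell_eqToHom_comp_app {A B : StrictAlg O} {f f' g : A ⟶ B} (h : f = f') (s : f' ⟶ g)
    (x : A.alg.cat.Ob) :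
    (AlgCell.toGTrans (StrictCell.cell (eqToHom h ≫ s))).app x =
      (AlgCell.toGTrans (StrictCell.cell s)).app x := by
  subst h; simp

variable (O) in
/-- The strictification is left 2-adjoint to the inclusion. -/
noncomputable def strictificationAdjunction :
    TwoAdjunction (strictification O) (inclusion O) where
  unit :=
    { app := fun X => X.unitMor
      naturality := fun f => (unitMor_comp_strMap f).symm
      naturality₂ := fun {X Y f g} s => AlgCell.ext' fun a => by
        refine (comp_eqToHom_app (s ▷ Y.unitMor) (unitMor_comp_strMap g).symm a).trans ?_
        refine Eq.trans ?_ (eqToHom_comp_app (unitMor_comp_strMap f).symm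
          (X.unitMor ◁ (strMap₂ s).cell) a).symm
        exact (strMap₂_app_of s a).symm }
  counit :=
    { app := fun T => T.counit
      naturality := fun f => strMap_comp_counit f
      naturality₂ := fun {A B f g} s => cell_ext (X := A.alg) fun a => by
        refine (cell_comp_eqToHom_app (strMap₂ s.cell ▷ B.counit) (strMap_comp_counit g)
          (PsAlg.FreeOb.of a : A.alg.FreeOb)).trans ?_
        refine Eq.trans ?_ (cell_eqToHom_comp_app (strMap_comp_counit f) (A.counit ◁ s)
          (PsAlg.FreeOb.of a : A.alg.FreeOb)).symm
        -- At a letter both sides are the component of `s` at `a`: the unit followed by the counit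
        -- is the identity, used for morphisms of `B` and for objects of `A`.
        refine (congrArg (PsMor.fn B.counit.mor).mor (strMap₂_app_of s.cell a)).trans ?_
        refine (congrArg (fun k : B.alg ⟶ B.alg => (PsMor.fn k).mor
          ((AlgCell.toGTrans s.cell).app a)) (unitMor_comp_counit B)).trans ?_
        exact congrArg (AlgCell.toGTrans s.cell).app
          (congrArg (fun k : A.alg ⟶ A.alg => (PsMor.fn k).obj a) (unitMor_comp_counit A)).symm }
  left_triangle X := by
    -- Both strict maps restrict to `unitMor` along the unit.
    refine hom_ext ?_
    change X.unitMor ≫ (strMap X.unitMor).mor ≫ X.str.counit.mor = X.unitMor ≫ 𝟙 X.str.alg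
    rw [← PsAlg.assoc_eq, unitMor_comp_strMap, PsAlg.assoc_eq, unitMor_comp_counit]
  right_triangle T := unitMor_comp_counit T

end StrictAlg

end

end GSym

theorem corollary0p4 (G : Type u) [Group G] :
    ∃ (St : CategoryTheory.StrictPseudofunctor (GSym.SymMonGCat G) (GSym.PermGCat G))
      (adj : GSym.TwoAdjunction St (GSym.inclusion (GSym.permOperadG G))),
      ∀ X : GSym.SymMonGCat G,
        ∃ e : CategoryTheory.Bicategory.Equivalence X
            ((GSym.inclusion (GSym.permOperadG G)).obj (St.obj X)),
          e.hom = adj.unit.app X :=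
  ⟨GSym.StrictAlg.strictification _, GSym.StrictAlg.strictificationAdjunction _,
    fun X => ⟨X.unitEquivalence, rfl⟩⟩
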